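/- Let $0<\theta<1$. For a measure space $(X,\mu)$, a measurable $g:X\to[0,\infty]$ and exponents $p,r\in(0,\infty]$ put $$\|g\|_{L^{p,r}(X)}=\big\|\rho\,\mu(\{g\ge\rho\})^{1/p}\big\|_{L^r((0,\infty),\rho^{-1}d\rho)}$$ (for $p=r=\infty$ this is the essential supremum). For a couple of quasi-normed spaces $A_0,A_1$ contained in a common vector space put $$K(s,a)=\inf_{a_0+a_1=a}\|a_0\|_{A_0}+s\|a_1\|_{A_1},\qquad \|a\|_{(A_0,A_1)_{\theta,q}}=\Big(\int_0^\infty s^{-\theta q-1}K(s,a)^q\,ds\Big)^{1/q}$$ for $0<q<\infty$, and $\|a\|_{(A_0,A_1)_{\theta,\infty}}=\sup_{s>0}s^{-\theta}K(s,a)$; the space $(A_0,A_1)_{\theta,q}$ consists of all $a\in A_0+A_1$ for which this is finite. For a Banach space $A$, $L^{p,r}(X;A)$ is the space of (a.e. classes of) strongly measurable $f:X\to A$ with $\|f\|_{L^{p,r}(X;A)}:=\big\|\,\|f(\cdot)\|_A\big\|_{L^{p,r}(X)}<\infty$; likewise $L^{p,r}(X;(A_0,A_1)_{\theta,q})$ is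 the space of strongly measurable $f:X\to A_0+A_1$ with $f(x)\in(A_0,A_1)_{\theta,q}$ for almost every $x$ and $\big\|\,\|f(\cdot)\|_{(A_0,A_1)_{\theta,q}}\big\|_{L^{p,r}(X)}<\infty$. **Theorem 2.** Let $(X,\mu)$ be a $\sigma$-finite measure space and $(A_0,A_1)$ a compatible couple of Banach spaces, that is, both are continuously embedded in a common Hausdorff topological vector space. (i) If $0<q<p<\infty$ and $q\le r\le\infty$, or if $0<p=q=r\le\infty$, then $$(L^{p,r}(X;A_0),L^{p,r}(X;A_1))_{\theta,q}\subset L^{p,r}(X;(A_0,A_1)_{\theta,q}).$$ (ii) If $0<p<q\le\infty$ and $0<r\le q$, or if $0<p=q=r\le\infty$, then $$(L^{p,r}(X;A_0),L^{p,r}(X;A_1))_{\theta,q}\supset L^{p,r}(X;(A_0,A_1)_{\theta,q}).$$ Both inclusions are continuous: the quasi-norm of the larger space is at most $C$ times that of the smaller one, where $C<\infty$ depends only on $p,q,r,\theta$. -/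

import Mathlib

open MeasureTheory Filter Topology
open scoped ENNReal NNReal

/-- The measure `dρ / ρ` on the half line `(0, ∞)`. -/
noncomputable def haarHalfLine : Measure ℝ :=
  (volume.restrict (Set.Ioi (0 : ℝ))).withDensity (fun ρ => ENNReal.ofReal ρ⁻¹)

/-- The Lorentz quasi-norm `‖ ρ μ(g ≥ ρ)^(1/p) ‖` in `L^r((0,∞), dρ/ρ)` of a function `g ≥ 0`,
with values in `[0, ∞]`. For `p = ∞` the exponent `1/p` is `0` and `0^0` is read as `0`, so that
`p = r = ∞` gives the essential supremum of `g`. -/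
noncomputable def lorentzENorm {X : Type*} [MeasurableSpace X] (p r : ℝ≥0∞) (μ : Measure X)
    (g : X → ℝ≥0∞) : ℝ≥0∞ :=
  open Classical in
  eLpNorm
    (fun ρ : ℝ => ENNReal.ofReal ρ *
      (if μ {x | ENNReal.ofReal ρ ≤ g x} = 0 then 0
        else μ {x | ENNReal.ofReal ρ ≤ g x} ^ (1 / p.toReal)))
    r haarHalfLine

/-! ### Real interpolation

A (quasi-)normed space contained in an ambient vector space `E` is given by its quasi-norm
`N : E → [0, ∞]`, equal to `∞` off the space; the space is `{u | N u < ∞}`. -/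

/-- Peetre's functional `K(s, u) = inf {N₀ u₀ + s N₁ u₁ | u₀ + u₁ = u}`; it is `∞` when `u` is not
in the sum of the two spaces. -/
noncomputable def peetreK {E : Type*} [Add E] (N₀ N₁ : E → ℝ≥0∞) (s : ℝ) (u : E) : ℝ≥0∞ :=
  ⨅ (u₀ : E) (u₁ : E) (_ : u₀ + u₁ = u), N₀ u₀ + ENNReal.ofReal s * N₁ u₁

/-- The quasi-norm of the real interpolation space: the norm of `s ↦ s^(-θ) K(s, u)` in
`L^q((0,∞), ds/s)`, that is `(∫ s^(-θq-1) K(s,u)^q ds)^(1/q)` if `q < ∞` and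
`sup_s s^(-θ) K(s,u)` if `q = ∞`. -/
noncomputable def interpENorm {E : Type*} [Add E] (N₀ N₁ : E → ℝ≥0∞) (θ : ℝ) (q : ℝ≥0∞)
    (u : E) : ℝ≥0∞ :=
  eLpNorm (fun s : ℝ => ENNReal.ofReal (s ^ (-θ)) * peetreK N₀ N₁ s u) q haarHalfLine

/-- The quasi-norm that `A` induces on an ambient space `U` through a map `ι : A → U`
(injective in all uses); it is `∞` off the range of `ι`. -/
noncomputable def inducedENorm {A U : Type*} [ENorm A] (ι : A → U) (u : U) : ℝ≥0∞ :=
  ⨅ (a : A) (_ : ι a = u), ‖a‖ₑ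

/-- A compatible couple: `A₀` and `A₁` are continuously and injectively embedded in `U`
(used for Banach spaces `A₀`, `A₁` and a Hausdorff topological vector space `U`). -/
structure CompatibleCouple (𝕜 A₀ A₁ U : Type*) [RCLike 𝕜]
    [NormedAddCommGroup A₀] [NormedSpace 𝕜 A₀] [NormedAddCommGroup A₁] [NormedSpace 𝕜 A₁]
    [AddCommGroup U] [Module 𝕜 U] [TopologicalSpace U] where
  ι₀ : A₀ →L[𝕜] U
  ι₁ : A₁ →L[𝕜] U
  injective₀ : Function.Injective ι₀
  injective₁ : Function.Injective ι₁

namespace CompatibleCouple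

variable {𝕜 A₀ A₁ U : Type*} [RCLike 𝕜]
  [NormedAddCommGroup A₀] [NormedSpace 𝕜 A₀] [NormedAddCommGroup A₁] [NormedSpace 𝕜 A₁]
  [AddCommGroup U] [Module 𝕜 U] [TopologicalSpace U]

/-- `K(s, u; A₀, A₁)` for `u` in the ambient space. -/
noncomputable def K (c : CompatibleCouple 𝕜 A₀ A₁ U) (s : ℝ) (u : U) : ℝ≥0∞ :=
  peetreK (inducedENorm c.ι₀) (inducedENorm c.ι₁) s u

/-- The quasi-norm of `(A₀, A₁)_{θ,q}` on the ambient space. -/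
noncomputable def interp (c : CompatibleCouple 𝕜 A₀ A₁ U) (θ : ℝ) (q : ℝ≥0∞) (u : U) : ℝ≥0∞ :=
  interpENorm (inducedENorm c.ι₀) (inducedENorm c.ι₁) θ q u

/-- `f` is (almost everywhere) strongly measurable as a function with values in the normed space
`A₀ + A₁`, whose norm is `K(1, ·)`: it is almost everywhere the limit, in `A₀ + A₁`, of a sequence
of simple functions with values in `A₀ + A₁`. -/
def AEStronglyMeasurableSum {X : Type*} [MeasurableSpace X] (c : CompatibleCouple 𝕜 A₀ A₁ U)
    (μ : Measure X) (f : X → U) : Prop :=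
  ∃ φ : ℕ → SimpleFunc X U, (∀ n x, c.K 1 (φ n x) < ∞) ∧
    ∀ᵐ x ∂μ, Tendsto (fun n => c.K 1 (f x - φ n x)) atTop (𝓝 0)

end CompatibleCouple

/-- The quasi-norm of `L^{p,r}(X; A)`, for a Banach space `A` embedded in `U` through `ι`, on
functions `f : X → U`. It is the Lorentz quasi-norm of `x ↦ ‖g x‖` if `f` agrees almost everywhere
with `ι ∘ g` for a strongly measurable `g : X → A`, and `∞` if there is no such `g`. -/
noncomputable def lorentzBochnerENorm {X A U : Type*} [MeasurableSpace X] [NormedAddCommGroup A]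
    (ι : A → U) (p r : ℝ≥0∞) (μ : Measure X) (f : X → U) : ℝ≥0∞ :=
  ⨅ (g : X → A) (_ : AEStronglyMeasurable g μ) (_ : (fun x => ι (g x)) =ᵐ[μ] f),
    lorentzENorm p r μ (fun x => ‖g x‖ₑ)

namespace CompatibleCouple

variable {𝕜 A₀ A₁ U : Type*} [RCLike 𝕜]
  [NormedAddCommGroup A₀] [NormedSpace 𝕜 A₀] [NormedAddCommGroup A₁] [NormedSpace 𝕜 A₁]
  [AddCommGroup U] [Module 𝕜 U] [TopologicalSpace U]

/-- The quasi-norm of `(L^{p,r}(X; A₀), L^{p,r}(X; A₁))_{θ,q}`. -/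
noncomputable def interpOfLorentz {X : Type*} [MeasurableSpace X]
    (c : CompatibleCouple 𝕜 A₀ A₁ U) (p r : ℝ≥0∞) (μ : Measure X) (θ : ℝ) (q : ℝ≥0∞)
    (f : X → U) : ℝ≥0∞ :=
  interpENorm (lorentzBochnerENorm c.ι₀ p r μ) (lorentzBochnerENorm c.ι₁ p r μ) θ q f

/-- The quasi-norm of `L^{p,r}(X; (A₀, A₁)_{θ,q})`: the Lorentz quasi-norm of
`x ↦ ‖f x‖_{(A₀, A₁)_{θ,q}}` for `f` strongly measurable with values in `A₀ + A₁`, and `∞` for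
other `f`. Where it is finite, `f x` lies in `(A₀, A₁)_{θ,q}` for almost every `x`. -/
noncomputable def lorentzOfInterp {X : Type*} [MeasurableSpace X]
    (c : CompatibleCouple 𝕜 A₀ A₁ U) (p r : ℝ≥0∞) (μ : Measure X) (θ : ℝ) (q : ℝ≥0∞)
    (f : X → U) : ℝ≥0∞ :=
  ⨅ (_ : c.AEStronglyMeasurableSum μ f), lorentzENorm p r μ (fun x => c.interp θ q (f x))

end CompatibleCouple

/-! Sampling `s` at powers of two turns an interpolation quasi-norm into a weighted `ℓ^q` norm of `k
↦ K(2^k, ·)` (`exists_eLpNorm_equiv_dyadicENorm`). Each inclusion then has two ingredients: a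
comparison of the two `K`-functionals at a fixed `s`, and an exchange of `ℓ^q` with `L^{p,r}`.

Comparison. Up to constants, `K(s, f)` for the couple of Lorentz spaces is the `L^{p,r}` quasi-norm
of `x ↦ K(s, f x)`. In one direction, a splitting of `f` splits almost every value `f x`. In the
other, the values `f x` have to be split almost optimally and measurably in `x`;
`AEStronglyMeasurableSum.exists_decomposition` does this by a telescoping series through a countable
set of values.

Exchange. Since `‖g‖^q` in `L^{p,r}` is a multiple of the quasi-norm of `g^q` in `L^{p/q,r/q}`
(`lorentzENorm_rpow`), for finite `q` it is enough to have a countable triangle inequality in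
`L^{p,R}` for `p > 1`, `R ≥ 1` (`exists_lorentzENorm_tsum_le`) and its reverse for `p < 1`, `R ≤ 1`
(`exists_tsum_lorentzENorm_le`). Both come from an equivalent expression `‖t^(1/p-1) Φ_t(g)‖` in
`L^R(dt/t)`. For `p > 1` take `Φ_t(g) = ∫ min(μ(g ≥ ρ), t) dρ = inf_a (∫ (g-a)₊ + t a)`, which is
subadditive as an infimum; Minkowski's inequality in `L^R` finishes. For `p < 1` take `Φ_t(g) = ∫
(μ(g ≥ ρ) - t)₊ dρ = sup_a (∫ min(g,a) - t a)`, which is superadditive, and so is the `L^R`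
quasi-norm on nonnegative functions. The equivalences are Hardy-type estimates, obtained from a
truncation bound with an auxiliary exponent strictly between `1/p` and `1`. For `p = q = r < ∞` the
exchange is Tonelli's theorem, and for `q = ∞` it concerns suprema. -/

/-! ### The measure `dρ/ρ` in logarithmic coordinates -/

theorem haarHalfLine_eq_map_exp : haarHalfLine = Measure.map Real.exp volume := by
  ext s hs
  have hm : MeasurableSet (Real.exp ⁻¹' s) := Real.measurable_exp hs
  rw [haarHalfLine, withDensity_apply _ hs, Measure.restrict_restrict hs,
    Measure.map_apply Real.measurable_exp hs]
  have him : s ∩ Set.Ioi 0 = Real.exp '' (Real.exp ⁻¹' s) := by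
    rw [Set.image_preimage_eq_inter_range, Real.range_exp]
  rw [him, lintegral_image_eq_lintegral_abs_deriv_mul hm
    (fun x _ => (Real.hasDerivAt_exp x).hasDerivWithinAt) Real.exp_injective.injOn]
  have : ∀ x : ℝ, ENNReal.ofReal |Real.exp x| * ENNReal.ofReal (Real.exp x)⁻¹ = 1 := by
    intro x
    rw [abs_of_pos (Real.exp_pos x), ← ENNReal.ofReal_mul (Real.exp_pos x).le,
      mul_inv_cancel₀ (Real.exp_pos x).ne', ENNReal.ofReal_one]
  simp_rw [this]
  simp

theorem measurableEmbedding_exp : MeasurableEmbedding Real.exp :=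
  Real.continuous_exp.measurableEmbedding Real.exp_injective

theorem lintegral_haarHalfLine (F : ℝ → ℝ≥0∞) :
    ∫⁻ ρ, F ρ ∂haarHalfLine = ∫⁻ x, F (Real.exp x) := by
  rw [haarHalfLine_eq_map_exp, measurableEmbedding_exp.lintegral_map]

theorem ae_haarHalfLine_iff {P : ℝ → Prop} :
    (∀ᵐ ρ ∂haarHalfLine, P ρ) ↔ ∀ᵐ x : ℝ, P (Real.exp x) := by
  rw [haarHalfLine_eq_map_exp, measurableEmbedding_exp.ae_map_iff]

theorem ae_haarHalfLine_pos : ∀ᵐ ρ ∂haarHalfLine, 0 < ρ :=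
  ae_haarHalfLine_iff.2 (.of_forall Real.exp_pos)

instance : SigmaFinite haarHalfLine := by
  rw [haarHalfLine_eq_map_exp]
  exact measurableEmbedding_exp.sigmaFinite_map

instance : NullSingletonClass haarHalfLine := by
  rw [haarHalfLine_eq_map_exp]
  refine ⟨fun x => ?_⟩
  rw [measurableEmbedding_exp.map_apply]
  exact (Set.subsingleton_singleton.preimage Real.exp_injective).measure_zero _

/-- In the coordinate `log ρ` a dilation is a translation. -/
theorem map_const_mul_haarHalfLine {c : ℝ} (hc : 0 < c) :
    Measure.map (fun ρ => c * ρ) haarHalfLine = haarHalfLine := by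
  conv_rhs => rw [haarHalfLine_eq_map_exp, ← map_add_left_eq_self volume (Real.log c),
    Measure.map_map Real.measurable_exp (measurable_const_add _)]
  rw [haarHalfLine_eq_map_exp, Measure.map_map (measurable_const_mul c) Real.measurable_exp]
  congr 1
  funext x
  simp [Real.exp_add, Real.exp_log hc]

/-- In the coordinate `log ρ` a power is multiplication by `q`, which produces the factor `1/q`. -/
theorem map_rpow_haarHalfLine {q : ℝ} (hq : 0 < q) :
    Measure.map (fun ρ : ℝ => ρ ^ q) haarHalfLine = ENNReal.ofReal q⁻¹ • haarHalfLine := by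
  have h := Real.map_volume_mul_left hq.ne'
  rw [abs_of_pos (inv_pos.2 hq)] at h
  rw [haarHalfLine_eq_map_exp, ← Measure.map_smul, ← h,
    Measure.map_map Real.measurable_exp (measurable_const_mul q),
    Measure.map_map (g := fun ρ : ℝ => ρ ^ q) (by fun_prop) Real.measurable_exp]
  congr 1
  funext x
  simp only [Function.comp]
  rw [← Real.exp_mul, mul_comm]

theorem eLpNorm_comp_const_mul_haarHalfLine {F : ℝ → ℝ≥0∞} (hF : Measurable F) {c : ℝ}
    (hc : 0 < c) (r : ℝ≥0∞) :
    eLpNorm (fun ρ => F (c * ρ)) r haarHalfLine = eLpNorm F r haarHalfLine := by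
  conv_rhs => rw [← map_const_mul_haarHalfLine hc]
  rw [eLpNorm_map_measure hF.aestronglyMeasurable (by fun_prop)]
  rfl

theorem eLpNorm_comp_rpow_haarHalfLine {F : ℝ → ℝ≥0∞} (hF : Measurable F) {q : ℝ}
    (hq : 0 < q) (r : ℝ≥0∞) :
    eLpNorm (fun ρ : ℝ => F (ρ ^ q)) r haarHalfLine
      = ENNReal.ofReal q⁻¹ ^ (1 / r).toReal * eLpNorm F r haarHalfLine := by
  have h0 : ENNReal.ofReal q⁻¹ ≠ 0 := by simpa using hq
  rw [← smul_eq_mul, ← eLpNorm_smul_measure_of_ne_zero h0, ← map_rpow_haarHalfLine hq,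
    eLpNorm_map_measure hF.aestronglyMeasurable (by fun_prop)]
  rfl

theorem eLpNorm_const_mul_le_ennreal {α : Type*} [MeasurableSpace α] {μ : Measure α} {c : ℝ≥0∞}
    (hc : c ≠ ∞) (f : α → ℝ≥0∞) (p : ℝ≥0∞) :
    eLpNorm (fun x => c * f x) p μ ≤ c * eLpNorm f p μ := by
  lift c to ℝ≥0 using hc
  exact eLpNorm_le_nnreal_smul_eLpNorm_of_ae_le_mul' (.of_forall fun x => by simp) p

theorem eLpNorm_const_mul_ennreal {α : Type*} [MeasurableSpace α] {μ : Measure α} {c : ℝ≥0∞}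
    (h0 : c ≠ 0) (hc : c ≠ ∞) (f : α → ℝ≥0∞) (p : ℝ≥0∞) :
    eLpNorm (fun x => c * f x) p μ = c * eLpNorm f p μ := by
  refine le_antisymm (eLpNorm_const_mul_le_ennreal hc f p) ?_
  have := eLpNorm_const_mul_le_ennreal (μ := μ) (ENNReal.inv_ne_top.2 h0) (fun x => c * f x) p
  simp only [← mul_assoc, ENNReal.inv_mul_cancel h0 hc, one_mul] at this
  calc c * eLpNorm f p μ ≤ c * (c⁻¹ * eLpNorm (fun x => c * f x) p μ) := by gcongr
    _ = _ := by rw [← mul_assoc, ENNReal.mul_inv_cancel h0 hc, one_mul]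

theorem ofReal_exp_rpow (x a : ℝ) :
    ENNReal.ofReal (Real.exp x) ^ a = ENNReal.ofReal (Real.exp (a * x)) := by
  rw [ENNReal.ofReal_rpow_of_pos (Real.exp_pos x), ← Real.exp_mul, mul_comm]

theorem setLIntegral_ofReal_le_rpow_ne_top {a : ℝ} (ha : 0 < a) {D : ℝ≥0∞} (hD : D ≠ ∞) :
    ∫⁻ t in {t | ENNReal.ofReal t ≤ D}, ENNReal.ofReal t ^ a ∂haarHalfLine
      = ENNReal.ofReal a⁻¹ * D ^ a := by
  have hm : MeasurableSet {t | ENNReal.ofReal t ≤ D} :=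
    measurableSet_le ENNReal.measurable_ofReal measurable_const
  rw [← lintegral_indicator hm, lintegral_haarHalfLine]
  rcases eq_or_ne D 0 with rfl | h0
  · simp [Set.indicator, not_le.2 (Real.exp_pos _), ha]
  obtain ⟨c, rfl⟩ : ∃ c : ℝ, D = ENNReal.ofReal (Real.exp c) :=
    ⟨Real.log D.toReal, by
      rw [Real.exp_log (ENNReal.toReal_pos h0 hD), ENNReal.ofReal_toReal hD]⟩
  have : ∀ x : ℝ, ({t | ENNReal.ofReal t ≤ ENNReal.ofReal (Real.exp c)}.indicator
      (fun t => ENNReal.ofReal t ^ a) (Real.exp x))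
      = (Set.Iic c).indicator (fun x => ENNReal.ofReal (Real.exp (a * x))) x := by
    intro x
    simp [Set.indicator, ENNReal.ofReal_le_ofReal_iff (Real.exp_pos c).le, ofReal_exp_rpow]
  simp_rw [this]
  rw [lintegral_indicator measurableSet_Iic,
    ← ofReal_integral_eq_lintegral_ofReal (integrableOn_exp_mul_Iic ha c)
      (.of_forall fun x => (Real.exp_pos _).le), integral_exp_mul_Iic ha, ofReal_exp_rpow,
    ← ENNReal.ofReal_mul (inv_pos.2 ha).le]
  congr 1; ring

theorem setLIntegral_ofReal_le_rpow {a : ℝ} (ha : 0 < a) (D : ℝ≥0∞) :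
    ∫⁻ t in {t | ENNReal.ofReal t ≤ D}, ENNReal.ofReal t ^ a ∂haarHalfLine
      = ENNReal.ofReal a⁻¹ * D ^ a := by
  rcases eq_or_ne D ∞ with rfl | hD
  · have hc : ENNReal.ofReal a⁻¹ ≠ 0 := by simpa using ha
    rw [ENNReal.top_rpow_of_pos ha, ENNReal.mul_top hc, eq_top_iff]
    -- An infinite endpoint is reached as the limit of the endpoints `n`.
    have hlim : Tendsto (fun n : ℕ => ENNReal.ofReal a⁻¹ * (n : ℝ≥0∞) ^ a) atTop (𝓝 ∞) := by
      have h1 := (ENNReal.continuous_rpow_const (y := a)).tendsto ∞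
      rw [ENNReal.top_rpow_of_pos ha] at h1
      have h2 := ENNReal.Tendsto.const_mul (h1.comp ENNReal.tendsto_nat_nhds_top)
        (a := ENNReal.ofReal a⁻¹) (.inl (by simp))
      rwa [ENNReal.mul_top hc] at h2
    refine le_of_tendsto' hlim fun n => ?_
    rw [← setLIntegral_ofReal_le_rpow_ne_top ha (ENNReal.natCast_ne_top n)]
    exact lintegral_mono_set fun t _ => le_top (α := ℝ≥0∞)
  · exact setLIntegral_ofReal_le_rpow_ne_top ha hD

theorem setOf_ofReal_lt_ae_eq_le (D : ℝ≥0∞) :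
    ({t : ℝ | ENNReal.ofReal t < D} : Set ℝ) =ᵐ[haarHalfLine]
      ({t : ℝ | ENNReal.ofReal t ≤ D} : Set ℝ) := by
  have h1 : ∀ᵐ t ∂haarHalfLine, t ≠ D.toReal := Measure.ae_ne _ _
  filter_upwards [h1, ae_haarHalfLine_pos] with t ht hpos
  refine propext ⟨fun h => le_of_lt h, fun h => lt_of_le_of_ne h fun h' => ht ?_⟩
  have : ENNReal.ofReal t = D := h'
  rw [← this, ENNReal.toReal_ofReal hpos.le]

theorem setLIntegral_ofReal_lt_rpow {a : ℝ} (ha : 0 < a) (D : ℝ≥0∞) :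
    ∫⁻ t in {t | ENNReal.ofReal t < D}, ENNReal.ofReal t ^ a ∂haarHalfLine
      = ENNReal.ofReal a⁻¹ * D ^ a := by
  rw [← setLIntegral_ofReal_le_rpow ha]
  exact setLIntegral_congr (setOf_ofReal_lt_ae_eq_le D)

theorem setLIntegral_lt_ofReal_rpow_neg {a : ℝ} (ha : 0 < a) {D : ℝ≥0∞} (h0 : D ≠ 0) :
    ∫⁻ t in {t | D < ENNReal.ofReal t}, ENNReal.ofReal t ^ (-a) ∂haarHalfLine
      = ENNReal.ofReal a⁻¹ * D ^ (-a) := by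
  rcases eq_or_ne D ∞ with rfl | hD
  · simp [ha]
  have hm : MeasurableSet {t | D < ENNReal.ofReal t} :=
    measurableSet_lt measurable_const ENNReal.measurable_ofReal
  rw [← lintegral_indicator hm, lintegral_haarHalfLine]
  obtain ⟨c, rfl⟩ : ∃ c : ℝ, D = ENNReal.ofReal (Real.exp c) :=
    ⟨Real.log D.toReal, by
      rw [Real.exp_log (ENNReal.toReal_pos h0 hD), ENNReal.ofReal_toReal hD]⟩
  have : ∀ x : ℝ, ({t | ENNReal.ofReal (Real.exp c) < ENNReal.ofReal t}.indicator
      (fun t => ENNReal.ofReal t ^ (-a)) (Real.exp x))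
      = (Set.Ioi c).indicator (fun x => ENNReal.ofReal (Real.exp (-a * x))) x := by
    intro x
    simp [Set.indicator, ENNReal.ofReal_lt_ofReal_iff (Real.exp_pos x), ofReal_exp_rpow]
  simp_rw [this]
  rw [lintegral_indicator measurableSet_Ioi,
    ← ofReal_integral_eq_lintegral_ofReal (integrableOn_exp_mul_Ioi (neg_lt_zero.2 ha) c)
      (.of_forall fun x => (Real.exp_pos _).le), integral_exp_mul_Ioi (neg_lt_zero.2 ha),
    ofReal_exp_rpow, ← ENNReal.ofReal_mul (inv_pos.2 ha).le]
  congr 1; ring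

/-! ### Dyadic discretisation -/

/-- Each dyadic interval has `dρ/ρ`-measure `log 2`. The shift `m` selects which endpoint of the
interval represents it. -/
theorem map_floor_logb_haarHalfLine (m : ℤ) :
    Measure.map (fun ρ : ℝ => ⌊Real.logb 2 ρ⌋ + m) haarHalfLine
      = ENNReal.ofReal (Real.log 2) • Measure.count := by
  have hl : 0 < Real.log 2 := Real.log_pos one_lt_two
  have hlog : Measurable fun ρ : ℝ => Real.logb 2 ρ := Real.measurable_log.div_const _
  have hmeas : Measurable fun ρ : ℝ => ⌊Real.logb 2 ρ⌋ + m :=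
    (Int.measurable_floor.comp hlog).add_const m
  refine Measure.ext_of_singleton fun k => ?_
  rw [Measure.map_apply hmeas (measurableSet_singleton k), haarHalfLine_eq_map_exp,
    measurableEmbedding_exp.map_apply]
  have : Real.exp ⁻¹' ((fun ρ : ℝ => ⌊Real.logb 2 ρ⌋ + m) ⁻¹' {k})
      = Set.Ico ((k - m : ℤ) * Real.log 2) (((k - m : ℤ) + 1) * Real.log 2) := by
    ext x
    simp only [Set.mem_preimage, Set.mem_singleton_iff, Set.mem_Ico]
    rw [← eq_sub_iff_add_eq, Int.floor_eq_iff, Real.logb, Real.log_exp, le_div_iff₀ hl,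
      div_lt_iff₀ hl]
  rw [this, Real.volume_Ico]
  simp [add_mul]

theorem eLpNorm_comp_floor_logb (G : ℤ → ℝ≥0∞) (q : ℝ≥0∞) (m : ℤ) :
    eLpNorm (fun ρ : ℝ => G (⌊Real.logb 2 ρ⌋ + m)) q haarHalfLine
      = ENNReal.ofReal (Real.log 2) ^ (1 / q).toReal * eLpNorm G q Measure.count := by
  have hl : 0 < Real.log 2 := Real.log_pos one_lt_two
  have h0 : ENNReal.ofReal (Real.log 2) ≠ 0 := by simpa using hl
  have hlog : Measurable fun ρ : ℝ => Real.logb 2 ρ := Real.measurable_log.div_const _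
  have hmeas : Measurable fun ρ : ℝ => ⌊Real.logb 2 ρ⌋ + m :=
    (Int.measurable_floor.comp hlog).add_const m
  rw [← smul_eq_mul, ← eLpNorm_smul_measure_of_ne_zero h0, ← map_floor_logb_haarHalfLine m,
    eLpNorm_map_measure Measurable.of_discrete.aestronglyMeasurable hmeas.aemeasurable]
  rfl

/-- The discrete counterpart of the norm of `s ↦ s^(-θ) φ(s)` in `L^q(ds/s)`. -/
noncomputable def dyadicENorm (θ : ℝ) (q : ℝ≥0∞) (φ : ℤ → ℝ≥0∞) : ℝ≥0∞ :=
  eLpNorm (fun k : ℤ => ENNReal.ofReal (((2 : ℝ) ^ k) ^ (-θ)) * φ k) q Measure.count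

theorem dyadicENorm_mono {θ : ℝ} {q : ℝ≥0∞} {φ ψ : ℤ → ℝ≥0∞} (h : ∀ k, φ k ≤ ψ k) :
    dyadicENorm θ q φ ≤ dyadicENorm θ q ψ :=
  eLpNorm_mono_enorm fun k => by simpa using by gcongr; exact h k

theorem dyadicENorm_const_mul_le {θ : ℝ} {q : ℝ≥0∞} {c : ℝ≥0∞} (hc : c ≠ ∞) (φ : ℤ → ℝ≥0∞) :
    dyadicENorm θ q (fun k => c * φ k) ≤ c * dyadicENorm θ q φ := by
  simp only [dyadicENorm, mul_left_comm _ c]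
  exact eLpNorm_const_mul_le_ennreal hc _ _

/-- On `[2^k, 2^(k+1)]` the weight varies by a factor `2^θ` at most, and a monotone `φ` lies between
its two endpoint values. -/
theorem exists_eLpNorm_equiv_dyadicENorm {θ : ℝ} (hθ : 0 ≤ θ) (q : ℝ≥0∞) :
    ∃ C : ℝ≥0, ∀ φ : ℝ → ℝ≥0∞, Monotone φ →
      eLpNorm (fun s : ℝ => ENNReal.ofReal (s ^ (-θ)) * φ s) q haarHalfLine
        ≤ C * dyadicENorm θ q (fun k => φ (2 ^ k)) ∧
      dyadicENorm θ q (fun k => φ (2 ^ k))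
        ≤ C * eLpNorm (fun s : ℝ => ENNReal.ofReal (s ^ (-θ)) * φ s) q haarHalfLine := by
  have hl : 0 < Real.log 2 := Real.log_pos one_lt_two
  set a : ℝ≥0∞ := ENNReal.ofReal (2 ^ θ) with ha
  set b : ℝ≥0∞ := ENNReal.ofReal (Real.log 2) ^ (1 / q).toReal with hb
  have hatop : a ≠ ∞ := ENNReal.ofReal_ne_top
  have hb0 : b ≠ 0 := (ENNReal.rpow_pos (by simpa using hl) ENNReal.ofReal_ne_top).ne'
  have hbtop : b ≠ ∞ := ENNReal.rpow_ne_top_of_nonneg ENNReal.toReal_nonneg ENNReal.ofReal_ne_top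
  -- Here `a` is the variation of the weight over one dyadic interval and `b` converts counting
  -- measure into `dρ/ρ`; one bound uses `b`, the other `b⁻¹`.
  refine ⟨(a * (b + b⁻¹)).toNNReal, fun φ hφ => ?_⟩
  rw [ENNReal.coe_toNNReal (ENNReal.mul_ne_top hatop
    (ENNReal.add_ne_top.2 ⟨hbtop, ENNReal.inv_ne_top.2 hb0⟩))]
  set G : ℤ → ℝ≥0∞ := fun k => ENNReal.ofReal (((2 : ℝ) ^ k) ^ (-θ)) * φ (2 ^ k) with hG
  have hpow : ∀ s : ℝ, 0 < s → (2 : ℝ) ^ ⌊Real.logb 2 s⌋ ≤ s ∧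
      s ≤ (2 : ℝ) ^ (⌊Real.logb 2 s⌋ + 1) := by
    intro s hs
    rw [← Real.rpow_intCast, ← Real.rpow_intCast]
    refine ⟨?_, ?_⟩
    · rw [← Real.le_logb_iff_rpow_le one_lt_two hs]; exact Int.floor_le _
    · rw [← Real.logb_le_iff_le_rpow one_lt_two hs]
      push_cast; exact (Int.lt_floor_add_one _).le
  have hstep : ∀ k : ℤ, ENNReal.ofReal (((2 : ℝ) ^ k) ^ (-θ))
      = a * ENNReal.ofReal (((2 : ℝ) ^ (k + 1)) ^ (-θ)) := by
    intro k
    rw [ha, ← ENNReal.ofReal_mul (by positivity), zpow_add_one₀ two_ne_zero,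
      Real.mul_rpow (by positivity) (by positivity), mul_left_comm, ← Real.rpow_add two_pos]
    simp
  have hanti : ∀ s t : ℝ, 0 < s → s ≤ t →
      ENNReal.ofReal (t ^ (-θ)) ≤ ENNReal.ofReal (s ^ (-θ)) := fun s t hs hst =>
    ENNReal.ofReal_le_ofReal (Real.rpow_le_rpow_of_nonpos hs hst (by linarith))
  have hDef : dyadicENorm θ q (fun k => φ (2 ^ k)) = eLpNorm G q Measure.count := rfl
  rw [hDef]
  constructor
  · calc eLpNorm (fun s : ℝ => ENNReal.ofReal (s ^ (-θ)) * φ s) q haarHalfLine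
        ≤ eLpNorm (fun s : ℝ => a * G (⌊Real.logb 2 s⌋ + 1)) q haarHalfLine := by
          refine eLpNorm_mono_enorm_ae ?_
          filter_upwards [ae_haarHalfLine_pos] with s hs
          simp only [enorm_eq_self, hG, ← mul_assoc]
          rw [← hstep]
          exact mul_le_mul' (hanti _ _ (by positivity) (hpow s hs).1) (hφ (hpow s hs).2)
      _ ≤ a * (b * eLpNorm G q Measure.count) := by
          refine (eLpNorm_const_mul_le_ennreal hatop _ _).trans ?_
          rw [eLpNorm_comp_floor_logb G q 1]
      _ ≤ a * (b + b⁻¹) * eLpNorm G q Measure.count := by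
          rw [← mul_assoc]; gcongr; exact le_self_add
  · have h1 : b * eLpNorm G q Measure.count
        ≤ a * eLpNorm (fun s : ℝ => ENNReal.ofReal (s ^ (-θ)) * φ s) q haarHalfLine := by
      rw [← eLpNorm_comp_floor_logb G q 0]
      refine le_trans (eLpNorm_mono_enorm_ae ?_) (eLpNorm_const_mul_le_ennreal hatop _ _)
      filter_upwards [ae_haarHalfLine_pos] with s hs
      simp only [enorm_eq_self, hG, add_zero]
      rw [hstep, mul_assoc]
      exact mul_le_mul_right (mul_le_mul' (hanti _ _ hs (hpow s hs).2) (hφ (hpow s hs).1)) a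
    calc eLpNorm G q Measure.count = b⁻¹ * (b * eLpNorm G q Measure.count) := by
          rw [← mul_assoc, ENNReal.inv_mul_cancel hb0 hbtop, one_mul]
      _ ≤ (b + b⁻¹) * (a * _) := by gcongr; exact le_add_self
      _ = _ := by ring

/-! ### Minkowski's inequality for series, and its reverse for exponents at most one -/

section Minkowski

variable {α ι : Type*} [MeasurableSpace α] {μ : Measure α}

theorem eLpNorm_tsum_le_ennreal [Countable ι] {R : ℝ≥0∞} (hR : 1 ≤ R) {φ : ι → α → ℝ≥0∞}
    (hφ : ∀ i, AEMeasurable (φ i) μ) :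
    eLpNorm (fun x => ∑' i, φ i x) R μ ≤ ∑' i, eLpNorm (φ i) R μ := by
  have h0 : R ≠ 0 := (zero_lt_one.trans_le hR).ne'
  rcases eq_or_ne R ∞ with rfl | htop
  · have h : ∀ᵐ x ∂μ, ∀ i, φ i x ≤ eLpNorm (φ i) ∞ μ := ae_all_iff.2 fun i => by
      simpa using ae_le_eLpNormEssSup (f := φ i) (μ := μ)
    rw [eLpNorm_exponent_top]
    refine essSup_le_of_ae_le _ ?_
    filter_upwards [h] with x hx
    exact ENNReal.tsum_le_tsum hx
  · have hp : 0 < R.toReal := ENNReal.toReal_pos h0 htop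
    have hfin : ∀ s : Finset ι, ∫⁻ x, (∑ i ∈ s, φ i x) ^ R.toReal ∂μ
        ≤ (∑' i, eLpNorm (φ i) R μ) ^ R.toReal := by
      intro s
      have h1 := eLpNorm_sum_le (μ := μ) (s := s) (f := φ)
        (fun i _ => (hφ i).aestronglyMeasurable) hR
      have h2 := h1.trans (ENNReal.sum_le_tsum s)
      rw [eLpNorm_eq_lintegral_rpow_enorm_toReal h0 htop, one_div,
        ENNReal.rpow_inv_le_iff hp] at h2
      simpa using h2
    rw [eLpNorm_eq_lintegral_rpow_enorm_toReal h0 htop, one_div, ENNReal.rpow_inv_le_iff hp]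
    calc ∫⁻ x, ‖∑' i, φ i x‖ₑ ^ R.toReal ∂μ
        = ∫⁻ x, ⨆ s : Finset ι, (∑ i ∈ s, φ i x) ^ R.toReal ∂μ := by
          refine lintegral_congr fun x => ?_
          rw [enorm_eq_self, ENNReal.tsum_eq_iSup_sum]
          exact (ENNReal.orderIsoRpow R.toReal hp).map_iSup _
      _ = ⨆ s : Finset ι, ∫⁻ x, (∑ i ∈ s, φ i x) ^ R.toReal ∂μ := by
          refine lintegral_iSup_directed (fun s => ?_) ?_
          · exact (Finset.aemeasurable_fun_sum s fun i _ => hφ i).pow_const _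
          · refine Monotone.directed_le fun s t hst x => ?_
            exact ENNReal.rpow_le_rpow (Finset.sum_le_sum_of_subset hst) hp.le
      _ ≤ _ := iSup_le hfin

/-- Only finite partial sums matter for a lower bound, so monotonicity replaces any continuity of
`Ψ`. -/
theorem tsum_le_apply_tsum_of_superadditive {Ψ : (α → ℝ≥0∞) → ℝ≥0∞} (hmono : Monotone Ψ)
    (hadd : ∀ f g : α → ℝ≥0∞, AEMeasurable f μ → AEMeasurable g μ → Ψ f + Ψ g ≤ Ψ (f + g))
    {φ : ι → α → ℝ≥0∞} (hφ : ∀ i, AEMeasurable (φ i) μ) :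
    ∑' i, Ψ (φ i) ≤ Ψ (fun x => ∑' i, φ i x) := by
  classical
  rw [ENNReal.tsum_eq_iSup_sum]
  refine iSup_le fun s => ?_
  have h : ∑ i ∈ s, Ψ (φ i) ≤ Ψ (∑ i ∈ s, φ i) := by
    induction s using Finset.induction_on with
    | empty => simp
    | insert i s hi ih =>
      rw [Finset.sum_insert hi, Finset.sum_insert hi]
      exact (add_le_add_right ih _).trans
        (hadd _ _ (hφ i) (Finset.aemeasurable_sum s fun i _ => hφ i))
  refine h.trans (hmono fun x => ?_)
  rw [Finset.sum_apply]
  exact ENNReal.sum_le_tsum s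

/-- Concavity of `y ↦ y^R`: with `a = ‖f‖`, `b = ‖g‖`, the sum `f + g` is `a + b` times the mean of
`f/a` and `g/b` with weights `a/(a+b)` and `b/(a+b)`, and both normalised functions have `∫ (·)^R =
1`. -/
theorem eLpNorm_add_eLpNorm_le_of_le_one {R : ℝ≥0∞} (h0 : R ≠ 0) (hR : R ≤ 1) {f g : α → ℝ≥0∞}
    (hf : AEMeasurable f μ) :
    eLpNorm f R μ + eLpNorm g R μ ≤ eLpNorm (f + g) R μ := by
  have htop : R ≠ ∞ := (hR.trans_lt ENNReal.one_lt_top).ne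
  have hp : 0 < R.toReal := ENNReal.toReal_pos h0 htop
  have hp1 : R.toReal ≤ 1 := by simpa using ENNReal.toReal_mono ENNReal.one_ne_top hR
  have hfm : eLpNorm f R μ ≤ eLpNorm (f + g) R μ :=
    eLpNorm_mono_enorm fun x => by simp
  have hgm : eLpNorm g R μ ≤ eLpNorm (f + g) R μ :=
    eLpNorm_mono_enorm fun x => by simp
  set a := eLpNorm f R μ with ha
  set b := eLpNorm g R μ with hb
  rcases eq_or_ne a 0 with ha0 | ha0
  · simpa [ha0] using hgm
  rcases eq_or_ne b 0 with hb0 | hb0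
  · simpa [hb0] using hfm
  rcases eq_or_ne a ∞ with hat | hat
  · rw [hat, top_le_iff] at hfm; simp [hfm]
  rcases eq_or_ne b ∞ with hbt | hbt
  · rw [hbt, top_le_iff] at hgm; simp [hgm]
  have hab0 : a + b ≠ 0 := by simp [ha0]
  have habt : a + b ≠ ∞ := ENNReal.add_ne_top.2 ⟨hat, hbt⟩
  have hfa : ∫⁻ x, f x ^ R.toReal ∂μ = a ^ R.toReal := by
    rw [ha, eLpNorm_eq_lintegral_rpow_enorm_toReal h0 htop, ← ENNReal.rpow_mul,
      one_div_mul_cancel hp.ne', ENNReal.rpow_one]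
    simp
  have hgb : ∫⁻ x, g x ^ R.toReal ∂μ = b ^ R.toReal := by
    rw [hb, eLpNorm_eq_lintegral_rpow_enorm_toReal h0 htop, ← ENNReal.rpow_mul,
      one_div_mul_cancel hp.ne', ENNReal.rpow_one]
    simp
  rw [eLpNorm_eq_lintegral_rpow_enorm_toReal h0 htop, one_div, ENNReal.le_rpow_inv_iff hp]
  set s := R.toReal
  set w₁ := a / (a + b)
  set w₂ := b / (a + b)
  have hw : w₁ + w₂ = 1 := by
    rw [← ENNReal.add_div, ENNReal.div_self hab0 habt]
  -- Concavity is used as convexity of `y ↦ y^(1/s)`, applied to the `s`-th powers of `f/a` and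
  -- `g/b`.
  have key : ∀ x, (a + b) ^ s * (w₁ * (f x ^ s / a ^ s) + w₂ * (g x ^ s / b ^ s))
      ≤ ‖(f + g) x‖ₑ ^ s := by
    intro x
    have hc := ENNReal.rpow_arith_mean_le_arith_mean2_rpow w₁ w₂ (f x ^ s / a ^ s)
      (g x ^ s / b ^ s) hw (p := s⁻¹) ((one_le_inv₀ hp).2 hp1)
    rw [ENNReal.rpow_inv_le_iff hp, ← ENNReal.div_rpow_of_nonneg _ _ hp.le,
      ← ENNReal.div_rpow_of_nonneg _ _ hp.le, ← ENNReal.rpow_mul, ← ENNReal.rpow_mul,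
      mul_inv_cancel₀ hp.ne', ENNReal.rpow_one, ENNReal.rpow_one] at hc
    have e1 : (a + b) * (w₁ * (f x / a) + w₂ * (g x / b)) = f x + g x := by
      have : ∀ c y : ℝ≥0∞, c ≠ 0 → c ≠ ∞ → (a + b) * (c / (a + b) * (y / c)) = y := by
        intro c y hc0 hct
        rw [← mul_assoc, ENNReal.mul_div_cancel hab0 habt, ENNReal.mul_div_cancel hc0 hct]
      rw [mul_add, this _ _ ha0 hat, this _ _ hb0 hbt]
    rw [← ENNReal.div_rpow_of_nonneg _ _ hp.le, ← ENNReal.div_rpow_of_nonneg _ _ hp.le,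
      enorm_eq_self, Pi.add_apply, ← e1, ENNReal.mul_rpow_of_nonneg _ _ hp.le]
    gcongr
  have has0 : a ^ s ≠ 0 := (ENNReal.rpow_pos (pos_iff_ne_zero.2 ha0) hat).ne'
  have hbs0 : b ^ s ≠ 0 := (ENNReal.rpow_pos (pos_iff_ne_zero.2 hb0) hbt).ne'
  have hast : a ^ s ≠ ∞ := ENNReal.rpow_ne_top_of_nonneg hp.le hat
  have hbst : b ^ s ≠ ∞ := ENNReal.rpow_ne_top_of_nonneg hp.le hbt
  have habst : (a + b) ^ s ≠ ∞ := ENNReal.rpow_ne_top_of_nonneg hp.le habt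
  have hw1 : w₁ ≠ ∞ := (ENNReal.div_lt_top hat hab0).ne
  have hw2 : w₂ ≠ ∞ := (ENNReal.div_lt_top hbt hab0).ne
  refine le_trans (le_of_eq ?_) (lintegral_mono key)
  rw [lintegral_const_mul' _ _ habst, lintegral_add_left',
    lintegral_const_mul' _ _ hw1, lintegral_const_mul' _ _ hw2]
  · simp only [div_eq_mul_inv (f _ ^ s), div_eq_mul_inv (g _ ^ s)]
    rw [lintegral_mul_const' _ _ (ENNReal.inv_ne_top.2 has0),
      lintegral_mul_const' _ _ (ENNReal.inv_ne_top.2 hbs0), hfa, hgb,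
      ENNReal.mul_inv_cancel has0 hast, ENNReal.mul_inv_cancel hbs0 hbst, mul_one, mul_one, hw,
      mul_one]
  · exact ((hf.pow_const _).div_const _).const_mul _

theorem tsum_eLpNorm_le_of_le_one {R : ℝ≥0∞} (h0 : R ≠ 0) (hR : R ≤ 1) {φ : ι → α → ℝ≥0∞}
    (hφ : ∀ i, AEMeasurable (φ i) μ) :
    ∑' i, eLpNorm (φ i) R μ ≤ eLpNorm (fun x => ∑' i, φ i x) R μ :=
  tsum_le_apply_tsum_of_superadditive (μ := μ) (Ψ := fun f => eLpNorm f R μ)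
    (fun _ _ h => eLpNorm_mono_enorm fun x => by simpa using h x)
    (fun _ _ hf _ => eLpNorm_add_eLpNorm_le_of_le_one h0 hR hf) hφ

end Minkowski

/-! ### Elementary properties of the Lorentz quasi-norm -/

/-- The distribution function of `g`, with a weak inequality. -/
noncomputable def levelMeasure {X : Type u} [MeasurableSpace X] (μ : Measure X) (g : X → ℝ≥0∞)
    (ρ : ℝ) : ℝ≥0∞ :=
  μ {x | ENNReal.ofReal ρ ≤ g x}

open Classical in
/-- `m ^ (1 / p)`, with `0 ^ 0` read as `0`. -/
noncomputable def lorentzWeight (p m : ℝ≥0∞) : ℝ≥0∞ :=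
  if m = 0 then 0 else m ^ (1 / p.toReal)

section Lorentz

variable {X : Type*} [MeasurableSpace X] {μ : Measure X} {g g' : X → ℝ≥0∞} {p r : ℝ≥0∞}

theorem lorentzENorm_eq : lorentzENorm p r μ g = eLpNorm
    (fun ρ => ENNReal.ofReal ρ * lorentzWeight p (levelMeasure μ g ρ)) r haarHalfLine :=
  rfl

theorem levelMeasure_antitone (μ : Measure X) (g : X → ℝ≥0∞) : Antitone (levelMeasure μ g) :=
  fun _ _ h => measure_mono fun _ hx => (ENNReal.ofReal_le_ofReal h).trans hx

theorem measurable_levelMeasure (μ : Measure X) (g : X → ℝ≥0∞) :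
    Measurable (levelMeasure μ g) :=
  (levelMeasure_antitone μ g).measurable

theorem levelMeasure_mono_ae (h : g ≤ᵐ[μ] g') (ρ : ℝ) :
    levelMeasure μ g ρ ≤ levelMeasure μ g' ρ := by
  refine measure_mono_ae ?_
  filter_upwards [h] with x hx h1
  exact le_trans (show ENNReal.ofReal ρ ≤ g x from h1) hx

theorem levelMeasure_congr_ae (h : g =ᵐ[μ] g') : levelMeasure μ g = levelMeasure μ g' :=
  funext fun ρ => le_antisymm (levelMeasure_mono_ae h.le ρ) (levelMeasure_mono_ae h.symm.le ρ)

theorem lorentzWeight_mono (p : ℝ≥0∞) : Monotone (lorentzWeight p) := by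
  intro m n h
  unfold lorentzWeight
  by_cases h1 : m = 0
  · simp [h1]
  have h2 : n ≠ 0 := fun h2 => h1 (le_antisymm (h.trans h2.le) zero_le)
  rw [if_neg h1, if_neg h2]
  exact ENNReal.rpow_le_rpow h (by positivity)

theorem lorentzWeight_of_pos (h : 0 < p.toReal) (m : ℝ≥0∞) :
    lorentzWeight p m = m ^ (1 / p.toReal) := by
  unfold lorentzWeight
  split_ifs with h1
  · rw [h1, ENNReal.zero_rpow_of_pos (by positivity)]
  · rfl

theorem lorentzWeight_add_le (p m n : ℝ≥0∞) :
    lorentzWeight p (m + n)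
      ≤ 2 ^ (1 / p.toReal) * (lorentzWeight p m + lorentzWeight p n) := by
  have key : ∀ a b : ℝ≥0∞, a ≤ b →
      lorentzWeight p (a + b) ≤ 2 ^ (1 / p.toReal) * lorentzWeight p b := by
    intro a b hab
    refine (lorentzWeight_mono p (show a + b ≤ 2 * b by rw [two_mul]; gcongr)).trans ?_
    unfold lorentzWeight
    split_ifs with h1 h2 h2
    · exact zero_le
    · exact zero_le
    · simp [h2] at h1
    · rw [ENNReal.mul_rpow_of_nonneg _ _ (by positivity)]
  rcases le_total m n with h | h
  · exact (key m n h).trans (by gcongr; exact le_add_self)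
  · rw [add_comm m n]
    exact (key n m h).trans (by gcongr; exact le_self_add)

theorem measurable_lorentz_integrand (p : ℝ≥0∞) (μ : Measure X) (g : X → ℝ≥0∞) :
    Measurable fun ρ => ENNReal.ofReal ρ * lorentzWeight p (levelMeasure μ g ρ) :=
  ENNReal.measurable_ofReal.mul
    ((lorentzWeight_mono p).comp_antitone (levelMeasure_antitone μ g)).measurable

theorem lorentzENorm_mono_ae (h : g ≤ᵐ[μ] g') : lorentzENorm p r μ g ≤ lorentzENorm p r μ g' := by
  rw [lorentzENorm_eq, lorentzENorm_eq]
  refine eLpNorm_mono_enorm fun ρ => ?_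
  exact mul_le_mul_right (lorentzWeight_mono p (levelMeasure_mono_ae h ρ)) _

theorem levelMeasure_const_mul {c : ℝ} (hc : 0 < c) (ρ : ℝ) :
    levelMeasure μ (fun x => ENNReal.ofReal c * g x) ρ = levelMeasure μ g (c⁻¹ * ρ) := by
  unfold levelMeasure
  congr 1
  ext x
  have h0 : ENNReal.ofReal c ≠ 0 := by simpa using hc
  rw [Set.mem_ofPred_eq, Set.mem_ofPred_eq, ENNReal.ofReal_mul (inv_pos.2 hc).le,
    ENNReal.ofReal_inv_of_pos hc, mul_comm _ (ENNReal.ofReal ρ), ← div_eq_mul_inv,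
    ENNReal.div_le_iff' h0 ENNReal.ofReal_ne_top]

theorem lorentzENorm_const_mul {c : ℝ≥0∞} (hc0 : c ≠ 0) (hct : c ≠ ∞) :
    lorentzENorm p r μ (fun x => c * g x) = c * lorentzENorm p r μ g := by
  obtain ⟨c, hc, rfl⟩ : ∃ c' : ℝ, 0 < c' ∧ c = ENNReal.ofReal c' :=
    ⟨c.toReal, ENNReal.toReal_pos hc0 hct, (ENNReal.ofReal_toReal hct).symm⟩
  rw [lorentzENorm_eq, lorentzENorm_eq,
    ← eLpNorm_comp_const_mul_haarHalfLine (measurable_lorentz_integrand p μ g) (inv_pos.2 hc),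
    ← eLpNorm_const_mul_ennreal hc0 hct]
  congr 1
  funext ρ
  rw [levelMeasure_const_mul hc, ← mul_assoc, ← ENNReal.ofReal_mul hc.le, ← mul_assoc,
    mul_inv_cancel₀ hc.ne', one_mul]

theorem lorentzENorm_const_mul_le {c : ℝ≥0} :
    lorentzENorm p r μ (fun x => c * g x) ≤ (c + 1) * lorentzENorm p r μ g := by
  -- The added `1` keeps the factor nonzero, so that exact homogeneity applies even when `c = 0`.
  rw [← lorentzENorm_const_mul (c := (c : ℝ≥0∞) + 1) (by simp) (by simp)]
  exact lorentzENorm_mono_ae (.of_forall fun x => by dsimp only; gcongr; exact le_self_add)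

theorem levelMeasure_add_le (μ : Measure X) (g g' : X → ℝ≥0∞) {ρ : ℝ} (hρ : 0 < ρ) :
    levelMeasure μ (fun x => g x + g' x) ρ
      ≤ levelMeasure μ g (2⁻¹ * ρ) + levelMeasure μ g' (2⁻¹ * ρ) := by
  refine (measure_mono ?_).trans (measure_union_le _ _)
  intro x hx
  by_contra h
  simp only [Set.mem_union, Set.mem_ofPred_eq, not_or, not_le] at h
  have h2 : ENNReal.ofReal (2⁻¹ * ρ) + ENNReal.ofReal (2⁻¹ * ρ) = ENNReal.ofReal ρ := by
    rw [← ENNReal.ofReal_add (by positivity) (by positivity)]; congr 1; ring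
  have h3 := ENNReal.add_lt_add h.1 h.2
  rw [h2] at h3
  exact absurd hx (not_le.2 h3)

/-- If `g + g' ≥ ρ` then one of the two is at least `ρ/2`, and `dρ/ρ` does not see the dilation by
`2`. -/
theorem exists_lorentzENorm_add_le.{u} (p r : ℝ≥0∞) :
    ∃ C : ℝ≥0, ∀ {X : Type u} [MeasurableSpace X] (μ : Measure X) (g g' : X → ℝ≥0∞),
      lorentzENorm p r μ (fun x => g x + g' x)
        ≤ C * (lorentzENorm p r μ g + lorentzENorm p r μ g') := by
  have hL : r.LpAddConst ≠ ∞ := (ENNReal.LpAddConst_lt_top r).ne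
  set a : ℝ≥0∞ := 2 ^ (1 / p.toReal)
  have ha : a ≠ ∞ := ENNReal.rpow_ne_top_of_nonneg (by positivity) (by simp)
  refine ⟨(2 * a * r.LpAddConst).toNNReal, fun {X} _ μ g g' => ?_⟩
  rw [ENNReal.coe_toNNReal (by finiteness)]
  set F := fun ρ => ENNReal.ofReal ρ * lorentzWeight p (levelMeasure μ g ρ)
  set F' := fun ρ => ENNReal.ofReal ρ * lorentzWeight p (levelMeasure μ g' ρ)
  have hF : Measurable F := measurable_lorentz_integrand p μ g
  have hF' : Measurable F' := measurable_lorentz_integrand p μ g'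
  rw [lorentzENorm_eq, lorentzENorm_eq, lorentzENorm_eq]
  calc _ ≤ eLpNorm (fun ρ => 2 * a * (F + F') (2⁻¹ * ρ)) r haarHalfLine := by
        refine eLpNorm_mono_enorm_ae ?_
        filter_upwards [ae_haarHalfLine_pos] with ρ hρ
        have e : ENNReal.ofReal ρ = 2 * ENNReal.ofReal (2⁻¹ * ρ) := by
          rw [← ENNReal.ofReal_ofNat 2, ← ENNReal.ofReal_mul (by norm_num)]; congr 1; ring
        simp only [enorm_eq_self, Pi.add_apply, F, F']
        rw [e, ← mul_add, mul_assoc, mul_assoc]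
        refine mul_le_mul_right ?_ 2
        rw [mul_left_comm a]
        refine mul_le_mul_right ?_ _
        exact (lorentzWeight_mono p (levelMeasure_add_le μ g g' hρ)).trans
          (lorentzWeight_add_le p _ _)
    _ ≤ 2 * a * eLpNorm (F + F') r haarHalfLine := by
        refine (eLpNorm_const_mul_le_ennreal (by finiteness) _ _).trans ?_
        rw [eLpNorm_comp_const_mul_haarHalfLine (hF.add hF') (by norm_num)]
    _ ≤ 2 * a * (r.LpAddConst * (eLpNorm F r haarHalfLine + eLpNorm F' r haarHalfLine)) := by
        gcongr
        exact eLpNorm_add_le' hF.aestronglyMeasurable hF'.aestronglyMeasurable r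
    _ = _ := by ring

theorem levelMeasure_rpow {q : ℝ} (hq : 0 < q) {ρ : ℝ} (hρ : 0 < ρ) :
    levelMeasure μ (fun x => g x ^ q) (ρ ^ q) = levelMeasure μ g ρ := by
  unfold levelMeasure
  congr 1
  ext x
  rw [Set.mem_ofPred_eq, Set.mem_ofPred_eq, ← ENNReal.ofReal_rpow_of_pos hρ,
    ENNReal.rpow_le_rpow_iff hq]

/-- This is what reduces `ℓ^q` sums to `ℓ¹` sums: substitute `ρ ↦ ρ^q` in the defining integral. -/
theorem lorentzENorm_rpow {q : ℝ} (hq : 0 < q) :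
    lorentzENorm p r μ g ^ q = ENNReal.ofReal q⁻¹ ^ (1 / (r / ENNReal.ofReal q)).toReal *
      lorentzENorm (p / ENNReal.ofReal q) (r / ENNReal.ofReal q) μ (fun x => g x ^ q) := by
  have hq0 : ENNReal.ofReal q ≠ 0 := by simpa using hq
  have hr : r / ENNReal.ofReal q * ENNReal.ofReal q = r :=
    ENNReal.div_mul_cancel hq0 ENNReal.ofReal_ne_top
  rw [lorentzENorm_eq, lorentzENorm_eq, ← eLpNorm_comp_rpow_haarHalfLine
    (measurable_lorentz_integrand _ μ _) hq]
  nth_rewrite 1 [← hr]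
  rw [← eLpNorm_enorm_rpow _ hq]
  refine eLpNorm_congr_ae ?_
  filter_upwards [ae_haarHalfLine_pos] with ρ hρ
  rw [enorm_eq_self, levelMeasure_rpow hq hρ, ENNReal.mul_rpow_of_nonneg _ _ hq.le,
    ENNReal.ofReal_rpow_of_pos hρ]
  congr 1
  unfold lorentzWeight
  split_ifs with h
  · rw [ENNReal.zero_rpow_of_pos hq]
  · rw [← ENNReal.rpow_mul, ENNReal.toReal_div, ENNReal.toReal_ofReal hq.le]
    congr 1
    rw [one_div_div, div_mul_eq_mul_div, one_mul]

theorem ae_le_lorentzENorm_top_top : ∀ᵐ x ∂μ, g x ≤ lorentzENorm ∞ ∞ μ g := by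
  set c := lorentzENorm ∞ ∞ μ g with hc
  have h1 : ∀ᵐ ρ ∂haarHalfLine,
      ENNReal.ofReal ρ * lorentzWeight ∞ (levelMeasure μ g ρ) ≤ c := by
    rw [hc, lorentzENorm_eq, eLpNorm_exponent_top]
    exact ae_le_eLpNormEssSup (ε := ℝ≥0∞)
  have h2 : ∀ ρ : ℝ, c < ENNReal.ofReal ρ → levelMeasure μ g ρ = 0 := by
    intro ρ hρ
    by_contra h0
    have hρ0 : 0 < ρ := by
      by_contra h
      rw [ENNReal.ofReal_of_nonpos (not_lt.1 h)] at hρ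
      exact not_lt_zero hρ
    -- If level `ρ > c` were attained on a set of positive measure, so would every level `t` in `(c,
    -- ρ]`, where the integrand equals `t > c`; that interval is not null.
    have hnull : haarHalfLine {t | c < ENNReal.ofReal t ∧ t ≤ ρ} = 0 := by
      refine measure_mono_null ?_ h1
      rintro t ⟨ht, htρ⟩
      refine fun hle : _ ≤ c => ?_
      have ht0 : levelMeasure μ g t ≠ 0 := fun h =>
        h0 (le_antisymm ((levelMeasure_antitone μ g htρ).trans h.le) zero_le)
      simp only [lorentzWeight, ht0, if_false, ENNReal.toReal_top, div_zero, ENNReal.rpow_zero,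
        mul_one] at hle
      exact absurd hle (not_le.2 ht)
    have hct : c ≠ ∞ := hρ.ne_top
    have hcr : c.toReal < ρ := (ENNReal.lt_ofReal_iff_toReal_lt hct).1 hρ
    rw [haarHalfLine_eq_map_exp, measurableEmbedding_exp.map_apply] at hnull
    have hsub : Set.Ioo (Real.log ((c.toReal + ρ) / 2)) (Real.log ρ) ⊆
        Real.exp ⁻¹' {t | c < ENNReal.ofReal t ∧ t ≤ ρ} := by
      have hcn : 0 ≤ c.toReal := ENNReal.toReal_nonneg
      rintro y ⟨hy1, hy2⟩
      rw [Real.log_lt_iff_lt_exp (by linarith)] at hy1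
      rw [Real.lt_log_iff_exp_lt hρ0] at hy2
      exact ⟨(ENNReal.lt_ofReal_iff_toReal_lt hct).2 (by linarith), hy2.le⟩
    have h3 := measure_mono_null hsub hnull
    rw [Real.volume_Ioo, ENNReal.ofReal_eq_zero, sub_nonpos] at h3
    have hcn : 0 ≤ c.toReal := ENNReal.toReal_nonneg
    have h4 := Real.log_lt_log (show 0 < (c.toReal + ρ) / 2 by linarith)
      (show (c.toReal + ρ) / 2 < ρ by linarith)
    linarith
  -- Rational levels suffice, and countably many null sets can be discarded together.
  have h3 : ∀ᵐ x ∂μ, ∀ n : ℚ, c < ENNReal.ofReal n → g x < ENNReal.ofReal n := by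
    refine ae_all_iff.2 fun n => ?_
    by_cases hn : c < ENNReal.ofReal n
    · have := h2 n hn
      simp only [hn, forall_const]
      simpa [ae_iff, levelMeasure] using this
    · simp [hn]
  filter_upwards [h3] with x hx
  by_contra! hlt
  obtain ⟨q, _, hq1, hq2⟩ := ENNReal.lt_iff_exists_rat_btwn.1 hlt
  exact absurd (hx q hq1) (not_lt.2 hq2.le)

theorem lorentzENorm_le_of_ae_le {c : ℝ≥0∞} (h : ∀ᵐ x ∂μ, g x ≤ c) :
    lorentzENorm ∞ ∞ μ g ≤ c := by
  rw [lorentzENorm_eq, eLpNorm_exponent_top]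
  refine essSup_le_of_ae_le _ (.of_forall fun ρ => ?_)
  dsimp only
  rw [enorm_eq_self, lorentzWeight]
  split_ifs with h0
  · simp
  · simp only [ENNReal.toReal_top, div_zero, ENNReal.rpow_zero, mul_one]
    by_contra! hlt
    refine h0 (measure_mono_null (fun x hx => ?_) h)
    exact fun hle => absurd ((show _ ≤ _ from hx).trans hle) (not_le.2 hlt)

end Lorentz

/-! ### Layer-cake formulas and the two truncated integrals -/

theorem measurableSet_ofReal_le (a : ℝ≥0∞) : MeasurableSet {t : ℝ | ENNReal.ofReal t ≤ a} :=
  measurableSet_le ENNReal.measurable_ofReal measurable_const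

theorem setLIntegral_ofReal_le (a : ℝ≥0∞) :
    ∫⁻ t in {t | ENNReal.ofReal t ≤ a}, ENNReal.ofReal t ∂haarHalfLine = a := by
  simpa using setLIntegral_ofReal_le_rpow one_pos a

theorem setLIntegral_ofReal_lt (a : ℝ≥0∞) :
    ∫⁻ t in {t | ENNReal.ofReal t < a}, ENNReal.ofReal t ∂haarHalfLine = a := by
  simpa using setLIntegral_ofReal_lt_rpow one_pos a

theorem setLIntegral_ofReal_Ioc (a b : ℝ≥0∞) :
    ∫⁻ t in {t | a < ENNReal.ofReal t ∧ ENNReal.ofReal t ≤ b}, ENNReal.ofReal t ∂haarHalfLine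
      = b - a := by
  rcases eq_or_ne a ∞ with rfl | ha
  · simp
  have h := lintegral_inter_add_sdiff (μ := haarHalfLine) (fun t => ENNReal.ofReal t)
    {t | ENNReal.ofReal t ≤ b} (measurableSet_ofReal_le a)
  have e1 : {t : ℝ | ENNReal.ofReal t ≤ b} ∩ {t | ENNReal.ofReal t ≤ a}
      = {t | ENNReal.ofReal t ≤ min a b} := by
    ext t; simp [and_comm]
  have e2 : {t : ℝ | ENNReal.ofReal t ≤ b} \ {t | ENNReal.ofReal t ≤ a}
      = {t | a < ENNReal.ofReal t ∧ ENNReal.ofReal t ≤ b} := by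
    ext t; simp [and_comm]
  rw [e1, e2, setLIntegral_ofReal_le, setLIntegral_ofReal_le] at h
  have hm : min a b ≠ ∞ := ne_top_of_le_ne_top ha (min_le_left _ _)
  calc _ = min a b + _ - min a b := (ENNReal.add_sub_cancel_left hm).symm
    _ = b - a := by rw [h, min_comm, tsub_min]

section Functionals

variable {X : Type*} [MeasurableSpace X] {μ : Measure X} {g : X → ℝ≥0∞}

/-- Tonelli on the region below the graph of `g`; this is where σ-finiteness enters. -/
theorem setLIntegral_levelMeasure [SigmaFinite μ] (hg : Measurable g) (S : Set ℝ) :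
    ∫⁻ ρ in S, ENNReal.ofReal ρ * levelMeasure μ g ρ ∂haarHalfLine
      = ∫⁻ x, ∫⁻ ρ in S ∩ {ρ | ENNReal.ofReal ρ ≤ g x}, ENNReal.ofReal ρ ∂haarHalfLine ∂μ := by
  have hset : MeasurableSet {z : ℝ × X | ENNReal.ofReal z.1 ≤ g z.2} :=
    measurableSet_le (ENNReal.measurable_ofReal.comp measurable_fst) (hg.comp measurable_snd)
  have h1 : ∀ ρ : ℝ, ENNReal.ofReal ρ * levelMeasure μ g ρ
      = ∫⁻ x, {z : ℝ × X | ENNReal.ofReal z.1 ≤ g z.2}.indicator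
        (fun z => ENNReal.ofReal z.1) (ρ, x) ∂μ := by
    intro ρ
    have hm : MeasurableSet {x | ENNReal.ofReal ρ ≤ g x} := measurableSet_le measurable_const hg
    rw [levelMeasure, ← setLIntegral_const, ← lintegral_indicator hm]
    rfl
  simp_rw [h1]
  rw [lintegral_lintegral_swap]
  · refine lintegral_congr fun x => ?_
    rw [Set.inter_comm, ← Measure.restrict_restrict (measurableSet_ofReal_le _),
      ← lintegral_indicator (measurableSet_ofReal_le _)]
    rfl
  · exact ((ENNReal.measurable_ofReal.comp measurable_fst).indicator hset).aemeasurable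

theorem setLIntegral_levelMeasure_gt [SigmaFinite μ] (hg : AEMeasurable g μ) (a : ℝ≥0∞) :
    ∫⁻ ρ in {ρ | a < ENNReal.ofReal ρ}, ENNReal.ofReal ρ * levelMeasure μ g ρ ∂haarHalfLine
      = ∫⁻ x, (g x - a) ∂μ := by
  rw [levelMeasure_congr_ae hg.ae_eq_mk, setLIntegral_levelMeasure hg.measurable_mk]
  refine lintegral_congr_ae ?_
  filter_upwards [hg.ae_eq_mk] with x hx
  rw [hx, ← setLIntegral_ofReal_Ioc]
  rfl

theorem setLIntegral_levelMeasure_le [SigmaFinite μ] (hg : AEMeasurable g μ) (a : ℝ≥0∞) :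
    ∫⁻ ρ in {ρ | ENNReal.ofReal ρ ≤ a}, ENNReal.ofReal ρ * levelMeasure μ g ρ ∂haarHalfLine
      = ∫⁻ x, min (g x) a ∂μ := by
  rw [levelMeasure_congr_ae hg.ae_eq_mk, setLIntegral_levelMeasure hg.measurable_mk]
  refine lintegral_congr_ae ?_
  filter_upwards [hg.ae_eq_mk] with x hx
  rw [hx, ← setLIntegral_ofReal_le (min _ _)]
  congr 2
  ext ρ; simp [and_comm]

theorem lintegral_levelMeasure [SigmaFinite μ] (hg : AEMeasurable g μ) :
    ∫⁻ ρ, ENNReal.ofReal ρ * levelMeasure μ g ρ ∂haarHalfLine = ∫⁻ x, g x ∂μ := by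
  simpa using setLIntegral_levelMeasure_le hg ∞

theorem lorentzENorm_one_one [SigmaFinite μ] (hg : AEMeasurable g μ) :
    lorentzENorm 1 1 μ g = ∫⁻ x, g x ∂μ := by
  rw [lorentzENorm_eq, eLpNorm_one_eq_lintegral_enorm, ← lintegral_levelMeasure hg]
  simp [lorentzWeight_of_pos (p := 1) (by simp)]

/-- The level above which `g` exceeds only on a set of measure at most `t`. -/
noncomputable def criticalLevel (μ : Measure X) (g : X → ℝ≥0∞) (t : ℝ≥0∞) : ℝ≥0∞ :=
  ⨆ (ρ : ℝ) (_ : t < levelMeasure μ g ρ), ENNReal.ofReal ρ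

theorem lt_levelMeasure_of_lt_criticalLevel {t : ℝ≥0∞} {ρ : ℝ}
    (h : ENNReal.ofReal ρ < criticalLevel μ g t) : t < levelMeasure μ g ρ := by
  simp only [criticalLevel, lt_iSup_iff] at h
  obtain ⟨ρ', h', hlt⟩ := h
  exact h'.trans_le (levelMeasure_antitone μ g (ENNReal.ofReal_lt_ofReal_iff'.1 hlt).1.le)

theorem levelMeasure_le_of_criticalLevel_lt {t : ℝ≥0∞} {ρ : ℝ}
    (h : criticalLevel μ g t < ENNReal.ofReal ρ) : levelMeasure μ g ρ ≤ t := by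
  by_contra! hlt
  exact absurd (le_iSup₂ (f := fun (ρ : ℝ) (_ : t < levelMeasure μ g ρ) => ENNReal.ofReal ρ)
    ρ hlt) (not_le.2 h)

/-- `∫ min(μ(g ≥ ρ), t) dρ`, the `K`-functional of `g` for the couple `(L¹, L^∞)`. -/
noncomputable def cappedIntegral (μ : Measure X) (t : ℝ≥0∞) (g : X → ℝ≥0∞) : ℝ≥0∞ :=
  ∫⁻ ρ, ENNReal.ofReal ρ * min (levelMeasure μ g ρ) t ∂haarHalfLine

/-- Bound the minimum by the distribution function above level `a` and by `t` below it. Together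
with `le_cappedIntegral` this is the variational formula, an infimum over `a`. -/
theorem cappedIntegral_le [SigmaFinite μ] (hg : AEMeasurable g μ) (t a : ℝ≥0∞) :
    cappedIntegral μ t g ≤ ∫⁻ x, (g x - a) ∂μ + t * a := by
  have e : {ρ : ℝ | ENNReal.ofReal ρ ≤ a}ᶜ = {ρ | a < ENNReal.ofReal ρ} := by ext; simp
  rw [cappedIntegral, ← lintegral_add_compl _ (measurableSet_ofReal_le a), add_comm, e,
    ← setLIntegral_levelMeasure_gt hg]
  gcongr
  · exact min_le_left _ _
  · rw [mul_comm t, ← setLIntegral_ofReal_le a, ← lintegral_mul_const _ ENNReal.measurable_ofReal,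
      setLIntegral_ofReal_le a]
    gcongr
    exact min_le_right _ _

/-- At the critical level the minimum is resolved exactly: it is `t` below and the distribution
function above. -/
theorem le_cappedIntegral [SigmaFinite μ] (hg : AEMeasurable g μ) (t : ℝ≥0∞) :
    ∫⁻ x, (g x - criticalLevel μ g t) ∂μ + t * criticalLevel μ g t ≤ cappedIntegral μ t g := by
  set a := criticalLevel μ g t with ha
  have hm1 : MeasurableSet {ρ : ℝ | ENNReal.ofReal ρ < a} :=
    measurableSet_lt ENNReal.measurable_ofReal measurable_const
  have hm2 : MeasurableSet {ρ : ℝ | a < ENNReal.ofReal ρ} :=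
    measurableSet_lt measurable_const ENNReal.measurable_ofReal
  rw [cappedIntegral, ← lintegral_add_compl _ hm1, add_comm, ← setLIntegral_levelMeasure_gt hg]
  refine add_le_add ?_ ?_
  · conv_lhs => rw [← setLIntegral_ofReal_lt a, mul_comm,
      ← lintegral_mul_const _ ENNReal.measurable_ofReal]
    refine setLIntegral_mono' hm1 fun ρ hρ => ?_
    rw [min_eq_right (lt_levelMeasure_of_lt_criticalLevel hρ).le]
  · refine (setLIntegral_mono' hm2 fun ρ hρ => ?_).trans
      (lintegral_mono_set (s := {ρ | a < ENNReal.ofReal ρ}) ?_)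
    · rw [min_eq_left (levelMeasure_le_of_criticalLevel_lt hρ)]
    · intro ρ hρ
      exact not_lt.2 (show a < _ from hρ).le

/-- In the variational formula for the sum, the sum of the critical levels is an admissible level,
and `(∑ gᵢ - ∑ aᵢ)₊ ≤ ∑ (gᵢ - aᵢ)₊`. -/
theorem cappedIntegral_tsum_le [SigmaFinite μ] {ι : Type*} [Countable ι] {g : ι → X → ℝ≥0∞}
    (hg : ∀ i, AEMeasurable (g i) μ) (t : ℝ≥0∞) :
    cappedIntegral μ t (fun x => ∑' i, g i x) ≤ ∑' i, cappedIntegral μ t (g i) := by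
  set a := fun i => criticalLevel μ (g i) t
  calc cappedIntegral μ t (fun x => ∑' i, g i x)
      ≤ ∫⁻ x, (∑' i, g i x - ∑' i, a i) ∂μ + t * ∑' i, a i :=
        cappedIntegral_le (AEMeasurable.tsum hg) t _
    _ ≤ ∫⁻ x, ∑' i, (g i x - a i) ∂μ + t * ∑' i, a i := by
        gcongr with x
        rw [tsub_le_iff_right, ← ENNReal.tsum_add]
        exact ENNReal.tsum_le_tsum fun i => le_tsub_add
    _ = ∑' i, (∫⁻ x, (g i x - a i) ∂μ + t * a i) := by
        rw [lintegral_tsum fun i => (hg i).sub_const _, ENNReal.tsum_add, ENNReal.tsum_mul_left]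
    _ ≤ _ := ENNReal.tsum_le_tsum fun i => le_cappedIntegral (hg i) t

/-- `∫ (μ(g ≥ ρ) - t)₊ dρ`, the infimum of `∫ g` over complements of sets of measure `t`. -/
noncomputable def excessIntegral (μ : Measure X) (t : ℝ≥0∞) (g : X → ℝ≥0∞) : ℝ≥0∞ :=
  ∫⁻ ρ, ENNReal.ofReal ρ * (levelMeasure μ g ρ - t) ∂haarHalfLine

theorem excessIntegral_mono (t : ℝ≥0∞) : Monotone (excessIntegral μ t) := fun f g h =>
  lintegral_mono fun ρ => by
    have := levelMeasure_mono_ae (μ := μ) (.of_forall h) ρ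
    dsimp only; gcongr

theorem lintegral_min_le_excessIntegral_add [SigmaFinite μ] (hg : AEMeasurable g μ)
    (t a : ℝ≥0∞) :
    ∫⁻ x, min (g x) a ∂μ ≤ excessIntegral μ t g + t * a := by
  rw [← setLIntegral_levelMeasure_le hg, excessIntegral]
  calc _ ≤ ∫⁻ ρ in {ρ | ENNReal.ofReal ρ ≤ a}, (ENNReal.ofReal ρ * (levelMeasure μ g ρ - t)
          + ENNReal.ofReal ρ * t) ∂haarHalfLine := by
        gcongr with ρ
        rw [← mul_add]
        gcongr
        exact le_tsub_add
    _ = ∫⁻ ρ in {ρ | ENNReal.ofReal ρ ≤ a}, ENNReal.ofReal ρ * (levelMeasure μ g ρ - t)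
          ∂haarHalfLine + t * a := by
        rw [lintegral_add_right _ (ENNReal.measurable_ofReal.mul_const _),
          lintegral_mul_const _ ENNReal.measurable_ofReal, setLIntegral_ofReal_le, mul_comm a]
    _ ≤ _ := by gcongr; exact Measure.restrict_le_self

/-- The integrand vanishes above the critical level and needs no positive part below it, so
truncating `g` near that level realises the supremum. The reverse bound is
`lintegral_min_le_excessIntegral_add`. -/
theorem excessIntegral_le_iSup [SigmaFinite μ] (hg : AEMeasurable g μ) {t : ℝ≥0∞} (ht : t ≠ ∞) :
    excessIntegral μ t g ≤ ⨆ a : ℝ≥0, (∫⁻ x, min (g x) a ∂μ - t * a) := by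
  set L := criticalLevel μ g t with hL
  set F : ℝ → ℝ≥0∞ := fun ρ => ENNReal.ofReal ρ * (levelMeasure μ g ρ - t) with hF
  -- The critical level may be infinite, while the supremum runs over finite `a`; hence the
  -- exhaustion by levels below `n`.
  set A : ℕ → Set ℝ := fun n => {ρ | ENNReal.ofReal ρ < min L n} with hA
  have hAm : ∀ n, MeasurableSet (A n) := fun n =>
    measurableSet_lt ENNReal.measurable_ofReal measurable_const
  have hU : ⋃ n, A n = {ρ | ENNReal.ofReal ρ < L} := by
    ext ρ
    simp only [hA, Set.mem_iUnion, lt_min_iff, Set.mem_ofPred_eq]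
    refine ⟨fun ⟨n, h, _⟩ => h, fun h => ?_⟩
    obtain ⟨n, hn⟩ := ENNReal.exists_nat_gt (ENNReal.ofReal_ne_top (r := ρ))
    exact ⟨n, h, hn⟩
  have hAmono : Monotone A := fun m n hmn ρ hρ =>
    lt_of_lt_of_le (show ENNReal.ofReal ρ < min L m from hρ)
      (min_le_min_left _ (Nat.cast_le.2 hmn))
  have h1 : excessIntegral μ t g = ∫⁻ ρ in {ρ | ENNReal.ofReal ρ ≤ L}, F ρ ∂haarHalfLine := by
    rw [excessIntegral, ← lintegral_indicator (measurableSet_ofReal_le _)]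
    refine lintegral_congr fun ρ => ?_
    rw [Set.indicator_apply]
    split_ifs with h
    · rfl
    · rw [tsub_eq_zero_of_le (levelMeasure_le_of_criticalLevel_lt (not_le.1 h)), mul_zero]
  rw [h1, ← setLIntegral_congr (setOf_ofReal_lt_ae_eq_le L), ← hU,
    setLIntegral_iUnion_of_directed _ hAmono.directed_le]
  refine iSup_le fun n => ?_
  have hmt : min L n ≠ ∞ := ne_top_of_le_ne_top (ENNReal.natCast_ne_top n) (min_le_right _ _)
  obtain ⟨m, hm⟩ := WithTop.ne_top_iff_exists.1 hmt
  refine le_trans ?_ (le_iSup _ m)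
  rw [show (m : ℝ≥0∞) = min L n from hm]
  refine ENNReal.le_sub_of_add_le_right (ENNReal.mul_ne_top ht hmt) (le_of_eq ?_)
  have h2 : t * min L n = ∫⁻ ρ in A n, ENNReal.ofReal ρ * t ∂haarHalfLine := by
    rw [lintegral_mul_const _ ENNReal.measurable_ofReal, setLIntegral_ofReal_lt, mul_comm]
  rw [h2, ← lintegral_add_right _ (ENNReal.measurable_ofReal.mul_const _),
    ← setLIntegral_levelMeasure_le hg, ← setLIntegral_congr (setOf_ofReal_lt_ae_eq_le (min L n))]
  refine setLIntegral_congr_fun (hAm n) fun ρ hρ => ?_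
  simp only [hF]
  rw [← mul_add, tsub_add_cancel_of_le]
  exact (lt_levelMeasure_of_lt_criticalLevel (lt_of_lt_of_le hρ (min_le_left _ _))).le

/-- In the variational formula the level `a + b` is admissible for `f + g`, because `min(f,a) +
min(g,b) ≤ min(f+g, a+b)`. -/
theorem excessIntegral_add_le [SigmaFinite μ] {f g : X → ℝ≥0∞} (hf : AEMeasurable f μ)
    (hg : AEMeasurable g μ) {t : ℝ≥0∞} (ht : t ≠ ∞) :
    excessIntegral μ t f + excessIntegral μ t g ≤ excessIntegral μ t (f + g) := by
  refine (add_le_add (excessIntegral_le_iSup hf ht) (excessIntegral_le_iSup hg ht)).trans ?_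
  refine ENNReal.iSup_add_iSup_le fun a b => ?_
  have hta : t * a ≠ ∞ := ENNReal.mul_ne_top ht ENNReal.coe_ne_top
  have htb : t * b ≠ ∞ := ENNReal.mul_ne_top ht ENNReal.coe_ne_top
  have hfle : ∫⁻ x, min (f x) a ∂μ - t * a ≤ excessIntegral μ t (f + g) :=
    (tsub_le_iff_right.2 (lintegral_min_le_excessIntegral_add hf t a)).trans
      (excessIntegral_mono t le_self_add)
  have hgle : ∫⁻ x, min (g x) b ∂μ - t * b ≤ excessIntegral μ t (f + g) :=
    (tsub_le_iff_right.2 (lintegral_min_le_excessIntegral_add hg t b)).trans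
      (excessIntegral_mono t le_add_self)
  -- Subtraction is truncated at zero: if one difference vanishes, the bound for the other one is
  -- enough, and otherwise both subtractions are genuine.
  rcases le_total (∫⁻ x, min (f x) a ∂μ) (t * a) with h1 | h1
  · simpa [tsub_eq_zero_of_le h1] using hgle
  rcases le_total (∫⁻ x, min (g x) b ∂μ) (t * b) with h2 | h2
  · simpa [tsub_eq_zero_of_le h2] using hfle
  have h3 : (∫⁻ x, min (f x) a ∂μ - t * a) + (∫⁻ x, min (g x) b ∂μ - t * b) + (t * a + t * b)
      ≤ excessIntegral μ t (f + g) + (t * a + t * b) := by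
    calc _ = (∫⁻ x, min (f x) a ∂μ - t * a + t * a) + (∫⁻ x, min (g x) b ∂μ - t * b + t * b) := by
          ring
      _ = ∫⁻ x, (min (f x) a + min (g x) b) ∂μ := by
          rw [tsub_add_cancel_of_le h1, tsub_add_cancel_of_le h2,
            lintegral_add_left' (hf.min aemeasurable_const)]
      _ ≤ ∫⁻ x, min ((f + g) x) (a + b) ∂μ := by
          gcongr with x
          exact le_min (add_le_add (min_le_left _ _) (min_le_left _ _))
            (add_le_add (min_le_right _ _) (min_le_right _ _))
      _ ≤ _ := by
          rw [← mul_add]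
          exact lintegral_min_le_excessIntegral_add (hf.add hg) t _
  exact (ENNReal.add_le_add_iff_right (ENNReal.add_ne_top.2 ⟨hta, htb⟩)).1 h3

theorem tsum_excessIntegral_le [SigmaFinite μ] {ι : Type*} {g : ι → X → ℝ≥0∞}
    (hg : ∀ i, AEMeasurable (g i) μ) {t : ℝ≥0∞} (ht : t ≠ ∞) :
    ∑' i, excessIntegral μ t (g i) ≤ excessIntegral μ t (fun x => ∑' i, g i x) :=
  tsum_le_apply_tsum_of_superadditive (excessIntegral_mono t)
    (fun _ _ hf hg => excessIntegral_add_le hf hg ht) hg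

end Functionals

/-! ### Hardy-type estimates by truncation -/

theorem haarHalfLine_Ioc_half {ρ : ℝ} (hρ : 0 < ρ) :
    haarHalfLine (Set.Ioc (2⁻¹ * ρ) ρ) = ENNReal.ofReal (Real.log 2) := by
  rw [haarHalfLine_eq_map_exp, measurableEmbedding_exp.map_apply]
  have : Real.exp ⁻¹' (Set.Ioc (2⁻¹ * ρ) ρ) = Set.Ioc (Real.log (2⁻¹ * ρ)) (Real.log ρ) := by
    ext x
    simp only [Set.mem_preimage, Set.mem_Ioc]
    rw [Real.log_lt_iff_lt_exp (by positivity), Real.le_log_iff_exp_le hρ]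
  rw [this, Real.volume_Ioc, Real.log_mul (by norm_num) hρ.ne', Real.log_inv]
  congr 1; ring

/-- The strong quasi-norm controls the weak one: on `(ρ/2, ρ]`, of measure `log 2`, the integrand is
at least `(ρ/2) F(ρ)`. -/
theorem exists_mul_le_eLpNorm_of_antitone {R : ℝ≥0∞} (hR : R ≠ 0) :
    ∃ c : ℝ≥0, ∀ F : ℝ → ℝ≥0∞, Antitone F → ∀ ρ : ℝ,
      ENNReal.ofReal ρ * F ρ
        ≤ c * eLpNorm (fun σ => ENNReal.ofReal σ * F σ) R haarHalfLine := by
  have hl : ENNReal.ofReal (Real.log 2) ≠ 0 := by simpa using Real.log_pos one_lt_two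
  set k : ℝ≥0∞ := ENNReal.ofReal (Real.log 2) ^ (1 / R.toReal)
  have hk0 : k ≠ 0 := (ENNReal.rpow_pos (pos_iff_ne_zero.2 hl) ENNReal.ofReal_ne_top).ne'
  have hkt : k ≠ ∞ := ENNReal.rpow_ne_top_of_nonneg (by positivity) ENNReal.ofReal_ne_top
  have hct : 2 * k⁻¹ ≠ ∞ := ENNReal.mul_ne_top (by simp) (ENNReal.inv_ne_top.2 hk0)
  refine ⟨(2 * k⁻¹).toNNReal, fun F hF ρ => ?_⟩
  rw [ENNReal.coe_toNNReal hct]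
  rcases le_or_gt ρ 0 with h0 | hρ
  · simp [ENNReal.ofReal_of_nonpos h0]
  have h1 : ENNReal.ofReal (2⁻¹ * ρ) * F ρ * k
      ≤ eLpNorm (fun σ => ENNReal.ofReal σ * F σ) R haarHalfLine := by
    have := eLpNorm_indicator_const' (μ := haarHalfLine) (p := R) (s := Set.Ioc (2⁻¹ * ρ) ρ)
      (c := ENNReal.ofReal (2⁻¹ * ρ) * F ρ) measurableSet_Ioc
      (by rw [haarHalfLine_Ioc_half hρ]; exact hl) hR
    rw [haarHalfLine_Ioc_half hρ, enorm_eq_self] at this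
    rw [← this]
    refine eLpNorm_mono_enorm fun σ => ?_
    simp only [Set.indicator_apply, enorm_eq_self]
    split_ifs with h
    · gcongr
      · exact h.1.le
      · exact hF h.2
    · exact zero_le
  calc ENNReal.ofReal ρ * F ρ
      = 2 * k⁻¹ * (ENNReal.ofReal (2⁻¹ * ρ) * F ρ * k) := by
        have e : ENNReal.ofReal ρ = 2 * ENNReal.ofReal (2⁻¹ * ρ) := by
          rw [← ENNReal.ofReal_ofNat 2, ← ENNReal.ofReal_mul (by norm_num)]; congr 1; ring
        calc _ = 2 * ENNReal.ofReal (2⁻¹ * ρ) * F ρ * (k⁻¹ * k) := by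
              rw [ENNReal.inv_mul_cancel hk0 hkt, mul_one, ← e]
          _ = _ := by ring
    _ ≤ _ := by gcongr

/-- The homogeneity bookkeeping shared by the two truncation estimates. -/
theorem rpow_inv_mul_rpow_eq {b : ℝ} (hb : 0 < b) {t B : ℝ≥0∞} (ht0 : t ≠ 0) (ht : t ≠ ∞)
    (hB0 : B ≠ 0) (hB : B ≠ ∞) :
    B ^ b⁻¹ * (B * t ^ (-b)) ^ (1 - b⁻¹) = t ^ (1 - b) * B := by
  have htb0 : t ^ (-b) ≠ 0 := by simp [ENNReal.rpow_eq_zero_iff, ht0, ht]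
  have htb : t ^ (-b) ≠ ∞ := by simp [ENNReal.rpow_eq_top_iff, ht0, ht]
  rw [ENNReal.mul_rpow_of_ne_top hB htb, ← mul_assoc, ← ENNReal.rpow_add _ _ hB0 hB,
    ← ENNReal.rpow_mul, mul_comm]
  congr 1
  · congr 1; field_simp; ring
  · rw [add_sub_cancel, ENNReal.rpow_one]

theorem le_rpow_inv_mul_rpow {b : ℝ} (hb : 0 < b) {ρ : ℝ} (hρ : 0 < ρ) {e B : ℝ≥0∞}
    (h : ENNReal.ofReal ρ * e ^ b ≤ B) :
    ENNReal.ofReal ρ * e ≤ B ^ b⁻¹ * ENNReal.ofReal ρ ^ (1 - b⁻¹) := by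
  have hr0 : ENNReal.ofReal ρ ≠ 0 := by simpa using hρ
  have hrt : ENNReal.ofReal ρ ≠ ∞ := ENNReal.ofReal_ne_top
  have h1 := ENNReal.rpow_le_rpow h (inv_pos.2 hb).le
  rw [ENNReal.mul_rpow_of_nonneg _ _ (inv_pos.2 hb).le, ← ENNReal.rpow_mul,
    mul_inv_cancel₀ hb.ne', ENNReal.rpow_one] at h1
  calc ENNReal.ofReal ρ * e
      = ENNReal.ofReal ρ ^ b⁻¹ * e * ENNReal.ofReal ρ ^ (1 - b⁻¹) := by
        rw [mul_right_comm, ← ENNReal.rpow_add _ _ hr0 hrt, add_sub_cancel, ENNReal.rpow_one]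
    _ ≤ _ := by gcongr

/-- Use `E ≤ t` for small `ρ` and `E ≤ (B/ρ)^(1/b)` for large `ρ`; the latter is integrable at
infinity for `dρ` because `1/b > 1`. -/
theorem exists_lintegral_le_of_le {b : ℝ} (hb : 0 < b) (hb1 : b < 1) :
    ∃ C : ℝ≥0, ∀ (t B : ℝ≥0∞) (E : ℝ → ℝ≥0∞), t ≠ 0 → t ≠ ∞ → (∀ ρ, E ρ ≤ t) →
      (∀ ρ, ENNReal.ofReal ρ * E ρ ^ b ≤ B) →
      ∫⁻ ρ, ENNReal.ofReal ρ * E ρ ∂haarHalfLine ≤ C * (t ^ (1 - b) * B) := by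
  have hb2 : 0 < b⁻¹ - 1 := by rw [sub_pos]; exact (one_lt_inv₀ hb).2 hb1
  refine ⟨(1 + ENNReal.ofReal (b⁻¹ - 1)⁻¹).toNNReal, fun t B E ht0 ht hE hB => ?_⟩
  rw [ENNReal.coe_toNNReal (by simp)]
  have hpow0 : t ^ (1 - b) ≠ 0 := by simp [ENNReal.rpow_eq_zero_iff, ht0, ht]
  rcases eq_or_ne B ∞ with rfl | hBt
  · rw [ENNReal.mul_top hpow0, ENNReal.mul_top (by simp)]; exact le_top
  rcases eq_or_ne B 0 with rfl | hB0
  · refine le_of_eq_of_le ?_ zero_le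
    rw [← lintegral_zero (μ := haarHalfLine)]
    refine lintegral_congr_ae ?_
    filter_upwards [ae_haarHalfLine_pos] with ρ hρ
    have h := hB ρ
    rw [nonpos_iff_eq_zero, mul_eq_zero] at h
    rcases h with h | h
    · simp [h]
    · rw [ENNReal.rpow_eq_zero_iff_of_pos hb] at h; simp [h]
  -- The two bounds `t` and `(B/ρ)^(1/b)` coincide at this `ρ₀`.
  set ρ₀ := B * t ^ (-b) with hρ₀
  have htb0 : t ^ (-b) ≠ 0 := by simp [ENNReal.rpow_eq_zero_iff, ht0, ht]
  have htb : t ^ (-b) ≠ ∞ := by simp [ENNReal.rpow_eq_top_iff, ht0, ht]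
  rw [← lintegral_add_compl _ (measurableSet_ofReal_le ρ₀), add_mul, one_mul]
  refine add_le_add ?_ ?_
  · calc _ ≤ ∫⁻ ρ in {ρ | ENNReal.ofReal ρ ≤ ρ₀}, ENNReal.ofReal ρ * t ∂haarHalfLine := by
          gcongr; exact hE _
      _ = ρ₀ * t := by
          rw [lintegral_mul_const _ ENNReal.measurable_ofReal, setLIntegral_ofReal_le]
      _ = t ^ (1 - b) * B := by
          rw [hρ₀, sub_eq_add_neg, ENNReal.rpow_add _ _ ht0 ht, ENNReal.rpow_one]; ring
      _ ≤ _ := le_rfl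
  · have e : {ρ : ℝ | ENNReal.ofReal ρ ≤ ρ₀}ᶜ = {ρ | ρ₀ < ENNReal.ofReal ρ} := by ext; simp
    have hm : MeasurableSet {ρ : ℝ | ρ₀ < ENNReal.ofReal ρ} :=
      measurableSet_lt measurable_const ENNReal.measurable_ofReal
    rw [e]
    calc _ ≤ ∫⁻ ρ in {ρ | ρ₀ < ENNReal.ofReal ρ},
            B ^ b⁻¹ * ENNReal.ofReal ρ ^ (-(b⁻¹ - 1)) ∂haarHalfLine := by
          refine setLIntegral_mono' hm fun ρ hρ => ?_
          have hρ0 : 0 < ρ := by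
            have : 0 < ENNReal.ofReal ρ := lt_of_le_of_lt zero_le hρ
            simpa using this
          rw [neg_sub]
          exact le_rpow_inv_mul_rpow hb hρ0 (hB ρ)
      _ = ENNReal.ofReal (b⁻¹ - 1)⁻¹ * (B ^ b⁻¹ * ρ₀ ^ (1 - b⁻¹)) := by
          rw [lintegral_const_mul _ (by fun_prop),
            setLIntegral_lt_ofReal_rpow_neg hb2 (mul_ne_zero hB0 htb0), neg_sub]
          ring
      _ ≤ _ := by rw [hρ₀, rpow_inv_mul_rpow_eq hb ht0 ht hB0 hBt]

/-- Counterpart for `b > 1`: a nonzero value of `E` is at least `t`, which forces `ρ ≤ B t^(-b)`,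
and on that range `(B/ρ)^(1/b)` is integrable at zero because `1/b < 1`. -/
theorem exists_lintegral_le_of_ge {b : ℝ} (hb1 : 1 < b) :
    ∃ C : ℝ≥0, ∀ (t B : ℝ≥0∞) (E : ℝ → ℝ≥0∞), t ≠ 0 → t ≠ ∞ →
      (∀ ρ, E ρ ≠ 0 → t ≤ E ρ) → (∀ ρ, ENNReal.ofReal ρ * E ρ ^ b ≤ B) →
      ∫⁻ ρ, ENNReal.ofReal ρ * E ρ ∂haarHalfLine ≤ C * (t ^ (1 - b) * B) := by
  have hb : 0 < b := one_pos.trans hb1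
  have hb2 : 0 < 1 - b⁻¹ := by rw [sub_pos]; exact inv_lt_one_of_one_lt₀ hb1
  refine ⟨(ENNReal.ofReal (1 - b⁻¹)⁻¹).toNNReal, fun t B E ht0 ht hE hB => ?_⟩
  rw [ENNReal.coe_toNNReal (by simp)]
  have hc0 : ENNReal.ofReal (1 - b⁻¹)⁻¹ ≠ 0 := by simpa using hb2
  have hpow0 : t ^ (1 - b) ≠ 0 := by simp [ENNReal.rpow_eq_zero_iff, ht0, ht]
  rcases eq_or_ne B ∞ with rfl | hBt
  · rw [ENNReal.mul_top hpow0, ENNReal.mul_top hc0]; exact le_top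
  rcases eq_or_ne B 0 with rfl | hB0
  · refine le_of_eq_of_le ?_ zero_le
    rw [← lintegral_zero (μ := haarHalfLine)]
    refine lintegral_congr_ae ?_
    filter_upwards [ae_haarHalfLine_pos] with ρ hρ
    have h := hB ρ
    rw [nonpos_iff_eq_zero, mul_eq_zero] at h
    rcases h with h | h
    · simp [h]
    · rw [ENNReal.rpow_eq_zero_iff_of_pos hb] at h; simp [h]
  set ρ₀ := B * t ^ (-b) with hρ₀
  rw [← rpow_inv_mul_rpow_eq hb ht0 ht hB0 hBt, ← hρ₀]
  calc _ ≤ ∫⁻ ρ in {ρ | ENNReal.ofReal ρ ≤ ρ₀},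
          B ^ b⁻¹ * ENNReal.ofReal ρ ^ (1 - b⁻¹) ∂haarHalfLine := by
        rw [← lintegral_indicator (measurableSet_ofReal_le _)]
        refine lintegral_mono_ae ?_
        filter_upwards [ae_haarHalfLine_pos] with ρ hρ
        rw [Set.indicator_apply]
        split_ifs with h
        · exact le_rpow_inv_mul_rpow hb hρ (hB ρ)
        · have : E ρ = 0 := by
            by_contra h0
            refine h ?_
            have h1 : ENNReal.ofReal ρ * t ^ b ≤ B :=
              (mul_le_mul_right (ENNReal.rpow_le_rpow (hE ρ h0) hb.le) _).trans (hB ρ)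
            show ENNReal.ofReal ρ ≤ B * t ^ (-b)
            rw [ENNReal.rpow_neg, ← div_eq_mul_inv, ENNReal.le_div_iff_mul_le
              (.inl (ENNReal.rpow_pos (pos_iff_ne_zero.2 ht0) ht).ne')
              (.inl (ENNReal.rpow_ne_top_of_nonneg hb.le ht))]
            exact h1
          simp [this]
    _ = _ := by
        rw [lintegral_const_mul _ (by fun_prop), setLIntegral_ofReal_le_rpow hb2]
        ring
    _ ≤ _ := le_rfl

/-- Mixed norms: a kernel bound in `t`, uniform in `D`, gives a bound for
`t ↦ ‖ρ e(t, D(ρ))^b‖_{L^R(dρ/ρ)}`. -/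
theorem eLpNorm_mixed_le {R : ℝ≥0∞} (hR : R ≠ 0) {α b : ℝ} {C : ℝ≥0∞} (hCt : C ≠ ∞)
    {e : ℝ → ℝ≥0∞ → ℝ≥0∞} (he : Measurable (Function.uncurry e))
    (hpt : ∀ t > 0, ∀ D, ENNReal.ofReal t ^ (α - b) * e t D ^ b ≤ D ^ α)
    (hint : R ≠ ∞ → ∀ D, ∫⁻ t, (ENNReal.ofReal t ^ (α - b) * e t D ^ b) ^ R.toReal ∂haarHalfLine
      ≤ C * (D ^ α) ^ R.toReal)
    {D : ℝ → ℝ≥0∞} (hD : Measurable D) :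
    eLpNorm (fun t => ENNReal.ofReal t ^ (α - b) *
        eLpNorm (fun ρ => ENNReal.ofReal ρ * e t (D ρ) ^ b) R haarHalfLine) R haarHalfLine
      ≤ C ^ (1 / R.toReal) * eLpNorm (fun ρ => ENNReal.ofReal ρ * D ρ ^ α) R haarHalfLine := by
  rcases eq_or_ne R ∞ with rfl | hRt
  · rw [eLpNorm_exponent_top]
    refine essSup_le_of_ae_le _ ?_
    filter_upwards [ae_haarHalfLine_pos] with t ht
    have h0 : ENNReal.ofReal t ≠ 0 := by simpa using ht
    rw [enorm_eq_self, ← eLpNorm_const_mul_ennreal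
      (by simp [ENNReal.rpow_eq_zero_iff, ht]) (by simp [ENNReal.rpow_eq_top_iff, ht])]
    simp only [ENNReal.toReal_top, div_zero, ENNReal.rpow_zero, one_mul]
    refine eLpNorm_mono_enorm fun ρ => ?_
    rw [enorm_eq_self, enorm_eq_self, mul_left_comm]
    gcongr
    exact hpt t ht _
  · have hp : 0 < R.toReal := ENNReal.toReal_pos hR hRt
    have hmeas : Measurable fun z : ℝ × ℝ => e z.1 (D z.2) :=
      he.comp (measurable_fst.prodMk (hD.comp measurable_snd))
    have hmeasF : Measurable fun z : ℝ × ℝ => ENNReal.ofReal z.2 ^ R.toReal *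
        (ENNReal.ofReal z.1 ^ (α - b) * e z.1 (D z.2) ^ b) ^ R.toReal := by fun_prop
    rw [eLpNorm_eq_lintegral_rpow_enorm_toReal hR hRt, eLpNorm_eq_lintegral_rpow_enorm_toReal hR
      hRt, ← ENNReal.mul_rpow_of_nonneg _ _ (by positivity)]
    refine ENNReal.rpow_le_rpow ?_ (by positivity)
    simp only [enorm_eq_self]
    calc ∫⁻ t, (ENNReal.ofReal t ^ (α - b) *
          eLpNorm (fun ρ => ENNReal.ofReal ρ * e t (D ρ) ^ b) R haarHalfLine) ^ R.toReal
            ∂haarHalfLine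
        = ∫⁻ t, ∫⁻ ρ, ENNReal.ofReal ρ ^ R.toReal *
            (ENNReal.ofReal t ^ (α - b) * e t (D ρ) ^ b) ^ R.toReal ∂haarHalfLine
              ∂haarHalfLine := by
          refine lintegral_congr fun t => ?_
          have hm2 : Measurable fun ρ => e t (D ρ) := hmeas.comp measurable_prodMk_left
          rw [ENNReal.mul_rpow_of_nonneg _ _ hp.le, eLpNorm_eq_lintegral_rpow_enorm_toReal hR hRt,
            ← ENNReal.rpow_mul (∫⁻ _, _ ∂_), one_div_mul_cancel hp.ne', ENNReal.rpow_one,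
            ← lintegral_const_mul _ (by fun_prop)]
          refine lintegral_congr fun ρ => ?_
          rw [enorm_eq_self, ← ENNReal.mul_rpow_of_nonneg _ _ hp.le,
            ← ENNReal.mul_rpow_of_nonneg _ _ hp.le, mul_left_comm]
      _ = ∫⁻ ρ, ENNReal.ofReal ρ ^ R.toReal * ∫⁻ t,
            (ENNReal.ofReal t ^ (α - b) * e t (D ρ) ^ b) ^ R.toReal ∂haarHalfLine
              ∂haarHalfLine := by
          -- With the same exponent `R` in both variables the mixed norm is a double integral, so
          -- the `t`-integral can be done first, at fixed `D ρ`.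
          rw [lintegral_lintegral_swap hmeasF.aemeasurable]
          refine lintegral_congr fun ρ => ?_
          have hm2 : Measurable fun t => e t (D ρ) := hmeas.comp measurable_prodMk_right
          rw [lintegral_const_mul _ (by fun_prop)]
      _ ≤ ∫⁻ ρ, C * (ENNReal.ofReal ρ * D ρ ^ α) ^ R.toReal ∂haarHalfLine := by
          refine lintegral_mono fun ρ => ?_
          dsimp only
          rw [ENNReal.mul_rpow_of_nonneg _ _ hp.le, mul_left_comm]
          gcongr
          exact hint hRt _
      _ = _ := lintegral_const_mul' _ _ hCt

/-- The integrand is `t^(αr)` up to `D` and `D^(br) t^(-(b-α)r)` beyond; both pieces converge since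
`0 < α < b`. -/
theorem exists_capped_kernel_bound {α b r : ℝ} (hα : 0 < α) (hb : α < b) (hr : 0 < r) :
    ∃ C : ℝ≥0, ∀ D : ℝ≥0∞,
      ∫⁻ t, (ENNReal.ofReal t ^ (α - b) * min D (ENNReal.ofReal t) ^ b) ^ r ∂haarHalfLine
        ≤ C * (D ^ α) ^ r := by
  have hb0 : 0 < b := hα.trans hb
  have hαr : 0 < α * r := mul_pos hα hr
  have hbr : 0 < (b - α) * r := mul_pos (sub_pos.2 hb) hr
  refine ⟨1 + (α * r)⁻¹.toNNReal + ((b - α) * r)⁻¹.toNNReal, fun D => ?_⟩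
  rcases eq_or_ne D 0 with rfl | hD0
  · simp [hb0, hr]
  rw [← lintegral_add_compl _ (measurableSet_ofReal_le D)]
  have e : {ρ : ℝ | ENNReal.ofReal ρ ≤ D}ᶜ = {ρ | D < ENNReal.ofReal ρ} := by ext; simp
  have hm : MeasurableSet {ρ : ℝ | D < ENNReal.ofReal ρ} :=
    measurableSet_lt measurable_const ENNReal.measurable_ofReal
  have h1 : ∫⁻ t in {ρ | ENNReal.ofReal ρ ≤ D},
      (ENNReal.ofReal t ^ (α - b) * min D (ENNReal.ofReal t) ^ b) ^ r ∂haarHalfLine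
      ≤ ENNReal.ofReal (α * r)⁻¹ * (D ^ α) ^ r := by
    rw [← ENNReal.rpow_mul, ← setLIntegral_ofReal_le_rpow hαr]
    refine lintegral_mono_ae ?_
    filter_upwards [ae_restrict_mem (measurableSet_ofReal_le D),
      ae_restrict_of_ae ae_haarHalfLine_pos] with t ht hpos
    have h0 : ENNReal.ofReal t ≠ 0 := by simpa using hpos
    rw [min_eq_right ht, ← ENNReal.rpow_add _ _ h0 ENNReal.ofReal_ne_top, sub_add_cancel,
      ENNReal.rpow_mul]
  have h2 : ∫⁻ t in {ρ | D < ENNReal.ofReal ρ},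
      (ENNReal.ofReal t ^ (α - b) * min D (ENNReal.ofReal t) ^ b) ^ r ∂haarHalfLine
      ≤ ENNReal.ofReal ((b - α) * r)⁻¹ * (D ^ α) ^ r := by
    rcases eq_or_ne D ∞ with rfl | hDt
    · simp
    calc _ ≤ ∫⁻ t in {ρ | D < ENNReal.ofReal ρ},
          (D ^ b) ^ r * ENNReal.ofReal t ^ (-((b - α) * r)) ∂haarHalfLine := by
          refine setLIntegral_mono' hm fun t ht => ?_
          rw [min_eq_left (show D < _ from ht).le, ENNReal.mul_rpow_of_nonneg _ _ hr.le,
            ← ENNReal.rpow_mul, mul_comm]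
          apply le_of_eq
          congr 2; ring
      _ = _ := by
          rw [lintegral_const_mul _ (by fun_prop), setLIntegral_lt_ofReal_rpow_neg hbr hD0,
            mul_left_comm, ← ENNReal.rpow_mul, ← ENNReal.rpow_add _ _ hD0 hDt, ← ENNReal.rpow_mul]
          congr 2; ring
  rw [e]
  refine (add_le_add h1 h2).trans ?_
  rw [← add_mul]
  gcongr
  push_cast
  rw [add_assoc]
  exact le_add_self

/-- Only `t < D` contributes, with integrand `D^(br) t^((α-b)r)`, integrable at zero since `b < α`.
-/
theorem exists_excess_kernel_bound {α b r : ℝ} (hb0 : 0 < b) (hb : b < α) (hr : 0 < r) :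
    ∃ C : ℝ≥0, ∀ D : ℝ≥0∞,
      ∫⁻ t, (ENNReal.ofReal t ^ (α - b) * (if ENNReal.ofReal t < D then D else 0) ^ b) ^ r
        ∂haarHalfLine ≤ C * (D ^ α) ^ r := by
  have hα : 0 < α := hb0.trans hb
  have hbr : 0 < (α - b) * r := mul_pos (sub_pos.2 hb) hr
  refine ⟨1 + ((α - b) * r)⁻¹.toNNReal, fun D => ?_⟩
  rcases eq_or_ne D 0 with rfl | hD0
  · simp [hb0, hr]
  rcases eq_or_ne D ∞ with rfl | hDt
  · rw [ENNReal.top_rpow_of_pos hα, ENNReal.top_rpow_of_pos hr, ENNReal.mul_top (by simp)]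
    exact le_top
  have hm : MeasurableSet {ρ : ℝ | ENNReal.ofReal ρ < D} :=
    measurableSet_lt ENNReal.measurable_ofReal measurable_const
  calc _ = ∫⁻ t in {ρ | ENNReal.ofReal ρ < D},
        (D ^ b) ^ r * ENNReal.ofReal t ^ ((α - b) * r) ∂haarHalfLine := by
        rw [← lintegral_indicator hm]
        refine lintegral_congr fun t => ?_
        rw [Set.indicator_apply]
        simp only [Set.mem_ofPred_eq]
        split_ifs with h
        · rw [ENNReal.mul_rpow_of_nonneg _ _ hr.le, ← ENNReal.rpow_mul, mul_comm]
        · simp [hb0, hr]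
    _ = ENNReal.ofReal ((α - b) * r)⁻¹ * (D ^ α) ^ r := by
        rw [lintegral_const_mul _ (by fun_prop), setLIntegral_ofReal_lt_rpow hbr,
          mul_left_comm, ← ENNReal.rpow_mul, ← ENNReal.rpow_add _ _ hD0 hDt, ← ENNReal.rpow_mul]
        congr 2; ring
    _ ≤ _ := by gcongr; push_cast; exact le_add_self

theorem le_of_ae_ofReal_lt_imp_le {a b : ℝ≥0∞}
    (h : ∀ᵐ t ∂haarHalfLine, ENNReal.ofReal t < a → ENNReal.ofReal t ≤ b) : a ≤ b := by
  have h1 : {t : ℝ | b < ENNReal.ofReal t ∧ ENNReal.ofReal t ≤ a} =ᵐ[haarHalfLine]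
      (∅ : Set ℝ) := by
    filter_upwards [h, setOf_ofReal_lt_ae_eq_le a] with t ht ht2
    refine propext ⟨fun ⟨hb, ha⟩ => ?_, fun h => h.elim⟩
    have h3 : ENNReal.ofReal t < a := ht2.symm.mp ha
    exact absurd (ht h3) (not_le.2 hb)
  have h2 := setLIntegral_ofReal_Ioc b a
  rw [setLIntegral_congr h1] at h2
  simp only [Measure.restrict_empty, lintegral_zero_measure] at h2
  exact tsub_eq_zero_iff_le.1 h2.symm

/-- For finite `R`, write `D(ρ)^(αR)` as a multiple of `∫_{t < D(ρ)/s} t^(αR) dt/t` and exchange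
integrals: the hypothesis confines `ρ` to `ρ ≤ T(t)/t`, where `ρ^R` integrates to a multiple of
`(T(t)/t)^R`. -/
theorem exists_eLpNorm_rpow_le_of_lt_imp {R : ℝ≥0∞} (hR : R ≠ 0) {α : ℝ} (hα : 0 < α) {s : ℝ≥0}
    (hs : s ≠ 0) :
    ∃ C : ℝ≥0, ∀ (D T : ℝ → ℝ≥0∞), Measurable D →
      (∀ t ρ : ℝ, 0 < t → s * ENNReal.ofReal t < D ρ →
        ENNReal.ofReal ρ * ENNReal.ofReal t ≤ T t) →
      eLpNorm (fun ρ => ENNReal.ofReal ρ * D ρ ^ α) R haarHalfLine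
        ≤ C * eLpNorm (fun t => ENNReal.ofReal t ^ (α - 1) * T t) R haarHalfLine := by
  have hs0 : (s : ℝ≥0∞) ≠ 0 := by simpa using hs
  have hst : (s : ℝ≥0∞) ≠ ∞ := ENNReal.coe_ne_top
  have hlt : ∀ t : ℝ, ∀ d : ℝ≥0∞, s * ENNReal.ofReal t < d ↔ ENNReal.ofReal t < d / s := by
    intro t d
    rw [ENNReal.lt_div_iff_mul_lt (.inl hs0) (.inl hst), mul_comm]
  have hsα : (s : ℝ≥0∞) ^ α ≠ ∞ := ENNReal.rpow_ne_top_of_nonneg hα.le hst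
  have hdiv : ∀ d : ℝ≥0∞, d ^ α = (s : ℝ≥0∞) ^ α * (d / s) ^ α := by
    intro d
    rw [← ENNReal.mul_rpow_of_nonneg _ _ hα.le, ENNReal.mul_div_cancel hs0 hst]
  rcases eq_or_ne R ∞ with rfl | hRt
  · refine ⟨((s : ℝ≥0∞) ^ α).toNNReal, fun D T hD hT => ?_⟩
    rw [ENNReal.coe_toNNReal hsα]
    set S := eLpNorm (fun t => ENNReal.ofReal t ^ (α - 1) * T t) ∞ haarHalfLine with hS
    have hSae : ∀ᵐ t ∂haarHalfLine, ENNReal.ofReal t ^ (α - 1) * T t ≤ S := by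
      rw [hS, eLpNorm_exponent_top]
      exact ae_le_eLpNormEssSup (ε := ℝ≥0∞)
    rw [eLpNorm_exponent_top]
    refine essSup_le_of_ae_le _ ?_
    filter_upwards [ae_haarHalfLine_pos] with ρ hρ
    have hρ0 : ENNReal.ofReal ρ ≠ 0 := by simpa using hρ
    rw [enorm_eq_self, hdiv, mul_left_comm]
    gcongr
    -- For `R = ∞` the bound holds for almost every `t < D(ρ)/s`; letting `t` increase to `D(ρ)/s`
    -- gives the claim.
    have key : D ρ / s ≤ (S / ENNReal.ofReal ρ) ^ α⁻¹ := by
      refine le_of_ae_ofReal_lt_imp_le ?_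
      filter_upwards [hSae, ae_haarHalfLine_pos] with t ht hpos hlt'
      have ht0 : ENNReal.ofReal t ≠ 0 := by simpa using hpos
      have h1 := hT t ρ hpos ((hlt _ _).2 hlt')
      rw [ENNReal.le_rpow_inv_iff hα, ENNReal.le_div_iff_mul_le (.inl hρ0)
        (.inl ENNReal.ofReal_ne_top)]
      refine le_trans ?_ ht
      calc _ = ENNReal.ofReal t ^ (α - 1) * (ENNReal.ofReal ρ * ENNReal.ofReal t) := by
            rw [show α = (α - 1) + 1 by ring, ENNReal.rpow_add _ _ ht0 ENNReal.ofReal_ne_top,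
              ENNReal.rpow_one, add_sub_cancel_right]
            ring
        _ ≤ _ := by gcongr
    rw [ENNReal.le_rpow_inv_iff hα, ENNReal.le_div_iff_mul_le (.inl hρ0)
        (.inl ENNReal.ofReal_ne_top), mul_comm] at key
    exact key
  · have hp : 0 < R.toReal := ENNReal.toReal_pos hR hRt
    set r := R.toReal with hr
    have hαr : 0 < α * r := mul_pos hα hp
    set c := (s : ℝ≥0∞) ^ (α * r) * ENNReal.ofReal (α * r) * ENNReal.ofReal r⁻¹ with hc
    have hct : c ≠ ∞ := ENNReal.mul_ne_top (ENNReal.mul_ne_top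
      (ENNReal.rpow_ne_top_of_nonneg hαr.le hst) ENNReal.ofReal_ne_top) ENNReal.ofReal_ne_top
    have hct' : c ^ (1 / r) ≠ ∞ := ENNReal.rpow_ne_top_of_nonneg (by positivity) hct
    refine ⟨(c ^ (1 / r)).toNNReal, fun D T hD hT => ?_⟩
    rw [ENNReal.coe_toNNReal hct', eLpNorm_eq_lintegral_rpow_enorm_toReal hR hRt,
      eLpNorm_eq_lintegral_rpow_enorm_toReal hR hRt, ← hr,
      ← ENNReal.mul_rpow_of_nonneg _ _ (by positivity)]
    refine ENNReal.rpow_le_rpow ?_ (by positivity)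
    simp only [enorm_eq_self]
    set A : Set (ℝ × ℝ) := {z | ENNReal.ofReal z.2 < D z.1 / s} with hA
    have hAm : MeasurableSet A := measurableSet_lt
      (ENNReal.measurable_ofReal.comp measurable_snd) ((hD.comp measurable_fst).div_const _)
    have hFm : Measurable (A.indicator fun z : ℝ × ℝ =>
        ENNReal.ofReal z.1 ^ r * ENNReal.ofReal z.2 ^ (α * r)) :=
      Measurable.indicator (by fun_prop) hAm
    have hone : ENNReal.ofReal (α * r) * ENNReal.ofReal (α * r)⁻¹ = 1 := by
      rw [← ENNReal.ofReal_mul hαr.le, mul_inv_cancel₀ hαr.ne', ENNReal.ofReal_one]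
    have hc1 : (s : ℝ≥0∞) ^ (α * r) * ENNReal.ofReal (α * r) ≠ ∞ := ENNReal.mul_ne_top
      (ENNReal.rpow_ne_top_of_nonneg hαr.le hst) ENNReal.ofReal_ne_top
    calc ∫⁻ ρ, (ENNReal.ofReal ρ * D ρ ^ α) ^ r ∂haarHalfLine
        = ∫⁻ ρ, (s : ℝ≥0∞) ^ (α * r) * ENNReal.ofReal (α * r) * ∫⁻ t, A.indicator (fun z : ℝ × ℝ =>
            ENNReal.ofReal z.1 ^ r * ENNReal.ofReal z.2 ^ (α * r)) (ρ, t) ∂haarHalfLine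
              ∂haarHalfLine := by
          refine lintegral_congr fun ρ => ?_
          have hm : MeasurableSet {t : ℝ | ENNReal.ofReal t < D ρ / s} :=
            measurableSet_lt ENNReal.measurable_ofReal measurable_const
          have : ∀ t : ℝ, A.indicator (fun z : ℝ × ℝ =>
              ENNReal.ofReal z.1 ^ r * ENNReal.ofReal z.2 ^ (α * r)) (ρ, t)
              = ENNReal.ofReal ρ ^ r * {t : ℝ | ENNReal.ofReal t < D ρ / s}.indicator
                (fun t => ENNReal.ofReal t ^ (α * r)) t := by
            intro t
            simp only [Set.indicator_apply, hA, Set.mem_ofPred_eq]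
            split_ifs <;> simp
          simp_rw [this]
          rw [lintegral_const_mul _ (Measurable.indicator (by fun_prop) hm),
            lintegral_indicator hm, setLIntegral_ofReal_lt_rpow hαr,
            ENNReal.mul_rpow_of_nonneg _ _ hp.le, hdiv, ENNReal.mul_rpow_of_nonneg _ _ hp.le,
            ← ENNReal.rpow_mul, ← ENNReal.rpow_mul]
          calc _ = 1 * (ENNReal.ofReal ρ ^ r * ((s : ℝ≥0∞) ^ (α * r) * (D ρ / s) ^ (α * r))) := by
                rw [one_mul]
            _ = _ := by rw [← hone]; ring
      _ = (s : ℝ≥0∞) ^ (α * r) * ENNReal.ofReal (α * r) * ∫⁻ t, ∫⁻ ρ, A.indicator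
            (fun z : ℝ × ℝ => ENNReal.ofReal z.1 ^ r * ENNReal.ofReal z.2 ^ (α * r)) (ρ, t)
              ∂haarHalfLine ∂haarHalfLine := by
          rw [lintegral_const_mul' _ _ hc1]
          exact congrArg _ (lintegral_lintegral_swap (f := fun ρ t => A.indicator _ (ρ, t))
            hFm.aemeasurable)
      _ ≤ (s : ℝ≥0∞) ^ (α * r) * ENNReal.ofReal (α * r) * ∫⁻ t, ENNReal.ofReal r⁻¹ *
            (ENNReal.ofReal t ^ (α - 1) * T t) ^ r ∂haarHalfLine := by
          gcongr 1
          refine lintegral_mono_ae ?_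
          filter_upwards [ae_haarHalfLine_pos] with t ht
          have ht0 : ENNReal.ofReal t ≠ 0 := by simpa using ht
          calc _ ≤ ∫⁻ ρ in {ρ | ENNReal.ofReal ρ ≤ T t / ENNReal.ofReal t},
                ENNReal.ofReal t ^ (α * r) * ENNReal.ofReal ρ ^ r ∂haarHalfLine := by
                rw [← lintegral_indicator (measurableSet_ofReal_le _)]
                refine lintegral_mono fun ρ => ?_
                dsimp only
                by_cases h : (ρ, t) ∈ A
                · have hle : ENNReal.ofReal ρ ≤ T t / ENNReal.ofReal t := by
                    rw [ENNReal.le_div_iff_mul_le (.inl ht0) (.inl ENNReal.ofReal_ne_top)]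
                    exact hT t ρ ht ((hlt _ _).2 h)
                  rw [Set.indicator_of_mem h, Set.indicator_of_mem
                    (show ρ ∈ {ρ : ℝ | ENNReal.ofReal ρ ≤ T t / ENNReal.ofReal t} from hle),
                    mul_comm]
                · rw [Set.indicator_of_notMem h]; exact zero_le
            _ = ENNReal.ofReal r⁻¹ * (ENNReal.ofReal t ^ (α - 1) * T t) ^ r := by
                rw [lintegral_const_mul _ (by fun_prop), setLIntegral_ofReal_le_rpow hp,
                  mul_left_comm, ENNReal.rpow_mul, ← ENNReal.mul_rpow_of_nonneg _ _ hp.le]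
                congr 2
                rw [ENNReal.rpow_sub _ _ ht0 ENNReal.ofReal_ne_top, ENNReal.rpow_one,
                  div_eq_mul_inv, div_eq_mul_inv]
                ring
            _ ≤ _ := le_rfl
      _ = _ := by
          rw [lintegral_const_mul' _ _ ENNReal.ofReal_ne_top, hc, ← mul_assoc]

/-- The weak-type bound supplies the `B` required by `hE`, so the inner integral is at most a
multiple of `t^(1-b) ‖ρ e(t, D ρ)^b‖_R`. The exponents of `t` add up to `α - b`, and
`eLpNorm_mixed_le` applies. -/
theorem exists_eLpNorm_lintegral_kernel_le {R : ℝ≥0∞} (hR : R ≠ 0) {α b : ℝ} (hb : 0 ≤ b)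
    {e : ℝ → ℝ≥0∞ → ℝ≥0∞} (he : Measurable (Function.uncurry e)) (hmono : ∀ t, Monotone (e t))
    (hpt : ∀ t > 0, ∀ D, ENNReal.ofReal t ^ (α - b) * e t D ^ b ≤ D ^ α)
    (hint : ∀ r : ℝ, 0 < r → ∃ C : ℝ≥0, ∀ D,
      ∫⁻ t, (ENNReal.ofReal t ^ (α - b) * e t D ^ b) ^ r ∂haarHalfLine ≤ C * (D ^ α) ^ r)
    (hE : ∃ C : ℝ≥0, ∀ (D : ℝ → ℝ≥0∞) (t : ℝ) (B : ℝ≥0∞), 0 < t →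
      (∀ ρ, ENNReal.ofReal ρ * e t (D ρ) ^ b ≤ B) →
      ∫⁻ ρ, ENNReal.ofReal ρ * e t (D ρ) ∂haarHalfLine ≤ C * (ENNReal.ofReal t ^ (1 - b) * B)) :
    ∃ C : ℝ≥0, ∀ D : ℝ → ℝ≥0∞, Antitone D →
      eLpNorm (fun t => ENNReal.ofReal t ^ (α - 1) *
          ∫⁻ ρ, ENNReal.ofReal ρ * e t (D ρ) ∂haarHalfLine) R haarHalfLine
        ≤ C * eLpNorm (fun ρ => ENNReal.ofReal ρ * D ρ ^ α) R haarHalfLine := by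
  obtain ⟨C₁, hC₁⟩ := hE
  obtain ⟨c, hc⟩ := exists_mul_le_eLpNorm_of_antitone hR
  obtain ⟨C₂, hC₂⟩ : ∃ C : ℝ≥0, R ≠ ∞ → ∀ D,
      ∫⁻ t, (ENNReal.ofReal t ^ (α - b) * e t D ^ b) ^ R.toReal ∂haarHalfLine
        ≤ C * (D ^ α) ^ R.toReal := by
    by_cases hRt : R = ∞
    · exact ⟨0, fun h => absurd hRt h⟩
    · obtain ⟨C, hC⟩ := hint R.toReal (ENNReal.toReal_pos hR hRt)
      exact ⟨C, fun _ => hC⟩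
  have hC₂t : (C₂ : ℝ≥0∞) ^ (1 / R.toReal) ≠ ∞ :=
    ENNReal.rpow_ne_top_of_nonneg (by positivity) ENNReal.coe_ne_top
  refine ⟨C₁ * c * ((C₂ : ℝ≥0∞) ^ (1 / R.toReal)).toNNReal, fun D hD => ?_⟩
  push_cast
  rw [ENNReal.coe_toNNReal hC₂t]
  calc _ ≤ eLpNorm (fun t => C₁ * c * (ENNReal.ofReal t ^ (α - b) *
          eLpNorm (fun ρ => ENNReal.ofReal ρ * e t (D ρ) ^ b) R haarHalfLine)) R
            haarHalfLine := by
        refine eLpNorm_mono_enorm_ae ?_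
        filter_upwards [ae_haarHalfLine_pos] with t ht
        have ht0 : ENNReal.ofReal t ≠ 0 := by simpa using ht
        have h1 := hC₁ D t _ ht (hc (fun ρ => e t (D ρ) ^ b) fun x y hxy =>
          ENNReal.rpow_le_rpow (hmono t (hD hxy)) hb)
        rw [enorm_eq_self, enorm_eq_self]
        refine (mul_le_mul_right h1 _).trans (le_of_eq ?_)
        rw [show α - b = (α - 1) + (1 - b) by ring,
          ENNReal.rpow_add _ _ ht0 ENNReal.ofReal_ne_top]
        ring
    _ ≤ C₁ * c * _ := eLpNorm_const_mul_le_ennreal (by finiteness) _ _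
    _ ≤ C₁ * c * ((C₂ : ℝ≥0∞) ^ (1 / R.toReal) *
          eLpNorm (fun ρ => ENNReal.ofReal ρ * D ρ ^ α) R haarHalfLine) := by
        gcongr
        exact eLpNorm_mixed_le hR ENNReal.coe_ne_top he hpt hC₂ hD.measurable
    _ = _ := by ring

/-! ### Lorentz quasi-norms expressed by truncated integrals -/

section Equivalence

theorem lorentzENorm_of_pos {X : Type*} [MeasurableSpace X] {μ : Measure X} {g : X → ℝ≥0∞}
    {p r : ℝ≥0∞} (hp : 0 < p.toReal) :
    lorentzENorm p r μ g = eLpNorm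
      (fun ρ => ENNReal.ofReal ρ * levelMeasure μ g ρ ^ (1 / p.toReal)) r haarHalfLine := by
  simp only [lorentzENorm_eq, lorentzWeight_of_pos hp]

theorem exists_eLpNorm_cappedIntegral_le.{u} {p R : ℝ≥0∞} (hp : 1 < p) (hpt : p ≠ ∞) (hR : R ≠ 0) :
    ∃ C : ℝ≥0, ∀ {X : Type u} [MeasurableSpace X] (μ : Measure X) (g : X → ℝ≥0∞),
      eLpNorm (fun t => ENNReal.ofReal t ^ (1 / p.toReal - 1) *
        cappedIntegral μ (ENNReal.ofReal t) g) R haarHalfLine ≤ C * lorentzENorm p R μ g := by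
  have hp1 : 1 < p.toReal := by
    simpa using (ENNReal.toReal_lt_toReal ENNReal.one_ne_top hpt).2 hp
  have hp0 : 0 < p.toReal := one_pos.trans hp1
  set α := 1 / p.toReal with hα
  have hα0 : 0 < α := by positivity
  have hα1 : α < 1 := by rw [hα, div_lt_one hp0]; exact hp1
  -- The auxiliary exponent must satisfy `b < 1` for the truncation bound and `α < b` for the kernel
  -- bound.
  set b := (α + 1) / 2 with hb
  have hb0 : 0 < b := by rw [hb]; linarith
  have hb1 : b < 1 := by rw [hb]; linarith
  have hαb : α < b := by rw [hb]; linarith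
  have hpt' : ∀ t > 0, ∀ D, ENNReal.ofReal t ^ (α - b) * min D (ENNReal.ofReal t) ^ b ≤ D ^ α := by
    intro t ht D
    set m := min D (ENNReal.ofReal t) with hm
    rcases eq_or_ne m 0 with h0 | h0
    · simp [h0, hb0]
    have hmt : m ≠ ∞ := ne_top_of_le_ne_top ENNReal.ofReal_ne_top (min_le_right _ _)
    calc ENNReal.ofReal t ^ (α - b) * m ^ b ≤ m ^ (α - b) * m ^ b := by
          gcongr 1
          rw [← neg_sub b α, ENNReal.rpow_neg, ENNReal.rpow_neg, ENNReal.inv_le_inv]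
          exact ENNReal.rpow_le_rpow (min_le_right _ _) (by linarith)
      _ = m ^ α := by rw [← ENNReal.rpow_add _ _ h0 hmt, sub_add_cancel]
      _ ≤ D ^ α := ENNReal.rpow_le_rpow (min_le_left _ _) hα0.le
  obtain ⟨C₁, hC₁⟩ := exists_lintegral_le_of_le hb0 hb1
  obtain ⟨C, hC⟩ := exists_eLpNorm_lintegral_kernel_le hR (α := α) hb0.le
    (e := fun t D => min D (ENNReal.ofReal t)) (by fun_prop)
    (fun t _ _ h => min_le_min_right _ h) hpt'
    (fun r hr => exists_capped_kernel_bound hα0 hαb hr)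
    ⟨C₁, fun D t B ht hB => hC₁ (ENNReal.ofReal t) B (fun ρ => min (D ρ) (ENNReal.ofReal t))
      (by simpa using ht) ENNReal.ofReal_ne_top (fun ρ => min_le_right _ _) hB⟩
  exact ⟨C, fun μ g => by
    rw [lorentzENorm_of_pos hp0]; exact hC _ (levelMeasure_antitone μ g)⟩

theorem exists_eLpNorm_excessIntegral_le.{u} {p R : ℝ≥0∞} (hp0 : p ≠ 0) (hp : p < 1) (hR : R ≠ 0) :
    ∃ C : ℝ≥0, ∀ {X : Type u} [MeasurableSpace X] (μ : Measure X) (g : X → ℝ≥0∞),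
      eLpNorm (fun t => ENNReal.ofReal t ^ (1 / p.toReal - 1) *
        excessIntegral μ (ENNReal.ofReal t) g) R haarHalfLine ≤ C * lorentzENorm p R μ g := by
  have hpt : p ≠ ∞ := (hp.trans ENNReal.one_lt_top).ne
  have hp1 : p.toReal < 1 := by
    simpa using (ENNReal.toReal_lt_toReal hpt ENNReal.one_ne_top).2 hp
  have hp0 : 0 < p.toReal := ENNReal.toReal_pos hp0 hpt
  set α := 1 / p.toReal with hα
  have hα1 : 1 < α := by rw [hα, lt_div_iff₀ hp0]; linarith
  have hα0 : 0 < α := by positivity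
  -- Now `1 < b` is needed for the truncation bound and `b < α` for the kernel bound.
  set b := (α + 1) / 2 with hb
  have hb1 : 1 < b := by rw [hb]; linarith
  have hb0 : 0 < b := by linarith
  have hαb : b < α := by rw [hb]; linarith
  have hmono : ∀ t : ℝ, Monotone fun D : ℝ≥0∞ => if ENNReal.ofReal t < D then D else 0 := by
    intro t x y h
    dsimp only
    split_ifs with h1 h2 h2
    · exact h
    · exact absurd (h1.trans_le h) h2
    · exact zero_le
    · exact le_rfl
  have hpt' : ∀ t > 0, ∀ D : ℝ≥0∞,
      ENNReal.ofReal t ^ (α - b) * (if ENNReal.ofReal t < D then D else 0) ^ b ≤ D ^ α := by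
    intro t ht D
    split_ifs with h
    · rcases eq_or_ne D ∞ with rfl | hDt
      · rw [ENNReal.top_rpow_of_pos hα0]; exact le_top
      have hD0 : D ≠ 0 := (zero_le.trans_lt h).ne'
      calc _ ≤ D ^ (α - b) * D ^ b := by
            gcongr 1
            exact ENNReal.rpow_le_rpow h.le (by linarith)
        _ = D ^ α := by rw [← ENNReal.rpow_add _ _ hD0 hDt, sub_add_cancel]
    · simp [hb0]
  have hE : ∀ (t : ℝ) (D : ℝ≥0∞), (if ENNReal.ofReal t < D then D else 0) ≠ 0 →
      ENNReal.ofReal t ≤ if ENNReal.ofReal t < D then D else 0 := by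
    intro t D h
    split_ifs at h ⊢ with h1
    · exact h1.le
    · exact absurd rfl h
  obtain ⟨C₁, hC₁⟩ := exists_lintegral_le_of_ge hb1
  obtain ⟨C, hC⟩ := exists_eLpNorm_lintegral_kernel_le hR (α := α) hb0.le
    (e := fun t D => if ENNReal.ofReal t < D then D else 0)
    (Measurable.ite (measurableSet_lt (by fun_prop) measurable_snd) measurable_snd
      measurable_const)
    hmono hpt'
    (fun r hr => exists_excess_kernel_bound hb0 hαb hr)
    ⟨C₁, fun D t B ht hB => hC₁ (ENNReal.ofReal t) B
      (fun ρ => if ENNReal.ofReal t < D ρ then D ρ else 0)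
      (by simpa using ht) ENNReal.ofReal_ne_top (fun ρ h => hE t (D ρ) h) hB⟩
  refine ⟨C, fun μ g => ?_⟩
  rw [lorentzENorm_of_pos hp0]
  -- The excess `(D - t)₊` is replaced by the larger `D · 1_{t < D}`, whose nonzero values are at
  -- least `t`.
  refine le_trans (eLpNorm_mono_enorm fun t => ?_) (hC _ (levelMeasure_antitone μ g))
  rw [enorm_eq_self, enorm_eq_self, excessIntegral]
  gcongr with ρ
  split_ifs with h
  · exact tsub_le_self
  · rw [tsub_eq_zero_of_le (not_lt.1 h)]

theorem mul_le_lintegral_of_antitone {F : ℝ → ℝ≥0∞} (hF : Antitone F) {ρ : ℝ} {m : ℝ≥0∞}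
    (h : m ≤ F ρ) :
    ENNReal.ofReal ρ * m ≤ ∫⁻ σ, ENNReal.ofReal σ * F σ ∂haarHalfLine := by
  calc ENNReal.ofReal ρ * m
      = ∫⁻ σ in {σ | ENNReal.ofReal σ ≤ ENNReal.ofReal ρ}, ENNReal.ofReal σ * m
          ∂haarHalfLine := by
        rw [lintegral_mul_const _ ENNReal.measurable_ofReal, setLIntegral_ofReal_le]
    _ ≤ ∫⁻ σ in {σ | ENNReal.ofReal σ ≤ ENNReal.ofReal ρ}, ENNReal.ofReal σ * F σ
          ∂haarHalfLine := by
        refine lintegral_mono_ae ?_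
        filter_upwards [ae_restrict_mem (measurableSet_ofReal_le _),
          ae_restrict_of_ae ae_haarHalfLine_pos] with σ hσ hpos
        gcongr
        refine h.trans (hF ?_)
        have hρ : 0 < ρ := by
          by_contra hneg
          rw [ENNReal.ofReal_of_nonpos (not_lt.1 hneg)] at hσ
          have : ENNReal.ofReal σ = 0 := le_antisymm hσ zero_le
          rw [ENNReal.ofReal_eq_zero] at this
          linarith
        exact (ENNReal.ofReal_le_ofReal_iff hρ.le).1 hσ
    _ ≤ _ := setLIntegral_le_lintegral _ _

theorem exists_lorentzENorm_le_cappedIntegral.{u} {p R : ℝ≥0∞} (hp : 0 < p.toReal) (hR : R ≠ 0) :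
    ∃ C : ℝ≥0, ∀ {X : Type u} [MeasurableSpace X] (μ : Measure X) (g : X → ℝ≥0∞),
      lorentzENorm p R μ g ≤ C * eLpNorm (fun t => ENNReal.ofReal t ^ (1 / p.toReal - 1) *
        cappedIntegral μ (ENNReal.ofReal t) g) R haarHalfLine := by
  obtain ⟨C, hC⟩ := exists_eLpNorm_rpow_le_of_lt_imp hR (α := 1 / p.toReal) (by positivity)
    -- If `μ(g ≥ ρ) > t`, the capped distribution function is at least `t` on `(0, ρ]`.
    (s := 1) one_ne_zero
  refine ⟨C, fun μ g => ?_⟩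
  rw [lorentzENorm_of_pos hp]
  refine hC _ _ (measurable_levelMeasure μ g) fun t ρ _ h => ?_
  rw [ENNReal.coe_one, one_mul] at h
  exact mul_le_lintegral_of_antitone
    (fun x y hxy => min_le_min_right _ (levelMeasure_antitone μ g hxy)) (le_min h.le le_rfl)

theorem exists_lorentzENorm_le_excessIntegral.{u} {p R : ℝ≥0∞} (hp : 0 < p.toReal) (hR : R ≠ 0) :
    ∃ C : ℝ≥0, ∀ {X : Type u} [MeasurableSpace X] (μ : Measure X) (g : X → ℝ≥0∞),
      lorentzENorm p R μ g ≤ C * eLpNorm (fun t => ENNReal.ofReal t ^ (1 / p.toReal - 1) *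
        excessIntegral μ (ENNReal.ofReal t) g) R haarHalfLine := by
  obtain ⟨C, hC⟩ := exists_eLpNorm_rpow_le_of_lt_imp hR (α := 1 / p.toReal) (by positivity)
    -- The factor `2` leaves room for the subtraction: `μ(g ≥ ρ) > 2t` gives an excess of at least
    -- `t`.
    (s := 2) two_ne_zero
  refine ⟨C, fun μ g => ?_⟩
  rw [lorentzENorm_of_pos hp]
  refine hC _ _ (measurable_levelMeasure μ g) fun t ρ _ h => ?_
  refine mul_le_lintegral_of_antitone
    (fun x y hxy => tsub_le_tsub_right (levelMeasure_antitone μ g hxy) _) ?_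
  refine ENNReal.le_sub_of_add_le_right ENNReal.ofReal_ne_top ?_
  rw [← two_mul]
  exact h.le

end Equivalence

/-! ### Countable triangle inequalities and exchange of `ℓ^q` with `L^{p,r}` -/

theorem measurable_cappedIntegral.{u} {X : Type u} [MeasurableSpace X] (μ : Measure X)
    (g : X → ℝ≥0∞) : Measurable fun t => cappedIntegral μ t g :=
  Monotone.measurable fun s t hst => lintegral_mono fun ρ => by dsimp only; gcongr

theorem measurable_excessIntegral.{u} {X : Type u} [MeasurableSpace X] (μ : Measure X)
    (g : X → ℝ≥0∞) : Measurable fun t => excessIntegral μ t g :=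
  Antitone.measurable fun s t hst => lintegral_mono fun ρ => by dsimp only; gcongr

/-- The equivalent expression by `cappedIntegral` is countably subadditive, so one constant serves
for all series. A quasi-triangle inequality alone would lose a factor at every addition. -/
theorem exists_lorentzENorm_tsum_le.{u} {p R : ℝ≥0∞}
    (h : (1 < p ∧ p ≠ ∞ ∧ 1 ≤ R) ∨ (p = 1 ∧ R = 1)) :
    ∃ C : ℝ≥0, ∀ {X : Type u} [MeasurableSpace X] (μ : Measure X) [SigmaFinite μ]
      (g : ℤ → X → ℝ≥0∞), (∀ k, AEMeasurable (g k) μ) →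
      lorentzENorm p R μ (fun x => ∑' k, g k x) ≤ C * ∑' k, lorentzENorm p R μ (g k) := by
  rcases h with ⟨hp, hpt, hR⟩ | ⟨rfl, rfl⟩
  · have hR0 : R ≠ 0 := (zero_lt_one.trans_le hR).ne'
    have hp0 : 0 < p.toReal := ENNReal.toReal_pos (zero_lt_one.trans hp).ne' hpt
    obtain ⟨C₁, hC₁⟩ := exists_lorentzENorm_le_cappedIntegral hp0 hR0
    obtain ⟨C₂, hC₂⟩ := exists_eLpNorm_cappedIntegral_le hp hpt hR0
    refine ⟨C₁ * C₂, fun μ _ g hg => ?_⟩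
    have hm : ∀ k, Measurable fun t => ENNReal.ofReal t ^ (1 / p.toReal - 1) *
        cappedIntegral μ (ENNReal.ofReal t) (g k) := fun k =>
      (ENNReal.measurable_ofReal.pow_const _).mul
        ((measurable_cappedIntegral μ (g k)).comp ENNReal.measurable_ofReal)
    calc _ ≤ (C₁ : ℝ≥0∞) * _ := hC₁ μ _
      _ ≤ C₁ * eLpNorm (fun t => ∑' k, ENNReal.ofReal t ^ (1 / p.toReal - 1) *
            cappedIntegral μ (ENNReal.ofReal t) (g k)) R haarHalfLine := by
          gcongr
          refine eLpNorm_mono_enorm fun t => ?_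
          rw [enorm_eq_self, enorm_eq_self, ENNReal.tsum_mul_left]
          gcongr
          exact cappedIntegral_tsum_le hg _
      _ ≤ C₁ * ∑' k, C₂ * lorentzENorm p R μ (g k) := by
          gcongr
          exact (eLpNorm_tsum_le_ennreal hR fun k => (hm k).aemeasurable).trans
            (ENNReal.tsum_le_tsum fun k => hC₂ μ (g k))
      _ = _ := by rw [ENNReal.tsum_mul_left, ENNReal.coe_mul, mul_assoc]
  · refine ⟨1, fun μ _ g hg => ?_⟩
    rw [lorentzENorm_one_one (AEMeasurable.tsum hg), lintegral_tsum hg, ENNReal.coe_one, one_mul]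
    exact ENNReal.tsum_le_tsum fun k => (lorentzENorm_one_one (hg k)).ge

/-- Superadditivity is used twice: for `excessIntegral` at each `t`, and for the `L^R` quasi-norm in
`t`. -/
theorem exists_tsum_lorentzENorm_le.{u} {p R : ℝ≥0∞}
    (h : (p ≠ 0 ∧ p < 1 ∧ R ≠ 0 ∧ R ≤ 1) ∨ (p = 1 ∧ R = 1)) :
    ∃ C : ℝ≥0, ∀ {X : Type u} [MeasurableSpace X] (μ : Measure X) [SigmaFinite μ]
      (g : ℤ → X → ℝ≥0∞), (∀ k, AEMeasurable (g k) μ) →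
      ∑' k, lorentzENorm p R μ (g k) ≤ C * lorentzENorm p R μ (fun x => ∑' k, g k x) := by
  rcases h with ⟨hp0, hp, hR0, hR⟩ | ⟨rfl, rfl⟩
  · have hp0' : 0 < p.toReal := ENNReal.toReal_pos hp0 (hp.trans ENNReal.one_lt_top).ne
    obtain ⟨C₁, hC₁⟩ := exists_lorentzENorm_le_excessIntegral hp0' hR0
    obtain ⟨C₂, hC₂⟩ := exists_eLpNorm_excessIntegral_le hp0 hp hR0
    refine ⟨C₁ * C₂, fun μ _ g hg => ?_⟩
    have hm : ∀ k, Measurable fun t => ENNReal.ofReal t ^ (1 / p.toReal - 1) *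
        excessIntegral μ (ENNReal.ofReal t) (g k) := fun k =>
      (ENNReal.measurable_ofReal.pow_const _).mul
        ((measurable_excessIntegral μ (g k)).comp ENNReal.measurable_ofReal)
    calc ∑' k, lorentzENorm p R μ (g k) ≤ ∑' k, (C₁ : ℝ≥0∞) * _ :=
          ENNReal.tsum_le_tsum fun k => hC₁ μ (g k)
      _ ≤ C₁ * eLpNorm (fun t => ∑' k, ENNReal.ofReal t ^ (1 / p.toReal - 1) *
            excessIntegral μ (ENNReal.ofReal t) (g k)) R haarHalfLine := by
          rw [ENNReal.tsum_mul_left]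
          gcongr
          exact tsum_eLpNorm_le_of_le_one hR0 hR fun k => (hm k).aemeasurable
      _ ≤ C₁ * eLpNorm (fun t => ENNReal.ofReal t ^ (1 / p.toReal - 1) *
            excessIntegral μ (ENNReal.ofReal t) fun x => ∑' k, g k x) R haarHalfLine := by
          gcongr
          refine eLpNorm_mono_enorm fun t => ?_
          rw [enorm_eq_self, enorm_eq_self, ENNReal.tsum_mul_left]
          gcongr
          exact tsum_excessIntegral_le hg ENNReal.ofReal_ne_top
      _ ≤ C₁ * (C₂ * _) := by gcongr; exact hC₂ μ _
      _ = _ := by rw [ENNReal.coe_mul, mul_assoc]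
  · refine ⟨1, fun μ _ g hg => ?_⟩
    rw [lorentzENorm_one_one (AEMeasurable.tsum hg), lintegral_tsum hg, ENNReal.coe_one, one_mul]
    exact ENNReal.tsum_le_tsum fun k => (lorentzENorm_one_one (hg k)).le

theorem eLpNorm_count_rpow {ι : Type*} [MeasurableSpace ι] [MeasurableSingletonClass ι]
    {q : ℝ≥0∞} (hq0 : q ≠ 0) (hqt : q ≠ ∞) (a : ι → ℝ≥0∞) :
    eLpNorm a q Measure.count ^ q.toReal = ∑' k, a k ^ q.toReal := by
  rw [eLpNorm_eq_lintegral_rpow_enorm_toReal hq0 hqt, ← ENNReal.rpow_mul,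
    one_div_mul_cancel (ENNReal.toReal_pos hq0 hqt).ne', ENNReal.rpow_one, lintegral_count]
  rfl

theorem dyadic_weight_ne_zero (θ : ℝ) (k : ℤ) : ENNReal.ofReal (((2 : ℝ) ^ k) ^ (-θ)) ≠ 0 := by
  simp only [ne_eq, ENNReal.ofReal_eq_zero, not_le]
  positivity

theorem exists_lorentzENorm_dyadicENorm_le.{u} {p q r : ℝ≥0∞} (θ : ℝ)
    (h : (0 < q ∧ q < p ∧ p < ∞ ∧ q ≤ r) ∨ (0 < p ∧ p = q ∧ q = r)) :
    ∃ C : ℝ≥0, ∀ {X : Type u} [MeasurableSpace X] (μ : Measure X) [SigmaFinite μ]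
      (g : ℤ → X → ℝ≥0∞), (∀ k, AEMeasurable (g k) μ) →
      lorentzENorm p r μ (fun x => dyadicENorm θ q fun k => g k x)
        ≤ C * dyadicENorm θ q fun k => lorentzENorm p r μ (g k) := by
  -- By homogeneity the dyadic weights can be absorbed into the functions `g k`.
  suffices H : ∃ C : ℝ≥0, ∀ {X : Type u} [MeasurableSpace X] (μ : Measure X) [SigmaFinite μ]
      (g : ℤ → X → ℝ≥0∞), (∀ k, AEMeasurable (g k) μ) →
      lorentzENorm p r μ (fun x => eLpNorm (fun k => g k x) q Measure.count)
        ≤ C * eLpNorm (fun k => lorentzENorm p r μ (g k)) q Measure.count by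
    obtain ⟨C, hC⟩ := H
    refine ⟨C, fun μ _ g hg => ?_⟩
    have := hC μ (fun k x => ENNReal.ofReal (((2 : ℝ) ^ k) ^ (-θ)) * g k x)
      fun k => (hg k).const_mul _
    simpa only [dyadicENorm, lorentzENorm_const_mul (dyadic_weight_ne_zero θ _) ENNReal.ofReal_ne_top]
      using this
  have hq0 : q ≠ 0 := by
    rcases h with h | ⟨h1, h2, _⟩
    · exact h.1.ne'
    · exact h2 ▸ h1.ne'
  rcases eq_or_ne q ∞ with rfl | hqt
  · obtain ⟨rfl, rfl⟩ : p = ∞ ∧ ∞ = r := by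
      rcases h with h | h
      · exact absurd h.2.1 not_top_lt
      · exact ⟨h.2.1, h.2.2⟩
    refine ⟨1, fun μ _ g _ => ?_⟩
    simp only [eLpNorm_exponent_top, eLpNormEssSup_count, enorm_eq_self, ENNReal.coe_one, one_mul]
    refine lorentzENorm_le_of_ae_le ?_
    filter_upwards [ae_all_iff.2 fun k => ae_le_lorentzENorm_top_top (μ := μ) (g := g k)] with x hx
    exact iSup_mono hx
  · have hq : 0 < q.toReal := ENNReal.toReal_pos hq0 hqt
    have hqr : ENNReal.ofReal q.toReal = q := ENNReal.ofReal_toReal hqt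
    -- The hypotheses say exactly that `p/q > 1` and `r/q ≥ 1`, or that both quotients are `1`.
    obtain ⟨C, hC⟩ := exists_lorentzENorm_tsum_le (p := p / q) (R := r / q) <| by
      rcases h with ⟨_, h2, h3, h4⟩ | ⟨_, rfl, rfl⟩
      · left
        refine ⟨?_, (ENNReal.div_lt_top h3.ne hq0).ne, ?_⟩
        · rw [ENNReal.lt_div_iff_mul_lt (.inl hq0) (.inl hqt), one_mul]; exact h2
        · rw [ENNReal.le_div_iff_mul_le (.inl hq0) (.inl hqt), one_mul]; exact h4
      · right
        exact ⟨ENNReal.div_self hq0 hqt, ENNReal.div_self hq0 hqt⟩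
    have hCt : (C : ℝ≥0∞) ^ q.toReal⁻¹ ≠ ∞ :=
      ENNReal.rpow_ne_top_of_nonneg (by positivity) ENNReal.coe_ne_top
    refine ⟨((C : ℝ≥0∞) ^ q.toReal⁻¹).toNNReal, fun μ _ g hg => ?_⟩
    rw [ENNReal.coe_toNNReal hCt, ← ENNReal.rpow_le_rpow_iff hq,
      ENNReal.mul_rpow_of_nonneg _ _ hq.le, ← ENNReal.rpow_mul, inv_mul_cancel₀ hq.ne',
      ENNReal.rpow_one, eLpNorm_count_rpow hq0 hqt]
    simp only [lorentzENorm_rpow hq, hqr, eLpNorm_count_rpow hq0 hqt]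
    rw [ENNReal.tsum_mul_left, mul_left_comm]
    gcongr
    exact hC μ _ fun k => (hg k).pow_const _

theorem exists_dyadicENorm_lorentzENorm_le.{u} {p q r : ℝ≥0∞} (θ : ℝ)
    (h : (0 < p ∧ p < q ∧ 0 < r ∧ r ≤ q) ∨ (0 < p ∧ p = q ∧ q = r)) :
    ∃ C : ℝ≥0, ∀ {X : Type u} [MeasurableSpace X] (μ : Measure X) [SigmaFinite μ]
      (g : ℤ → X → ℝ≥0∞), (∀ k, AEMeasurable (g k) μ) →
      (dyadicENorm θ q fun k => lorentzENorm p r μ (g k))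
        ≤ C * lorentzENorm p r μ (fun x => dyadicENorm θ q fun k => g k x) := by
  suffices H : ∃ C : ℝ≥0, ∀ {X : Type u} [MeasurableSpace X] (μ : Measure X) [SigmaFinite μ]
      (g : ℤ → X → ℝ≥0∞), (∀ k, AEMeasurable (g k) μ) →
      eLpNorm (fun k => lorentzENorm p r μ (g k)) q Measure.count
        ≤ C * lorentzENorm p r μ (fun x => eLpNorm (fun k => g k x) q Measure.count) by
    obtain ⟨C, hC⟩ := H
    refine ⟨C, fun μ _ g hg => ?_⟩
    have := hC μ (fun k x => ENNReal.ofReal (((2 : ℝ) ^ k) ^ (-θ)) * g k x)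
      fun k => (hg k).const_mul _
    simpa only [dyadicENorm, lorentzENorm_const_mul (dyadic_weight_ne_zero θ _) ENNReal.ofReal_ne_top]
      using this
  have hq0 : q ≠ 0 := by
    rcases h with h | ⟨h1, h2, _⟩
    · exact (h.1.trans h.2.1).ne'
    · exact h2 ▸ h1.ne'
  rcases eq_or_ne q ∞ with rfl | hqt
  -- For `q = ∞` monotonicity is enough: each `g k` lies below the supremum, whatever `p` and `r`
  -- are.
  · refine ⟨1, fun μ _ g _ => ?_⟩
    simp only [eLpNorm_exponent_top, eLpNormEssSup_count, enorm_eq_self, ENNReal.coe_one, one_mul]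
    exact iSup_le fun k => lorentzENorm_mono_ae (.of_forall fun x =>
      le_iSup (fun k => g k x) k)
  · have hq : 0 < q.toReal := ENNReal.toReal_pos hq0 hqt
    have hqr : ENNReal.ofReal q.toReal = q := ENNReal.ofReal_toReal hqt
    obtain ⟨C, hC⟩ := exists_tsum_lorentzENorm_le (p := p / q) (R := r / q) <| by
      rcases h with ⟨h1, h2, h3, h4⟩ | ⟨_, rfl, rfl⟩
      · left
        refine ⟨(ENNReal.div_pos h1.ne' hqt).ne', ?_, (ENNReal.div_pos h3.ne' hqt).ne', ?_⟩
        · rw [ENNReal.div_lt_iff (.inl hq0) (.inl hqt), one_mul]; exact h2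
        · rw [ENNReal.div_le_iff hq0 hqt, one_mul]; exact h4
      · right
        exact ⟨ENNReal.div_self hq0 hqt, ENNReal.div_self hq0 hqt⟩
    have hCt : (C : ℝ≥0∞) ^ q.toReal⁻¹ ≠ ∞ :=
      ENNReal.rpow_ne_top_of_nonneg (by positivity) ENNReal.coe_ne_top
    refine ⟨((C : ℝ≥0∞) ^ q.toReal⁻¹).toNNReal, fun μ _ g hg => ?_⟩
    rw [ENNReal.coe_toNNReal hCt, ← ENNReal.rpow_le_rpow_iff hq,
      ENNReal.mul_rpow_of_nonneg _ _ hq.le, ← ENNReal.rpow_mul, inv_mul_cancel₀ hq.ne',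
      ENNReal.rpow_one, eLpNorm_count_rpow hq0 hqt]
    simp only [lorentzENorm_rpow hq, hqr, eLpNorm_count_rpow hq0 hqt]
    rw [ENNReal.tsum_mul_left, mul_left_comm]
    gcongr
    exact hC μ _ fun k => (hg k).pow_const _

/-! ### Peetre's functional -/

section Peetre

variable {E : Type*}

theorem peetreK_monotone [Add E] (N₀ N₁ : E → ℝ≥0∞) (u : E) :
    Monotone fun s => peetreK N₀ N₁ s u := by
  intro s t hst
  refine iInf_mono fun u₀ => iInf_mono fun u₁ => iInf_mono fun _ => ?_
  gcongr

theorem peetreK_le [Add E] (N₀ N₁ : E → ℝ≥0∞) (s : ℝ) (u₀ u₁ : E) :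
    peetreK N₀ N₁ s (u₀ + u₁) ≤ N₀ u₀ + ENNReal.ofReal s * N₁ u₁ :=
  iInf_le_of_le u₀ (iInf_le_of_le u₁ (iInf_le _ rfl))

theorem exists_of_peetreK_lt [Add E] {N₀ N₁ : E → ℝ≥0∞} {s : ℝ} {u : E} {d : ℝ≥0∞}
    (h : peetreK N₀ N₁ s u < d) :
    ∃ u₀ u₁, u₀ + u₁ = u ∧ N₀ u₀ + ENNReal.ofReal s * N₁ u₁ < d := by
  simp only [peetreK, iInf_lt_iff] at h
  obtain ⟨u₀, u₁, h, hlt⟩ := h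
  exact ⟨u₀, u₁, h, hlt⟩

theorem peetreK_le_mul [Add E] (N₀ N₁ : E → ℝ≥0∞) {s t : ℝ} (ht : 0 < t) (u : E) :
    peetreK N₀ N₁ s u ≤ ENNReal.ofReal (max 1 (s / t)) * peetreK N₀ N₁ t u := by
  have h1 : (1 : ℝ≥0∞) ≤ ENNReal.ofReal (max 1 (s / t)) := by
    rw [← ENNReal.ofReal_one]; exact ENNReal.ofReal_le_ofReal (le_max_left _ _)
  have h2 : ENNReal.ofReal s ≤ ENNReal.ofReal (max 1 (s / t)) * ENNReal.ofReal t := by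
    rw [← ENNReal.ofReal_mul (by positivity)]
    refine ENNReal.ofReal_le_ofReal ?_
    rw [← div_le_iff₀ ht]
    exact le_max_right _ _
  refine ENNReal.le_of_forall_pos_le_add fun ε hε hlt => ?_
  set c := ENNReal.ofReal (max 1 (s / t)) with hc
  have hct : c ≠ ∞ := ENNReal.ofReal_ne_top
  have hc0 : c ≠ 0 := (zero_lt_one.trans_le h1).ne'
  have hK : peetreK N₀ N₁ t u ≠ ∞ := fun h => by
    rw [h, ENNReal.mul_top hc0] at hlt; exact lt_irrefl _ hlt
  have hε' : (ε : ℝ≥0∞) / c ≠ 0 := (ENNReal.div_pos (by simpa using hε.ne') hct).ne'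
  obtain ⟨u₀, u₁, rfl, h⟩ := exists_of_peetreK_lt (ENNReal.lt_add_right hK hε')
  calc _ ≤ N₀ u₀ + ENNReal.ofReal s * N₁ u₁ := peetreK_le _ _ _ _ _
    _ ≤ c * N₀ u₀ + c * ENNReal.ofReal t * N₁ u₁ := by
        gcongr
        exact le_mul_of_one_le_left zero_le h1
    _ = c * (N₀ u₀ + ENNReal.ofReal t * N₁ u₁) := by ring
    _ ≤ c * (peetreK N₀ N₁ t (u₀ + u₁) + ε / c) := by gcongr
    _ = _ := by rw [mul_add, ENNReal.mul_div_cancel hc0 hct]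

theorem inducedENorm_apply_le {A U : Type*} [ENorm A] (ι : A → U) (a : A) :
    inducedENorm ι (ι a) ≤ ‖a‖ₑ :=
  iInf_le_of_le a (iInf_le _ rfl)

theorem exists_of_inducedENorm_ne_top {A U : Type*} [ENorm A] {ι : A → U}
    (hι : Function.Injective ι) {u : U} (h : inducedENorm ι u ≠ ∞) :
    ∃ a, ι a = u ∧ ‖a‖ₑ = inducedENorm ι u := by
  have h' := lt_top_iff_ne_top.2 h
  simp only [inducedENorm, iInf_lt_iff] at h'
  obtain ⟨a, rfl, -⟩ := h'
  refine ⟨a, rfl, le_antisymm (le_iInf₂ fun a' ha' => ?_) (inducedENorm_apply_le ι a)⟩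
  rw [hι ha']

end Peetre

/-! ### The sum space `A₀ + A₁` of a compatible couple -/

namespace CompatibleCouple

variable {𝕜 A₀ A₁ U : Type*} [RCLike 𝕜]
  [NormedAddCommGroup A₀] [NormedSpace 𝕜 A₀] [NormedAddCommGroup A₁] [NormedSpace 𝕜 A₁]
  [AddCommGroup U] [Module 𝕜 U] [TopologicalSpace U] (c : CompatibleCouple 𝕜 A₀ A₁ U)

theorem K_le (s : ℝ) (a : A₀) (b : A₁) :
    c.K s (c.ι₀ a + c.ι₁ b) ≤ ‖a‖ₑ + ENNReal.ofReal s * ‖b‖ₑ := by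
  refine (peetreK_le _ _ _ _ _).trans ?_
  gcongr <;> exact inducedENorm_apply_le _ _

theorem K_zero (s : ℝ) : c.K s 0 = 0 := by
  simpa using c.K_le s 0 0

variable {c}

theorem exists_of_K_lt {s : ℝ} (hs : 0 < s) {u : U} {d : ℝ≥0∞} (h : c.K s u < d) :
    ∃ a b, c.ι₀ a + c.ι₁ b = u ∧ ‖a‖ₑ + ENNReal.ofReal s * ‖b‖ₑ < d := by
  obtain ⟨u₀, u₁, rfl, hlt⟩ := exists_of_peetreK_lt h
  have hs0 : ENNReal.ofReal s ≠ 0 := by simpa using hs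
  have h2 := ENNReal.add_ne_top.1 hlt.ne_top
  obtain ⟨a, rfl, ha⟩ := exists_of_inducedENorm_ne_top c.injective₀ h2.1
  obtain ⟨b, rfl, hb⟩ := exists_of_inducedENorm_ne_top c.injective₁ (u := u₁) fun h => by
    rw [h, ENNReal.mul_top hs0] at h2; exact h2.2 rfl
  exact ⟨a, b, rfl, by rwa [ha, hb]⟩

theorem K_add_le {s : ℝ} (hs : 0 < s) (u v : U) : c.K s (u + v) ≤ c.K s u + c.K s v := by
  refine ENNReal.le_of_forall_pos_le_add fun ε hε hlt => ?_
  have hne := ENNReal.add_ne_top.1 hlt.ne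
  have hε2 : (ε : ℝ≥0∞) / 2 ≠ 0 := by simpa using hε.ne'
  obtain ⟨a, b, rfl, h⟩ := exists_of_K_lt hs (ENNReal.lt_add_right hne.1 hε2)
  obtain ⟨a', b', rfl, h'⟩ := exists_of_K_lt hs (ENNReal.lt_add_right hne.2 hε2)
  calc _ = c.K s (c.ι₀ (a + a') + c.ι₁ (b + b')) := by
        congr 1; rw [map_add, map_add]; abel
    _ ≤ ‖a + a'‖ₑ + ENNReal.ofReal s * ‖b + b'‖ₑ := c.K_le _ _ _
    _ ≤ (‖a‖ₑ + ‖a'‖ₑ) + ENNReal.ofReal s * (‖b‖ₑ + ‖b'‖ₑ) := by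
        gcongr <;> exact enorm_add_le _ _
    _ = (‖a‖ₑ + ENNReal.ofReal s * ‖b‖ₑ) + (‖a'‖ₑ + ENNReal.ofReal s * ‖b'‖ₑ) := by ring
    _ ≤ (_ + ε / 2) + (_ + ε / 2) := add_le_add h.le h'.le
    _ = _ := by rw [add_add_add_comm, ENNReal.add_halves]

theorem K_neg_le {s : ℝ} (hs : 0 < s) (u : U) : c.K s (-u) ≤ c.K s u := by
  refine ENNReal.le_of_forall_pos_le_add fun ε hε hlt => ?_
  obtain ⟨a, b, rfl, h⟩ := exists_of_K_lt hs
    (ENNReal.lt_add_right hlt.ne (by simpa using hε.ne' : (ε : ℝ≥0∞) ≠ 0))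
  calc _ = c.K s (c.ι₀ (-a) + c.ι₁ (-b)) := by
        congr 1; rw [map_neg, map_neg]; abel
    _ ≤ ‖-a‖ₑ + ENNReal.ofReal s * ‖-b‖ₑ := c.K_le _ _ _
    _ ≤ _ := by rw [enorm_neg, enorm_neg]; exact h.le

theorem K_sub_comm {s : ℝ} (hs : 0 < s) (u v : U) : c.K s (u - v) = c.K s (v - u) :=
  le_antisymm (by simpa using K_neg_le (c := c) hs (v - u))
    (by simpa using K_neg_le (c := c) hs (u - v))

theorem K_sub_le {s : ℝ} (hs : 0 < s) (u v w : U) :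
    c.K s (u - w) ≤ c.K s (u - v) + c.K s (v - w) := by
  simpa using K_add_le (c := c) hs (u - v) (v - w)

/-- The functionals `K(s, ·)`, `s > 0`, are mutually equivalent, so measurability defined through
`K(1, ·)` can be used at every scale. -/
theorem tendsto_K_of_tendsto_K {ι : Type*} {l : Filter ι} {s t : ℝ} (ht : 0 < t) {u : ι → U}
    (h : Tendsto (fun i => c.K t (u i)) l (𝓝 0)) : Tendsto (fun i => c.K s (u i)) l (𝓝 0) := by
  have h2 := ENNReal.Tendsto.const_mul h (a := ENNReal.ofReal (max 1 (s / t)))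
    (.inr ENNReal.ofReal_ne_top)
  rw [mul_zero] at h2
  exact tendsto_of_tendsto_of_tendsto_of_le_of_le tendsto_const_nhds h2 (fun _ => zero_le)
    fun i => peetreK_le_mul _ _ ht _

theorem K_ne_top_of_K_ne_top {s t : ℝ} (ht : 0 < t) {u : U} (h : c.K t u ≠ ∞) : c.K s u ≠ ∞ :=
  ne_top_of_le_ne_top (ENNReal.mul_ne_top ENNReal.ofReal_ne_top h) (peetreK_le_mul _ _ ht _)

variable [IsTopologicalAddGroup U]

/-- Continuity of `A₀ + A₁ → U`: nearly optimal splittings have both components tending to zero in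
norm, and the two embeddings are continuous. -/
theorem tendsto_zero_of_tendsto_K {s : ℝ} (hs : 0 < s) {u : ℕ → U}
    (h : Tendsto (fun n => c.K s (u n)) atTop (𝓝 0)) : Tendsto u atTop (𝓝 0) := by
  have h1 := tendsto_K_of_tendsto_K (s := 1) hs h
  have hfin : ∀ᶠ n in atTop, c.K 1 (u n) < ∞ :=
    h1.eventually_lt_const ENNReal.zero_lt_top
  have hex : ∀ n, ∃ z : A₀ × A₁, c.K 1 (u n) ≠ ∞ → c.ι₀ z.1 + c.ι₁ z.2 = u n ∧
      ‖z.1‖ₑ + ‖z.2‖ₑ ≤ c.K 1 (u n) + (n : ℝ≥0∞)⁻¹ := by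
    intro n
    by_cases hn : c.K 1 (u n) = ∞
    · exact ⟨0, fun h => absurd hn h⟩
    · obtain ⟨a, b, h1, h2⟩ := exists_of_K_lt one_pos (ENNReal.lt_add_right hn
        (ENNReal.inv_ne_zero.2 (ENNReal.natCast_ne_top n)))
      exact ⟨(a, b), fun _ => ⟨h1, by simpa using h2.le⟩⟩
  choose z hz using hex
  have hlim : Tendsto (fun n : ℕ => c.K 1 (u n) + (n : ℝ≥0∞)⁻¹) atTop (𝓝 0) := by
    simpa using h1.add ENNReal.tendsto_inv_nat_nhds_zero
  have ha : Tendsto (fun n => (z n).1) atTop (𝓝 0) := by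
    rw [tendsto_zero_iff_enorm_tendsto_zero]
    refine tendsto_of_tendsto_of_tendsto_of_le_of_le' tendsto_const_nhds hlim
      (.of_forall fun _ => zero_le) ?_
    filter_upwards [hfin] with n hn
    exact le_self_add.trans (hz n hn.ne).2
  have hb : Tendsto (fun n => (z n).2) atTop (𝓝 0) := by
    rw [tendsto_zero_iff_enorm_tendsto_zero]
    refine tendsto_of_tendsto_of_tendsto_of_le_of_le' tendsto_const_nhds hlim
      (.of_forall fun _ => zero_le) ?_
    filter_upwards [hfin] with n hn
    exact le_add_self.trans (hz n hn.ne).2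
  have hsum : Tendsto (fun n => c.ι₀ (z n).1 + c.ι₁ (z n).2) atTop (𝓝 0) := by
    simpa using ((c.ι₀.continuous.tendsto 0).comp ha).add ((c.ι₁.continuous.tendsto 0).comp hb)
  refine hsum.congr' ?_
  filter_upwards [hfin] with n hn
  exact (hz n hn.ne).1

theorem eq_zero_of_K_eq_zero [T2Space U] {s : ℝ} (hs : 0 < s) {u : U} (h : c.K s u = 0) :
    u = 0 :=
  tendsto_nhds_unique (tendsto_const_nhds (x := u) (f := (atTop : Filter ℕ)))
    (tendsto_zero_of_tendsto_K (c := c) hs (by simp [h]))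

/-- The infimum need not be attained, so a factor `2` is given away; where `K` vanishes this gains
nothing, and `u = 0` is used instead. -/
theorem exists_lift [T2Space U] {s : ℝ} (hs : 0 < s) {u : U} (h : c.K s u ≠ ∞) :
    ∃ z : A₀ × A₁, c.ι₀ z.1 + c.ι₁ z.2 = u ∧
      ‖z.1‖ₑ + ENNReal.ofReal s * ‖z.2‖ₑ ≤ 2 * c.K s u := by
  rcases eq_or_ne (c.K s u) 0 with h0 | h0
  · exact ⟨0, by simp [eq_zero_of_K_eq_zero hs h0], by simp⟩
  · obtain ⟨a, b, h1, h2⟩ := exists_of_K_lt hs (ENNReal.lt_add_right h h0)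
    exact ⟨(a, b), h1, by rw [two_mul]; exact h2.le⟩

end CompatibleCouple

/-! ### Measurable, almost optimal splitting -/

theorem exists_measurable_nat_selection {X : Type*} [MeasurableSpace X] {S : ℕ → Set X}
    (hS : ∀ n, MeasurableSet (S n)) :
    ∃ N : X → ℕ, Measurable N ∧ ∀ x, (∃ n, x ∈ S n) → x ∈ S (N x) := by
  classical
  -- Points outside every `S n` are added to each set so that the least index exists everywhere.
  have hex : ∀ x, ∃ n, x ∈ S n ∪ (⋃ m, S m)ᶜ := by
    intro x
    by_cases h : ∃ n, x ∈ S n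
    · obtain ⟨n, hn⟩ := h
      exact ⟨n, .inl hn⟩
    · exact ⟨0, .inr (by simpa using h)⟩
  refine ⟨fun x => Nat.find (hex x), measurable_find hex fun k =>
    (hS k).union (MeasurableSet.iUnion hS).compl, fun x hx => ?_⟩
  rcases Nat.find_spec (hex x) with h | h
  · exact h
  · exact absurd (Set.mem_iUnion.2 hx) h

namespace CompatibleCouple

variable {𝕜 A₀ A₁ U : Type*} [RCLike 𝕜]
  [NormedAddCommGroup A₀] [NormedSpace 𝕜 A₀] [NormedAddCommGroup A₁] [NormedSpace 𝕜 A₁]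
  [AddCommGroup U] [Module 𝕜 U] [TopologicalSpace U] {c : CompatibleCouple 𝕜 A₀ A₁ U}
  {X : Type*} [MeasurableSpace X] {μ : Measure X} {f : X → U}

/-- `K(s, · - v)` is 1-Lipschitz for `K(s, ·)`, so it passes to the limit from simple functions, for
which no measurable structure on `U` is needed. -/
theorem AEStronglyMeasurableSum.aemeasurable_K_sub (hf : c.AEStronglyMeasurableSum μ f) {s : ℝ}
    (hs : 0 < s) (v : U) : AEMeasurable (fun x => c.K s (f x - v)) μ := by
  obtain ⟨φ, -, hlim⟩ := hf
  refine aemeasurable_of_tendsto_metrizable_ae atTop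
    (f := fun n x => c.K s (φ n x - v)) (fun n => ?_) ?_
  · exact ((φ n).map fun u => c.K s (u - v)).measurable.aemeasurable
  · filter_upwards [hlim] with x hx
    have he := tendsto_K_of_tendsto_K (s := s) one_pos hx
    have h1 : Tendsto (fun n => c.K s (f x - v) - c.K s (f x - φ n x)) atTop
        (𝓝 (c.K s (f x - v))) := by
      simpa using ENNReal.Tendsto.sub (tendsto_const_nhds (x := c.K s (f x - v))) he (.inr (by simp))
    have h2 : Tendsto (fun n => c.K s (f x - φ n x) + c.K s (f x - v)) atTop
        (𝓝 (c.K s (f x - v))) := by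
      simpa using he.add (tendsto_const_nhds (x := c.K s (f x - v)))
    refine tendsto_of_tendsto_of_tendsto_of_le_of_le h1 h2 (fun n => ?_) fun n => ?_
    · exact tsub_le_iff_left.2 (K_sub_le hs _ _ _)
    · refine (K_sub_le hs _ (f x) _).trans ?_
      rw [K_sub_comm hs]

theorem AEStronglyMeasurableSum.aemeasurable_K (hf : c.AEStronglyMeasurableSum μ f) {s : ℝ}
    (hs : 0 < s) : AEMeasurable (fun x => c.K s (f x)) μ := by
  simpa using hf.aemeasurable_K_sub hs 0

theorem aestronglyMeasurableSum_of_ae_eq {g₀ : X → A₀} {g₁ : X → A₁}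
    (h₀ : AEStronglyMeasurable g₀ μ) (h₁ : AEStronglyMeasurable g₁ μ)
    (h : ∀ᵐ x ∂μ, c.ι₀ (g₀ x) + c.ι₁ (g₁ x) = f x) : c.AEStronglyMeasurableSum μ f := by
  set F₀ := h₀.stronglyMeasurable_mk.approx
  set F₁ := h₁.stronglyMeasurable_mk.approx
  refine ⟨fun n => (F₀ n).map c.ι₀ + (F₁ n).map c.ι₁, fun n x => ?_, ?_⟩
  · refine lt_of_le_of_lt (c.K_le 1 (F₀ n x) (F₁ n x)) ?_
    exact ENNReal.add_lt_top.2 ⟨enorm_lt_top, ENNReal.mul_lt_top ENNReal.ofReal_lt_top enorm_lt_top⟩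
  · filter_upwards [h, h₀.ae_eq_mk, h₁.ae_eq_mk] with x hx hx0 hx1
    have t0 := h₀.stronglyMeasurable_mk.tendsto_approx x
    have t1 := h₁.stronglyMeasurable_mk.tendsto_approx x
    rw [← hx0] at t0
    rw [← hx1] at t1
    have s0 : Tendsto (fun n => ‖g₀ x - F₀ n x‖ₑ) atTop (𝓝 0) := by
      rw [← tendsto_zero_iff_enorm_tendsto_zero]
      simpa using (tendsto_const_nhds (x := g₀ x)).sub t0
    have s1 : Tendsto (fun n => ‖g₁ x - F₁ n x‖ₑ) atTop (𝓝 0) := by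
      rw [← tendsto_zero_iff_enorm_tendsto_zero]
      simpa using (tendsto_const_nhds (x := g₁ x)).sub t1
    have s2 := s0.add s1
    rw [add_zero] at s2
    refine tendsto_of_tendsto_of_tendsto_of_le_of_le tendsto_const_nhds s2
      (fun _ => zero_le) fun n => ?_
    have := c.K_le 1 (g₀ x - F₀ n x) (g₁ x - F₁ n x)
    rw [ENNReal.ofReal_one, one_mul] at this
    refine le_trans (le_of_eq ?_) this
    congr 1
    rw [← hx, map_sub, map_sub]
    simp only [SimpleFunc.coe_add, SimpleFunc.coe_map, Pi.add_apply, Function.comp]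
    abel

/-- A strongly measurable function with values in `A₀ + A₁` splits measurably, almost optimally
for a given `K(s, ·)`. -/
theorem AEStronglyMeasurableSum.exists_decomposition [IsTopologicalAddGroup U] [T2Space U]
    [CompleteSpace A₀] [CompleteSpace A₁]
    (hf : c.AEStronglyMeasurableSum μ f) {s : ℝ} (hs : 0 < s) :
    ∃ (g₀ : X → A₀) (g₁ : X → A₁), AEStronglyMeasurable g₀ μ ∧ AEStronglyMeasurable g₁ μ ∧
      (∀ᵐ x ∂μ, c.ι₀ (g₀ x) + c.ι₁ (g₁ x) = f x) ∧
      ∀ᵐ x ∂μ, ‖g₀ x‖ₑ + ENNReal.ofReal s * ‖g₁ x‖ₑ ≤ 16 * c.K s (f x) := by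
  have hKm := fun v => hf.aemeasurable_K_sub hs v
  obtain ⟨φ, hφ, hlim⟩ := hf
  -- The countably many values of the approximating simple functions, with `0`, come arbitrarily
  -- close to `f x` for almost every `x`.
  have hcount : (insert 0 (⋃ n, Set.range (φ n))).Countable :=
    (Set.countable_iUnion fun n => (φ n).finite_range.countable).insert 0
  obtain ⟨d, hd⟩ := hcount.exists_eq_range (Set.insert_nonempty _ _)
  have hdK : ∀ n, c.K s (d n) ≠ ∞ := by
    intro n
    have : d n ∈ insert 0 (⋃ n, Set.range (φ n)) := hd ▸ Set.mem_range_self n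
    rcases this with h | h
    · rw [h, c.K_zero]; simp
    · obtain ⟨m, x, hx⟩ := Set.mem_iUnion.1 h
      rw [← hx]
      exact K_ne_top_of_K_ne_top one_pos (hφ m x).ne
  obtain ⟨i₀, hi₀⟩ : (0 : U) ∈ Set.range d := hd ▸ Set.mem_insert _ _
  have hdφ : ∀ n x, ∃ m, d m = φ n x := by
    intro n x
    have : φ n x ∈ Set.range d :=
      hd ▸ Set.mem_insert_of_mem _ (Set.mem_iUnion.2 ⟨n, Set.mem_range_self x⟩)
    exact this
  set H : ℕ → X → ℝ≥0∞ := fun n => (hKm (d n)).mk _ with hH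
  have hHm : ∀ n, Measurable (H n) := fun n => (hKm (d n)).measurable_mk
  have hHae : ∀ᵐ x ∂μ, ∀ n, c.K s (f x - d n) = H n x :=
    ae_all_iff.2 fun n => (hKm (d n)).ae_eq_mk
  -- Select a value `d n` within `2^(-j) K(s, f x)` of `f x`; the comparison value is `H i₀ x`, a
  -- measurable version of `K(s, f x)` since `d i₀ = 0`.
  have hsel : ∀ j : ℕ, ∃ N : X → ℕ, Measurable N ∧ ∀ x,
      (∃ n, H n x ≤ 2⁻¹ ^ j * H i₀ x) → H (N x) x ≤ 2⁻¹ ^ j * H i₀ x := fun j =>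
    exists_measurable_nat_selection (S := fun n => {x | H n x ≤ 2⁻¹ ^ j * H i₀ x})
      fun n => measurableSet_le (hHm n) ((hHm i₀).const_mul _)
  choose N' hN'm hN' using hsel
  -- The sequence starts at the value `0` so that the increments telescope. This shifts the
  -- tolerances by one place, hence the factor `2` in `hbound`.
  set N : ℕ → X → ℕ := fun j => Nat.casesOn j (fun _ => i₀) N' with hN
  have hNm : ∀ j, Measurable (N j) := by
    rintro (_ | j)
    · exact measurable_const
    · exact hN'm j
  have hbound : ∀ᵐ x ∂μ, ∀ j, c.K s (f x - d (N j x)) ≤ 2 * 2⁻¹ ^ j * c.K s (f x) := by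
    filter_upwards [hHae, hlim] with x hx hl
    have hfx : H i₀ x = c.K s (f x) := by rw [← hx, hi₀, sub_zero]
    rintro (_ | j)
    · change c.K s (f x - d i₀) ≤ _
      rw [hi₀, sub_zero, pow_zero, mul_one]
      exact le_mul_of_one_le_left zero_le (by norm_num)
    · have hex : ∃ n, H n x ≤ 2⁻¹ ^ j * H i₀ x := by
        rw [hfx]
        rcases eq_or_ne (c.K s (f x)) 0 with h0 | h0
        · exact ⟨i₀, by rw [hfx, h0]; simp⟩
        · have hpos : 0 < 2⁻¹ ^ j * c.K s (f x) :=
            ENNReal.mul_pos (pow_ne_zero _ (by simp)) h0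
          obtain ⟨n, hn⟩ := ((tendsto_K_of_tendsto_K (s := s) one_pos hl).eventually_lt_const
            hpos).exists
          obtain ⟨m, hm⟩ := hdφ n x
          exact ⟨m, by rw [← hx, hm]; exact hn.le⟩
      have := hN' j x hex
      rw [← hx, hfx] at this
      refine this.trans (le_of_eq ?_)
      rw [pow_succ, mul_comm _ (2⁻¹ : ℝ≥0∞), ← mul_assoc 2,
        ENNReal.mul_inv_cancel two_ne_zero ENNReal.ofNat_ne_top, one_mul]
  have hfin : ∀ᵐ x ∂μ, c.K s (f x) ≠ ∞ := by
    filter_upwards [hlim] with x hl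
    obtain ⟨n, hn⟩ := ((tendsto_K_of_tendsto_K (s := s) one_pos hl).eventually_lt_const
      ENNReal.zero_lt_top).exists
    have := K_add_le (c := c) hs (f x - φ n x) (φ n x)
    rw [sub_add_cancel] at this
    exact ne_top_of_le_ne_top (ENNReal.add_ne_top.2
      ⟨hn.ne, K_ne_top_of_K_ne_top one_pos (hφ n x).ne⟩) this
  have hdd : ∀ m n, c.K s (d m - d n) ≠ ∞ := fun m n => by
    refine ne_top_of_le_ne_top (ENNReal.add_ne_top.2 ⟨hdK m, hdK n⟩) ?_
    have := K_sub_le (c := c) hs (d m) 0 (d n)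
    rw [sub_zero, zero_sub] at this
    exact this.trans (by gcongr; exact K_neg_le hs _)
  -- Splittings are chosen once for each pair of indices, so composition with the measurable indices
  -- `N j` is automatically measurable.
  choose L hL1 hL2 using fun m n => exists_lift hs (hdd m n)
  set G : ℕ → X → A₀ × A₁ := fun j x => L (N (j + 1) x) (N j x) with hG
  have hG0m : ∀ j, StronglyMeasurable fun x => (G j x).1 := fun j =>
    (StronglyMeasurable.of_discrete (f := fun z : ℕ × ℕ => (L z.1 z.2).1)).comp_measurable
      ((hNm (j + 1)).prodMk (hNm j))
  have hG1m : ∀ j, StronglyMeasurable fun x => (G j x).2 := fun j =>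
    (StronglyMeasurable.of_discrete (f := fun z : ℕ × ℕ => (L z.1 z.2).2)).comp_measurable
      ((hNm (j + 1)).prodMk (hNm j))
  have hGsum : ∀ᵐ x ∂μ, ∑' j, (‖(G j x).1‖ₑ + ENNReal.ofReal s * ‖(G j x).2‖ₑ)
      ≤ 16 * c.K s (f x) := by
    filter_upwards [hbound] with x hx
    -- Each increment has size at most `4 · 2^(-j) K(s, f x)`, its splitting costs another factor
    -- `2`, and the geometric series sums to `2`.
    calc _ ≤ ∑' j : ℕ, 8 * c.K s (f x) * 2⁻¹ ^ j := by
          refine ENNReal.tsum_le_tsum fun j => (hL2 _ _).trans ?_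
          have h1 : c.K s (d (N (j + 1) x) - d (N j x))
              ≤ 2 * 2⁻¹ ^ j * c.K s (f x) + 2 * 2⁻¹ ^ j * c.K s (f x) := by
            refine (K_sub_le hs _ (f x) _).trans (add_le_add ?_ (hx j))
            rw [K_sub_comm hs]
            refine (hx (j + 1)).trans ?_
            gcongr 2 * ?_ * _
            exact pow_le_pow_of_le_one zero_le (by simp) (Nat.le_succ j)
          calc _ ≤ 2 * (2 * 2⁻¹ ^ j * c.K s (f x) + 2 * 2⁻¹ ^ j * c.K s (f x)) := by gcongr
            _ = _ := by ring
      _ = 16 * c.K s (f x) := by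
          rw [ENNReal.tsum_mul_left, ENNReal.tsum_geometric, ENNReal.one_sub_inv_two, inv_inv]
          ring
  have hs0 : ENNReal.ofReal s ≠ 0 := by simpa using hs
  have hsum0 : ∀ᵐ x ∂μ, Summable fun j => (G j x).1 := by
    filter_upwards [hGsum, hfin] with x hx hxf
    have h1 : ∑' j, ‖(G j x).1‖ₑ ≠ ∞ := ne_top_of_le_ne_top
      (ENNReal.mul_ne_top (by simp) hxf) ((ENNReal.tsum_le_tsum fun j => le_self_add).trans hx)
    exact Summable.of_nnnorm (ENNReal.tsum_coe_ne_top_iff_summable.1 h1)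
  have hsum1 : ∀ᵐ x ∂μ, Summable fun j => (G j x).2 := by
    filter_upwards [hGsum, hfin] with x hx hxf
    have h1 : ∑' j, ENNReal.ofReal s * ‖(G j x).2‖ₑ ≠ ∞ := ne_top_of_le_ne_top
      (ENNReal.mul_ne_top (by simp) hxf) ((ENNReal.tsum_le_tsum fun j => le_add_self).trans hx)
    rw [ENNReal.tsum_mul_left] at h1
    have h2 : ∑' j, ‖(G j x).2‖ₑ ≠ ∞ := fun h => by
      rw [h, ENNReal.mul_top hs0] at h1; exact h1 rfl
    exact Summable.of_nnnorm (ENNReal.tsum_coe_ne_top_iff_summable.1 h2)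
  refine ⟨fun x => ∑' j, (G j x).1, fun x => ∑' j, (G j x).2, ?_, ?_, ?_, ?_⟩
  · refine aestronglyMeasurable_of_tendsto_ae atTop
      (f := fun n x => ∑ j ∈ Finset.range n, (G j x).1) (fun n => ?_) ?_
    · exact (Finset.stronglyMeasurable_fun_sum _ fun j _ => hG0m j).aestronglyMeasurable
    · filter_upwards [hsum0] with x hx using hx.hasSum.tendsto_sum_nat
  · refine aestronglyMeasurable_of_tendsto_ae atTop
      (f := fun n x => ∑ j ∈ Finset.range n, (G j x).2) (fun n => ?_) ?_
    · exact (Finset.stronglyMeasurable_fun_sum _ fun j _ => hG1m j).aestronglyMeasurable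
    · filter_upwards [hsum1] with x hx using hx.hasSum.tendsto_sum_nat
  · filter_upwards [hsum0, hsum1, hbound, hfin] with x h0 h1 hb hxf
    have t0 := ((c.ι₀.continuous.tendsto _).comp h0.hasSum.tendsto_sum_nat).add
      ((c.ι₁.continuous.tendsto _).comp h1.hasSum.tendsto_sum_nat)
    have hpart : ∀ n, c.ι₀ (∑ j ∈ Finset.range n, (G j x).1)
        + c.ι₁ (∑ j ∈ Finset.range n, (G j x).2) = d (N n x) := by
      intro n
      rw [map_sum, map_sum, ← Finset.sum_add_distrib]
      simp only [hG, hL1]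
      rw [Finset.sum_range_sub (fun j => d (N j x))]
      simp [hN, hi₀]
    simp only [Function.comp_def, hpart] at t0
    -- The partial sums converge to `f x` in `U`, because convergence in `A₀ + A₁` implies
    -- convergence in `U`; limits in `U` are unique.
    have t1 : Tendsto (fun n => f x - d (N n x)) atTop (𝓝 0) := by
      refine tendsto_zero_of_tendsto_K (c := c) hs ?_
      have hg : Tendsto (fun n : ℕ => 2 * (2⁻¹ : ℝ≥0∞) ^ n * c.K s (f x)) atTop (𝓝 0) := by
        have h2 := ENNReal.tendsto_pow_atTop_nhds_zero_of_lt_one (r := (2⁻¹ : ℝ≥0∞)) (by simp)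
        have h3 := ENNReal.Tendsto.const_mul h2 (a := 2 * c.K s (f x))
          (.inr (ENNReal.mul_ne_top (by simp) hxf))
        rw [mul_zero] at h3
        refine h3.congr fun n => by ring
      exact tendsto_of_tendsto_of_tendsto_of_le_of_le tendsto_const_nhds hg
        (fun _ => zero_le) hb
    have t2 : Tendsto (fun n => d (N n x)) atTop (𝓝 (f x)) := by
      simpa using (tendsto_const_nhds (x := f x)).sub t1
    exact tendsto_nhds_unique t0 t2
  · filter_upwards [hGsum] with x hx
    refine le_trans ?_ hx
    rw [ENNReal.tsum_add, ENNReal.tsum_mul_left]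
    gcongr <;> exact enorm_tsum_le_tsum_enorm

end CompatibleCouple

/-! ### Dyadic sequences and representatives in Bochner–Lorentz spaces -/

theorem apply_le_eLpNorm_count {ι : Type*} [MeasurableSpace ι] [MeasurableSingletonClass ι]
    {q : ℝ≥0∞} (hq : q ≠ 0) (a : ι → ℝ≥0∞) (k : ι) : a k ≤ eLpNorm a q Measure.count := by
  rcases eq_or_ne q ∞ with rfl | hqt
  · rw [eLpNorm_exponent_top, eLpNormEssSup_count]
    exact le_iSup (fun k => ‖a k‖ₑ) k
  · rw [← ENNReal.rpow_le_rpow_iff (ENNReal.toReal_pos hq hqt), eLpNorm_count_rpow hq hqt]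
    exact ENNReal.le_tsum k

theorem ne_top_of_dyadicENorm_ne_top {θ : ℝ} {q : ℝ≥0∞} (hq : q ≠ 0) {φ : ℤ → ℝ≥0∞}
    (h : dyadicENorm θ q φ ≠ ∞) (k : ℤ) : φ k ≠ ∞ := fun hk => by
  have := ne_top_of_le_ne_top h (apply_le_eLpNorm_count hq _ k)
  rw [hk, ENNReal.mul_top (dyadic_weight_ne_zero θ k)] at this
  exact this rfl

/-- Supplies the errors allowed in nearly optimal splittings: positive at each scale, yet small in
total. -/
theorem exists_pos_dyadicENorm_le (θ : ℝ) {q : ℝ≥0∞} (hq : q ≠ 0) {ε : ℝ≥0∞} (hε : ε ≠ 0) :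
    ∃ δ : ℤ → ℝ≥0∞, (∀ k, δ k ≠ 0) ∧ dyadicENorm θ q δ ≤ ε := by
  suffices H : ∃ η : ℤ → ℝ≥0∞, (∀ k, η k ≠ 0) ∧ eLpNorm η q Measure.count ≤ ε by
    obtain ⟨η, h0, hη⟩ := H
    refine ⟨fun k => η k / ENNReal.ofReal (((2 : ℝ) ^ k) ^ (-θ)),
      fun k => (ENNReal.div_pos (h0 k) ENNReal.ofReal_ne_top).ne', le_of_eq_of_le ?_ hη⟩
    unfold dyadicENorm
    congr 1
    funext k
    rw [ENNReal.mul_div_cancel (dyadic_weight_ne_zero θ k) ENNReal.ofReal_ne_top]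
  rcases eq_or_ne q ∞ with rfl | hqt
  · refine ⟨fun _ => ε, fun _ => hε, ?_⟩
    rw [eLpNorm_exponent_top, eLpNormEssSup_count]
    exact iSup_le fun _ => le_rfl
  · have hq' := ENNReal.toReal_pos hq hqt
    have hε' : ε ^ q.toReal ≠ 0 := by
      rw [ne_eq, ENNReal.rpow_eq_zero_iff_of_pos hq']; exact hε
    obtain ⟨η, h0, hη⟩ := ENNReal.exists_pos_sum_of_countable' hε' ℤ
    refine ⟨fun k => η k ^ q.toReal⁻¹, fun k => ?_, ?_⟩
    · rw [ne_eq, ENNReal.rpow_eq_zero_iff_of_pos (inv_pos.2 hq')]; exact (h0 k).ne'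
    · rw [← ENNReal.rpow_le_rpow_iff hq', eLpNorm_count_rpow hq hqt]
      simpa [← ENNReal.rpow_mul, inv_mul_cancel₀ hq'.ne'] using hη.le

theorem dyadicENorm_add_le (θ : ℝ) (q : ℝ≥0∞) (φ ψ : ℤ → ℝ≥0∞) :
    dyadicENorm θ q (fun k => φ k + ψ k)
      ≤ q.LpAddConst * (dyadicENorm θ q φ + dyadicENorm θ q ψ) := by
  unfold dyadicENorm
  simp only [mul_add (ENNReal.ofReal _)]
  have hm : ∀ a : ℤ → ℝ≥0∞, AEStronglyMeasurable a Measure.count :=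
    fun a => (StronglyMeasurable.of_discrete (f := a)).aestronglyMeasurable
  exact eLpNorm_add_le' (hm _) (hm _) q

theorem lorentzBochnerENorm_le {X A U : Type*} [MeasurableSpace X] [NormedAddCommGroup A]
    {ι : A → U} {p r : ℝ≥0∞} {μ : Measure X} {u : X → U} {g : X → A}
    (hg : AEStronglyMeasurable g μ) (h : (fun x => ι (g x)) =ᵐ[μ] u) :
    lorentzBochnerENorm ι p r μ u ≤ lorentzENorm p r μ fun x => ‖g x‖ₑ :=
  iInf_le_of_le g (iInf_le_of_le hg (iInf_le _ h))

/-- Injectivity of `ι` makes the representative unique almost everywhere, so the infimum is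
attained. -/
theorem exists_of_lorentzBochnerENorm_ne_top {X A U : Type*} [MeasurableSpace X]
    [NormedAddCommGroup A] {ι : A → U} (hι : Function.Injective ι) {p r : ℝ≥0∞} {μ : Measure X}
    {u : X → U} (h : lorentzBochnerENorm ι p r μ u ≠ ∞) :
    ∃ g : X → A, AEStronglyMeasurable g μ ∧ (fun x => ι (g x)) =ᵐ[μ] u ∧
      (lorentzENorm p r μ fun x => ‖g x‖ₑ) = lorentzBochnerENorm ι p r μ u := by
  have h' := lt_top_iff_ne_top.2 h
  simp only [lorentzBochnerENorm, iInf_lt_iff] at h'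
  obtain ⟨g, hg, hgu, -⟩ := h'
  refine ⟨g, hg, hgu, le_antisymm (le_iInf fun g' => le_iInf fun _ => le_iInf fun hg' => ?_)
    (lorentzBochnerENorm_le hg hgu)⟩
  refine lorentzENorm_mono_ae ?_
  filter_upwards [hgu, hg'] with x h1 h2
  rw [hι (h1.trans h2.symm)]

/-! ### The two inclusions -/

namespace CompatibleCouple

section

variable {𝕜 A₀ A₁ U : Type*} [RCLike 𝕜]
  [NormedAddCommGroup A₀] [NormedSpace 𝕜 A₀] [NormedAddCommGroup A₁] [NormedSpace 𝕜 A₁]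
  [AddCommGroup U] [Module 𝕜 U] [TopologicalSpace U] {c : CompatibleCouple 𝕜 A₀ A₁ U}
  {X : Type*} [MeasurableSpace X] {μ : Measure X} {f : X → U} {p r : ℝ≥0∞}

/-- Peetre's functional of the couple `L^{p,r}(X; A₀)`, `L^{p,r}(X; A₁)`. -/
noncomputable def lorentzK (c : CompatibleCouple 𝕜 A₀ A₁ U) (p r : ℝ≥0∞) (μ : Measure X) (s : ℝ)
    (f : X → U) : ℝ≥0∞ :=
  peetreK (lorentzBochnerENorm c.ι₀ p r μ) (lorentzBochnerENorm c.ι₁ p r μ) s f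

theorem exists_of_lorentzK_lt {s : ℝ} (hs : 0 < s) {d : ℝ≥0∞} (h : c.lorentzK p r μ s f < d) :
    ∃ (g₀ : X → A₀) (g₁ : X → A₁), AEStronglyMeasurable g₀ μ ∧ AEStronglyMeasurable g₁ μ ∧
      (∀ᵐ x ∂μ, c.ι₀ (g₀ x) + c.ι₁ (g₁ x) = f x) ∧
      (lorentzENorm p r μ fun x => ‖g₀ x‖ₑ) +
        ENNReal.ofReal s * (lorentzENorm p r μ fun x => ‖g₁ x‖ₑ) < d := by
  obtain ⟨u₀, u₁, rfl, hlt⟩ := exists_of_peetreK_lt h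
  have hs0 : ENNReal.ofReal s ≠ 0 := by simpa using hs
  have h2 := ENNReal.add_ne_top.1 hlt.ne_top
  obtain ⟨g₀, hm₀, he₀, h₀⟩ := exists_of_lorentzBochnerENorm_ne_top c.injective₀ h2.1
  obtain ⟨g₁, hm₁, he₁, h₁⟩ := exists_of_lorentzBochnerENorm_ne_top c.injective₁ (u := u₁)
    fun h => by rw [h, ENNReal.mul_top hs0] at h2; exact h2.2 rfl
  refine ⟨g₀, g₁, hm₀, hm₁, ?_, by rwa [h₀, h₁]⟩
  filter_upwards [he₀, he₁] with x h3 h4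
  rw [Pi.add_apply, ← h3, ← h4]

theorem lorentzK_le_of_decomposition {s : ℝ} {g₀ : X → A₀} {g₁ : X → A₁}
    (h₀ : AEStronglyMeasurable g₀ μ) (h₁ : AEStronglyMeasurable g₁ μ)
    (h : ∀ᵐ x ∂μ, c.ι₀ (g₀ x) + c.ι₁ (g₁ x) = f x) :
    c.lorentzK p r μ s f ≤ (lorentzENorm p r μ fun x => ‖g₀ x‖ₑ) +
      ENNReal.ofReal s * (lorentzENorm p r μ fun x => ‖g₁ x‖ₑ) := by
  -- The second summand is `f - ι₀ ∘ g₀` rather than `ι₁ ∘ g₁`, because Peetre's functional asks for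
  -- an identity at every point.
  have := peetreK_le (lorentzBochnerENorm c.ι₀ p r μ) (lorentzBochnerENorm c.ι₁ p r μ) s
    (fun x => c.ι₀ (g₀ x)) (fun x => f x - c.ι₀ (g₀ x))
  have e : ((fun x => c.ι₀ (g₀ x)) + fun x => f x - c.ι₀ (g₀ x)) = f := by
    funext x; simp
  rw [e] at this
  refine this.trans ?_
  gcongr
  · exact lorentzBochnerENorm_le h₀ .rfl
  · refine lorentzBochnerENorm_le h₁ ?_
    filter_upwards [h] with x hx
    rw [← hx, add_sub_cancel_left]

end

/-- Split `f` almost optimally in the Lorentz couple at each scale `2^k`. Off a single null set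
these splittings bound `K(2^k, f x)` by `G k x`, and `L^{p,r}(ℓ^q)` is then estimated by
`ℓ^q(L^{p,r})`. -/
theorem exists_lorentzOfInterp_le.{u, v, w₀, w₁, w} {p q r : ℝ≥0∞} {θ : ℝ} (hθ : 0 ≤ θ)
    (h : (0 < q ∧ q < p ∧ p < ∞ ∧ q ≤ r) ∨ (0 < p ∧ p = q ∧ q = r)) :
    ∃ C : ℝ≥0, ∀ {𝕜 : Type v} {X : Type u} {A₀ : Type w₀} {A₁ : Type w₁} {U : Type w} [RCLike 𝕜]
      [MeasurableSpace X] (μ : Measure X) [SigmaFinite μ]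
      [NormedAddCommGroup A₀] [NormedSpace 𝕜 A₀] [NormedAddCommGroup A₁] [NormedSpace 𝕜 A₁]
      [AddCommGroup U] [Module 𝕜 U] [TopologicalSpace U]
      (c : CompatibleCouple 𝕜 A₀ A₁ U) (f : X → U), c.interpOfLorentz p r μ θ q f < ∞ →
        c.lorentzOfInterp p r μ θ q f ≤ C * c.interpOfLorentz p r μ θ q f := by
  have hq0 : q ≠ 0 := by
    rcases h with h | ⟨h1, h2, _⟩
    · exact h.1.ne'
    · exact h2 ▸ h1.ne'
  obtain ⟨Cd, hCd⟩ := exists_eLpNorm_equiv_dyadicENorm hθ q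
  obtain ⟨Ca, hCa⟩ := exists_lorentzENorm_add_le.{u} p r
  obtain ⟨Ci, hCi⟩ := exists_lorentzENorm_dyadicENorm_le.{u} θ h
  have hL : q.LpAddConst ≠ ∞ := (ENNReal.LpAddConst_lt_top q).ne
  set B : ℝ≥0∞ := (Cd + 1) * (Ci * (Ca * q.LpAddConst)) with hB
  have hBt : B ≠ ∞ := by finiteness
  refine ⟨(B * Cd).toNNReal, fun {𝕜 X A₀ A₁ U} _ _ μ _ _ _ _ _ _ _ _ c f hf => ?_⟩
  rw [ENNReal.coe_toNNReal (by finiteness)]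
  set k₀ : ℤ → ℝ≥0∞ := fun k => c.lorentzK p r μ (2 ^ k) f with hk₀
  have hd : dyadicENorm θ q k₀ ≤ Cd * c.interpOfLorentz p r μ θ q f :=
    (hCd _ (peetreK_monotone _ _ f)).2
  have hdt : dyadicENorm θ q k₀ ≠ ∞ :=
    ne_top_of_le_ne_top (ENNReal.mul_ne_top ENNReal.coe_ne_top hf.ne) hd
  have hk₀t := ne_top_of_dyadicENorm_ne_top hq0 hdt
  suffices H : ∀ ε : ℝ≥0∞, ε ≠ 0 →
      c.lorentzOfInterp p r μ θ q f ≤ B * (dyadicENorm θ q k₀ + ε) by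
    refine le_trans ?_ ((mul_le_mul_right hd B).trans_eq (mul_assoc _ _ _).symm)
    refine ENNReal.le_of_forall_pos_le_add fun ε hε _ => ?_
    refine (H (ε / (B + 1)) (ENNReal.div_pos (by simpa using hε.ne') (by finiteness)).ne').trans ?_
    rw [mul_add]
    gcongr
    calc B * (ε / (B + 1)) ≤ (B + 1) * (ε / (B + 1)) := by gcongr; exact le_self_add
      _ = ε := ENNReal.mul_div_cancel (by simp) (by finiteness)
  intro ε hε
  obtain ⟨δ, hδ0, hδ⟩ := exists_pos_dyadicENorm_le θ hq0 hε
  choose g₀ g₁ hm₀ hm₁ hfg hlt using fun k : ℤ => exists_of_lorentzK_lt (c := c) (f := f)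
    (zpow_pos two_pos k) (ENNReal.lt_add_right (hk₀t k) (hδ0 k))
  -- Any single scale yields strong measurability of `f` in `A₀ + A₁`; scale `1` is used.
  have hfm : c.AEStronglyMeasurableSum μ f :=
    aestronglyMeasurableSum_of_ae_eq (hm₀ 0) (hm₁ 0) (hfg 0)
  set G : ℤ → X → ℝ≥0∞ := fun k x => ‖g₀ k x‖ₑ + ENNReal.ofReal (2 ^ k) * ‖g₁ k x‖ₑ with hG
  have hGm : ∀ k, AEMeasurable (G k) μ := fun k =>
    (hm₀ k).enorm.add ((hm₁ k).enorm.const_mul _)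
  have hpos : ∀ k : ℤ, ENNReal.ofReal ((2 : ℝ) ^ k) ≠ 0 := fun k => by
    simp only [ne_eq, ENNReal.ofReal_eq_zero, not_le]; positivity
  have hGle : ∀ k, lorentzENorm p r μ (G k) ≤ Ca * (k₀ k + δ k) := fun k => by
    refine (hCa μ _ _).trans ?_
    rw [lorentzENorm_const_mul (hpos k) ENNReal.ofReal_ne_top]
    exact mul_le_mul_right (hlt k).le _
  have hpt : ∀ᵐ x ∂μ, c.interp θ q (f x) ≤ Cd * dyadicENorm θ q fun k => G k x := by
    filter_upwards [ae_all_iff.2 hfg] with x hx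
    refine (hCd _ (peetreK_monotone _ _ (f x))).1.trans ?_
    gcongr
    refine dyadicENorm_mono fun k => ?_
    rw [← hx k]
    exact c.K_le _ _ _
  calc c.lorentzOfInterp p r μ θ q f
      ≤ lorentzENorm p r μ fun x => c.interp θ q (f x) := iInf_le _ hfm
    _ ≤ (Cd + 1) * lorentzENorm p r μ fun x => dyadicENorm θ q fun k => G k x :=
        (lorentzENorm_mono_ae hpt).trans lorentzENorm_const_mul_le
    _ ≤ (Cd + 1) * (Ci * dyadicENorm θ q fun k => lorentzENorm p r μ (G k)) := by
        gcongr; exact hCi μ G hGm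
    _ ≤ (Cd + 1) * (Ci * (Ca * dyadicENorm θ q fun k => k₀ k + δ k)) := by
        gcongr
        exact (dyadicENorm_mono hGle).trans (dyadicENorm_const_mul_le ENNReal.coe_ne_top _)
    _ ≤ (Cd + 1) * (Ci * (Ca * (q.LpAddConst * (dyadicENorm θ q k₀ + ε)))) := by
        gcongr
        exact (dyadicENorm_add_le θ q k₀ δ).trans (by gcongr)
    _ = _ := by rw [hB]; ring

/-- Split the values `f x` almost optimally and measurably at each scale `2^k`, then estimate
`ℓ^q(L^{p,r})` by `L^{p,r}(ℓ^q)`. -/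
theorem exists_interpOfLorentz_le.{u, v, w₀, w₁, w} {p q r : ℝ≥0∞} {θ : ℝ} (hθ : 0 ≤ θ)
    (h : (0 < p ∧ p < q ∧ 0 < r ∧ r ≤ q) ∨ (0 < p ∧ p = q ∧ q = r)) :
    ∃ C : ℝ≥0, ∀ {𝕜 : Type v} {X : Type u} {A₀ : Type w₀} {A₁ : Type w₁} {U : Type w} [RCLike 𝕜]
      [MeasurableSpace X] (μ : Measure X) [SigmaFinite μ]
      [NormedAddCommGroup A₀] [NormedSpace 𝕜 A₀] [CompleteSpace A₀]
      [NormedAddCommGroup A₁] [NormedSpace 𝕜 A₁] [CompleteSpace A₁]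
      [AddCommGroup U] [Module 𝕜 U] [TopologicalSpace U] [IsTopologicalAddGroup U] [T2Space U]
      (c : CompatibleCouple 𝕜 A₀ A₁ U) (f : X → U), c.AEStronglyMeasurableSum μ f →
        c.interpOfLorentz p r μ θ q f ≤ C * c.lorentzOfInterp p r μ θ q f := by
  obtain ⟨Cd, hCd⟩ := exists_eLpNorm_equiv_dyadicENorm hθ q
  obtain ⟨Ci, hCi⟩ := exists_dyadicENorm_lorentzENorm_le.{u} θ h
  refine ⟨Cd * (32 * (Ci * (Cd + 1))), fun {𝕜 X A₀ A₁ U} _ _ μ _ _ _ _ _ _ _ _ _ _ _ _ c f hf => ?_⟩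
  have hpos : ∀ k : ℤ, ENNReal.ofReal ((2 : ℝ) ^ k) ≠ 0 := fun k => by
    simp only [ne_eq, ENNReal.ofReal_eq_zero, not_le]; positivity
  have hK : ∀ k : ℤ, c.lorentzK p r μ (2 ^ k) f
      ≤ 32 * lorentzENorm p r μ fun x => c.K (2 ^ k) (f x) := by
    intro k
    obtain ⟨g₀, g₁, hm₀, hm₁, hfg, hle⟩ := hf.exists_decomposition (zpow_pos two_pos k)
    refine (lorentzK_le_of_decomposition hm₀ hm₁ hfg).trans ?_
    rw [← lorentzENorm_const_mul (hpos k) ENNReal.ofReal_ne_top]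
    -- Each component separately is at most `16 K(2^k, f x)`, hence `32`, with no use of the
    -- quasi-triangle inequality.
    calc _ ≤ (lorentzENorm p r μ fun x => 16 * c.K (2 ^ k) (f x))
          + lorentzENorm p r μ fun x => 16 * c.K (2 ^ k) (f x) := by
          refine add_le_add (lorentzENorm_mono_ae ?_) (lorentzENorm_mono_ae ?_)
          · filter_upwards [hle] with x hx using le_self_add.trans hx
          · filter_upwards [hle] with x hx using le_add_self.trans hx
      _ = _ := by
          rw [lorentzENorm_const_mul (by simp) (by simp)]; ring
  have hlow : lorentzENorm p r μ (fun x => dyadicENorm θ q fun k => c.K (2 ^ k) (f x))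
      ≤ (Cd + 1) * c.lorentzOfInterp p r μ θ q f := by
    have e : c.lorentzOfInterp p r μ θ q f = lorentzENorm p r μ fun x => c.interp θ q (f x) :=
      iInf_pos hf
    rw [e]
    refine le_trans (lorentzENorm_mono_ae (.of_forall fun x => ?_)) lorentzENorm_const_mul_le
    exact (hCd _ (peetreK_monotone _ _ (f x))).2
  calc c.interpOfLorentz p r μ θ q f
      ≤ Cd * dyadicENorm θ q fun k => c.lorentzK p r μ (2 ^ k) f :=
        (hCd _ (peetreK_monotone _ _ f)).1
    _ ≤ Cd * (32 * dyadicENorm θ q fun k => lorentzENorm p r μ fun x => c.K (2 ^ k) (f x)) := by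
        gcongr
        exact (dyadicENorm_mono hK).trans (dyadicENorm_const_mul_le (by simp) _)
    _ ≤ Cd * (32 * (Ci * lorentzENorm p r μ
          fun x => dyadicENorm θ q fun k => c.K (2 ^ k) (f x))) := by
        gcongr
        exact hCi μ (fun k x => c.K (2 ^ k) (f x)) fun k => hf.aemeasurable_K (zpow_pos two_pos k)
    _ ≤ Cd * (32 * (Ci * ((Cd + 1) * c.lorentzOfInterp p r μ θ q f))) := by gcongr
    _ = _ := by push_cast; ring

theorem aestronglyMeasurableSum_of_lorentzOfInterp_lt_top {𝕜 A₀ A₁ U X : Type*} [RCLike 𝕜]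
    [NormedAddCommGroup A₀] [NormedSpace 𝕜 A₀] [NormedAddCommGroup A₁] [NormedSpace 𝕜 A₁]
    [AddCommGroup U] [Module 𝕜 U] [TopologicalSpace U] {c : CompatibleCouple 𝕜 A₀ A₁ U}
    [MeasurableSpace X] {μ : Measure X} {f : X → U} {p q r : ℝ≥0∞} {θ : ℝ}
    (h : c.lorentzOfInterp p r μ θ q f < ∞) : c.AEStronglyMeasurableSum μ f := by
  simp only [lorentzOfInterp, iInf_lt_iff] at h
  exact h.1

end CompatibleCouple

theorem theorem2 (p q r : ℝ≥0∞) (θ : ℝ) (hθ₀ : 0 < θ) (hθ₁ : θ < 1) :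
    ∃ C : ℝ≥0, ∀ (𝕜 X A₀ A₁ U : Type*) [RCLike 𝕜]
      [MeasurableSpace X] (μ : Measure X) [SigmaFinite μ]
      [NormedAddCommGroup A₀] [NormedSpace 𝕜 A₀] [CompleteSpace A₀]
      [NormedAddCommGroup A₁] [NormedSpace 𝕜 A₁] [CompleteSpace A₁]
      [AddCommGroup U] [Module 𝕜 U] [TopologicalSpace U] [IsTopologicalAddGroup U]
      [ContinuousSMul 𝕜 U] [T2Space U]
      (c : CompatibleCouple 𝕜 A₀ A₁ U),
      ((0 < q ∧ q < p ∧ p < ∞ ∧ q ≤ r) ∨ (0 < p ∧ p = q ∧ q = r) →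
        ∀ f : X → U, c.interpOfLorentz p r μ θ q f < ∞ →
          c.lorentzOfInterp p r μ θ q f < ∞ ∧
          c.lorentzOfInterp p r μ θ q f ≤ C * c.interpOfLorentz p r μ θ q f) ∧
      ((0 < p ∧ p < q ∧ 0 < r ∧ r ≤ q) ∨ (0 < p ∧ p = q ∧ q = r) →
        ∀ f : X → U, c.lorentzOfInterp p r μ θ q f < ∞ →
          c.interpOfLorentz p r μ θ q f < ∞ ∧
          c.interpOfLorentz p r μ θ q f ≤ C * c.lorentzOfInterp p r μ θ q f) := by
  have hbound : ∀ {a b : ℝ≥0∞} {C D : ℝ≥0}, b < ∞ → C ≤ D → a ≤ C * b → a < ∞ ∧ a ≤ D * b :=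
    fun {a b C D} hb hCD hab => ⟨hab.trans_lt (ENNReal.mul_lt_top ENNReal.coe_lt_top hb),
      hab.trans (by gcongr)⟩
  -- The constant precedes the choice of spaces, so the admissibility of the exponents is decided
  -- first.
  by_cases h₁ : (0 < q ∧ q < p ∧ p < ∞ ∧ q ≤ r) ∨ (0 < p ∧ p = q ∧ q = r) <;>
    by_cases h₂ : (0 < p ∧ p < q ∧ 0 < r ∧ r ≤ q) ∨ (0 < p ∧ p = q ∧ q = r)
  · obtain ⟨C₁, hC₁⟩ := CompatibleCouple.exists_lorentzOfInterp_le hθ₀.le h₁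
    obtain ⟨C₂, hC₂⟩ := CompatibleCouple.exists_interpOfLorentz_le hθ₀.le h₂
    refine ⟨max C₁ C₂, fun 𝕜 X A₀ A₁ U => ?_⟩
    intros
    exact ⟨fun _ f hf => hbound hf (le_max_left _ _) (hC₁ _ _ f hf), fun _ f hf => hbound hf
      (le_max_right _ _) (hC₂ _ _ f
        (CompatibleCouple.aestronglyMeasurableSum_of_lorentzOfInterp_lt_top hf))⟩
  · obtain ⟨C₁, hC₁⟩ := CompatibleCouple.exists_lorentzOfInterp_le hθ₀.le h₁
    refine ⟨C₁, fun 𝕜 X A₀ A₁ U => ?_⟩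
    intros
    exact ⟨fun _ f hf => hbound hf le_rfl (hC₁ _ _ f hf), fun h => absurd h h₂⟩
  · obtain ⟨C₂, hC₂⟩ := CompatibleCouple.exists_interpOfLorentz_le hθ₀.le h₂
    refine ⟨C₂, fun 𝕜 X A₀ A₁ U => ?_⟩
    intros
    exact ⟨fun h => absurd h h₁, fun _ f hf => hbound hf le_rfl (hC₂ _ _ f
        (CompatibleCouple.aestronglyMeasurableSum_of_lorentzOfInterp_lt_top hf))⟩
  · refine ⟨0, fun 𝕜 X A₀ A₁ U => ?_⟩
    intros
    exact ⟨fun h => absurd h h₁, fun h => absurd h h₂⟩
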